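/- **Notation.** Let $k\in\{1,2,4,8\}$ and $n=n_k=3k+2\in\{5,8,14,26\}$, and let $\mathbb R^{n}$ carry the standard Euclidean metric (all indices are written down; repeated indices are summed). Let $e_0=1,e_1,\dots,e_7$ be the unit octonions, with $e_\mu^2=-1$, $e_\mu e_\nu=-e_\nu e_\mu$ for $\mu\ne\nu$, $e_\mu e_{\mu+1}=e_{\mu+3}$ (indices $1,\dots,7$ modulo $7$) and the relations obtained by cyclically permuting the triples $(e_\mu,e_{\mu+1},e_{\mu+3})$. For $x=(x^1,\dots,x^{n})\in\mathbb R^{n}$ put $x^I=0$ for $n<I\le 26$ and $$\begin{aligned}X^1&=x^1e_0+x^6e_1+x^9e_2+x^{10}e_4+x^{15}e_3+x^{16}e_5+x^{17}e_6+x^{18}e_7,\\ X^2&=x^2e_0+x^7e_1+x^{11}e_2+x^{12}e_4+x^{19}e_3+x^{20}e_5+x^{21}e_6+x^{22}e_7,\\ X^3&=x^3e_0+x^8e_1+x^{13}e_2+x^{14}e_4+x^{23}e_3+x^{24}e_5+x^{25}e_6+x^{26}e_7,\end{aligned}$$ $$A=\begin{pmatrix}x^5-\sqrt3\,x^4&\sqrt3\,X^3&\sqrt3\,X^2\\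 \sqrt3\,\overline{X^3}&x^5+\sqrt3\,x^4&\sqrt3\,X^1\\ \sqrt3\,\overline{X^2}&\sqrt3\,\overline{X^1}&-2x^5\end{pmatrix}.$$ Let $\Upsilon_{IJK}$ be the totally symmetric tensor with $\Upsilon_{IJK}x^Ix^Jx^K=\tfrac12\det_1A$, where $$\textstyle\det_1A=a_{11}a_{22}a_{33}-a_{12}a_{21}a_{33}-a_{13}a_{22}a_{31}-a_{11}a_{23}a_{32}+a_{13}(a_{32}a_{21})+(a_{12}a_{23})a_{31}\in\mathbb R .$$ Let $H_k$ be the stabilizer of $\Upsilon$ in $\mathbf{SO}(n_k)$, and let $\mathfrak h_k\subset\Lambda^2\mathbb R^{n_k}=\mathfrak{so}(n_k)$ be its Lie algebra; $\mathfrak h_2$ and $\mathfrak h_8$ are also written $\mathfrak{su}(3)$ and $\mathfrak f_4$. Elements of $\Lambda^2\mathbb R^{n_k}\otimes\mathbb R^{n_k}$ are the tensors $\Gamma_{MJI}$ skew in $M,J$; it contains $\mathfrak h_k\otimes\mathbb R^{n_k}$ and the space $\Lambda^3\mathbb R^{n_k}$ of totally skew tensors. Let $$\Upsilon':\Lambda^2\mathbb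 R^{n_k}\otimes\mathbb R^{n_k}\to\odot^4\mathbb R^{n_k},\qquad \Upsilon'(\Gamma)_{IJKL}=12\,\Gamma_{M(JI}\Upsilon_{KL)M},$$ with symmetrization of total weight one over $I,J,K,L$. Let $\hat\Upsilon$ be the endomorphism $W_{IK}\mapsto4\,\Upsilon_{IJM}\Upsilon_{KLM}W_{JL}$ of $\otimes^2\mathbb R^{n_k}$; let ${}^{8}\odot^2_1$ be its eigenspace with eigenvalue $20$ for $n_k=8$, and ${}^{26}\Lambda^2_{52}$ its eigenspace with eigenvalue $28$ for $n_k=26$. The group $H_k$ acts on all tensor spaces in the natural way. **Proposition.** 1. If $n_k=5$ or $n_k=14$, then $\ker\Upsilon'=[\mathfrak h_k\otimes\mathbb R^{n_k}]\oplus\Lambda^3\mathbb R^{n_k}$ (an internal direct sum). 2. If $n_k=8$, then $\ker\Upsilon'=[\mathfrak{su}(3)\otimes\mathbb R^{8}]+\Lambda^3\mathbb R^{8}$, and the intersection $[\mathfrak{su}(3)\otimes\mathbb R^{8}]\cap\Lambda^3\mathbb R^{8}$ is one-dimensional and isomorphic, as a representation of $H_2$, to ${}^{8}\odot^2_1$.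 3. If $n_k=26$, then $\ker\Upsilon'=[\mathfrak f_4\otimes\mathbb R^{26}]\oplus\Lambda^3\mathbb R^{26}\oplus W$ (an internal direct sum), where $W\subset\Lambda^2\mathbb R^{26}\otimes\mathbb R^{26}$ is a $52$-dimensional $H_8$-invariant subspace isomorphic, as a representation of $H_8$, to ${}^{26}\Lambda^2_{52}$. In particular, $[\mathfrak h_k\otimes\mathbb R^{n_k}]\cap\Lambda^3\mathbb R^{n_k}=\{0\}$ for $n_k=5,14,26$. -/

import Mathlib

open Matrix MvPolynomial

noncomputable section

/-! ### Octonions over a commutative ring -/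

/-- An octonion `re · e₀ + ∑ im μ · e_μ` with coefficients in `R`. The imaginary units
`e₁, …, e₇` are indexed by `ZMod 7`, the unit `e₇` having the index `7 = 0`. -/
@[ext]
structure Octonion (R : Type*) where
  re : R
  im : ZMod 7 → R

namespace Octonion

variable {R : Type*} [CommRing R]

instance : Add (Octonion R) := ⟨fun a b => ⟨a.re + b.re, fun l => a.im l + b.im l⟩⟩

instance : Sub (Octonion R) := ⟨fun a b => ⟨a.re - b.re, fun l => a.im l - b.im l⟩⟩

/-- The product determined by `e_μ² = -1`, `e_μ e_{μ+1} = e_{μ+3}`, `e_μ e_ν = - e_ν e_μ` for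
`μ ≠ ν`, and the relations obtained by cyclically permuting the triples `(e_μ, e_{μ+1}, e_{μ+3})`.
The unit `e_l` occurs in the triples starting with `μ = l - 3`, `μ = l` and `μ = l - 1`. -/
instance : Mul (Octonion R) := ⟨fun a b =>
  ⟨a.re * b.re - ∑ m, a.im m * b.im m,
   fun l => a.re * b.im l + a.im l * b.re
    + (a.im (l - 3) * b.im (l - 2) - a.im (l - 2) * b.im (l - 3))
    + (a.im (l + 1) * b.im (l + 3) - a.im (l + 3) * b.im (l + 1))
    + (a.im (l + 2) * b.im (l - 1) - a.im (l - 1) * b.im (l + 2))⟩⟩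

/-- The scalar `r · e₀`. -/
def ofScalar (r : R) : Octonion R := ⟨r, fun _ => 0⟩

/-- Octonionic conjugation. -/
def conj (a : Octonion R) : Octonion R := ⟨a.re, fun l => - a.im l⟩

/-- The octonion `c₀ e₀ + c₁ e₁ + ⋯ + c₇ e₇`. -/
def mk8 (c₀ c₁ c₂ c₃ c₄ c₅ c₆ c₇ : R) : Octonion R := ⟨c₀, ![c₇, c₁, c₂, c₃, c₄, c₅, c₆]⟩

end Octonion

/-! ### The ternary form -/

/-- The (real) number `det₁ A` for a hermitian `3 × 3` matrix `A` with octonionic entries: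
`a₁₁a₂₂a₃₃ - a₁₂a₂₁a₃₃ - a₁₃a₂₂a₃₁ - a₁₁a₂₃a₃₂ + a₁₃(a₃₂a₂₁) + (a₁₂a₂₃)a₃₁`.
For hermitian `A` this octonion is a multiple of `e₀`, and we return the multiple. -/
def detOne {R : Type*} [CommRing R] (A : Fin 3 → Fin 3 → Octonion R) : R :=
  (A 0 0 * A 1 1 * A 2 2 - A 0 1 * A 1 0 * A 2 2 - A 0 2 * A 1 1 * A 2 0 - A 0 0 * A 1 2 * A 2 1
    + A 0 2 * (A 2 1 * A 1 0) + (A 0 1 * A 1 2) * A 2 0).re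

/-- The coordinate `x^I` of `ℝⁿ`, numbered from `1` to `n`; it is set to zero for `I > n`. -/
def coordX (n I : ℕ) : MvPolynomial (Fin n) ℝ :=
  if h : 1 ≤ I ∧ I ≤ n then X ⟨I - 1, by omega⟩ else 0

/-- The generic element `X¹`. It is real, complex, quaternionic or octonionic
for `n = 5, 8, 14, 26`, respectively; likewise for `X²` and `X³`. -/
def genericOne (n : ℕ) : Octonion (MvPolynomial (Fin n) ℝ) :=
  let x := coordX n
  .mk8 (x 1) (x 6) (x 9) (x 15) (x 10) (x 16) (x 17) (x 18)

/-- The generic element `X²`. -/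
def genericTwo (n : ℕ) : Octonion (MvPolynomial (Fin n) ℝ) :=
  let x := coordX n
  .mk8 (x 2) (x 7) (x 11) (x 19) (x 12) (x 20) (x 21) (x 22)

/-- The generic element `X³`. -/
def genericThree (n : ℕ) : Octonion (MvPolynomial (Fin n) ℝ) :=
  let x := coordX n
  .mk8 (x 3) (x 8) (x 13) (x 23) (x 14) (x 24) (x 25) (x 26)

/-- The generic trace-free hermitian `3 × 3` matrix
`(x⁵ - √3 x⁴, √3 X³, √3 X²; √3 X̄³, x⁵ + √3 x⁴, √3 X¹; √3 X̄², √3 X̄¹, -2 x⁵)`. -/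
def genericHermitian (n : ℕ) : Fin 3 → Fin 3 → Octonion (MvPolynomial (Fin n) ℝ) :=
  let x := coordX n
  let s : MvPolynomial (Fin n) ℝ := C (√3)
  let r : Octonion (MvPolynomial (Fin n) ℝ) := .ofScalar s
  ![![.ofScalar (x 5 - s * x 4), r * genericThree n, r * genericTwo n],
    ![r * (genericThree n).conj, .ofScalar (x 5 + s * x 4), r * genericOne n],
    ![r * (genericTwo n).conj, r * (genericOne n).conj, .ofScalar (-2 * x 5)]]

/-- The cubic form `Υ(x, x, x) = ½ det₁ A`. -/
def upsilonPoly (n : ℕ) : MvPolynomial (Fin n) ℝ :=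
  C (1 / 2) * detOne (genericHermitian n)

/-- The tensor `Υ_{IJK} = (1/6) ∂³Υ(x, x, x) / ∂x^I ∂x^J ∂x^K`
(a constant, as the form is cubic). -/
def upsilon (n : ℕ) (I J K : Fin n) : ℝ :=
  1 / 6 * eval 0 (pderiv I (pderiv J (pderiv K (upsilonPoly n))))

theorem pderiv_pderiv_swap {n : ℕ} (I J : Fin n) (p : MvPolynomial (Fin n) ℝ) :
    pderiv I (pderiv J p) = pderiv J (pderiv I p) := by
  have h : ⁅pderiv (R := ℝ) I, pderiv (R := ℝ) J⁆ = 0 := by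
    apply MvPolynomial.derivation_ext
    intro K
    have h1 : ∀ A B : Fin n, pderiv A (pderiv B (X K : MvPolynomial (Fin n) ℝ)) = 0 := by
      intro A B
      by_cases hB : K = B
      · subst hB; simp
      · rw [pderiv_X_of_ne hB, map_zero]
    rw [Derivation.commutator_apply, h1, h1, sub_zero, Derivation.zero_apply]
  have := congrArg (fun D => D p) h
  simpa [Derivation.commutator_apply, sub_eq_zero] using this

theorem upsilon_swap_left {n : ℕ} (I J K : Fin n) : upsilon n I J K = upsilon n J I K := by
  simp only [upsilon, pderiv_pderiv_swap I J]

theorem upsilon_swap_right {n : ℕ} (I J K : Fin n) : upsilon n I J K = upsilon n I K J := by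
  simp only [upsilon, pderiv_pderiv_swap J K]

/-- The trilinear form `Υ(x, y, z) = Υ_{IJK} x^I y^J z^K`. -/
def upsilonForm (n : ℕ) (x y z : Fin n → ℝ) : ℝ :=
  ∑ I, ∑ J, ∑ K, upsilon n I J K * x I * y J * z K

/-! ### The group `H` and its Lie algebra -/

/-- The stabilizer of `Υ` in `SO(n)`. -/
def stabGroup (n : ℕ) : Subgroup (specialOrthogonalGroup (Fin n) ℝ) where
  carrier := {h | ∀ x y z, upsilonForm n ((h : Matrix (Fin n) (Fin n) ℝ) *ᵥ x)
    ((h : Matrix (Fin n) (Fin n) ℝ) *ᵥ y) ((h : Matrix (Fin n) (Fin n) ℝ) *ᵥ z)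
      = upsilonForm n x y z}
  mul_mem' := by
    intro a b ha hb x y z
    have := ha ((b : Matrix (Fin n) (Fin n) ℝ) *ᵥ x) ((b : Matrix (Fin n) (Fin n) ℝ) *ᵥ y)
      ((b : Matrix (Fin n) (Fin n) ℝ) *ᵥ z)
    simpa [mulVec_mulVec, hb x y z] using this
  one_mem' := by intro x y z; simp
  inv_mem' := by
    intro a ha x y z
    have key : ∀ v, (a : Matrix (Fin n) (Fin n) ℝ) *ᵥ
        (((a⁻¹ : specialOrthogonalGroup (Fin n) ℝ) : Matrix (Fin n) (Fin n) ℝ) *ᵥ v) = v := by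
      intro v
      have h1 : (a : Matrix (Fin n) (Fin n) ℝ) *
          ((a⁻¹ : specialOrthogonalGroup (Fin n) ℝ) : Matrix (Fin n) (Fin n) ℝ) = 1 := by
        exact congrArg Subtype.val (mul_inv_cancel a)
      rw [mulVec_mulVec, h1, one_mulVec]
    have := ha (((a⁻¹ : specialOrthogonalGroup (Fin n) ℝ) : Matrix (Fin n) (Fin n) ℝ) *ᵥ x)
      (((a⁻¹ : specialOrthogonalGroup (Fin n) ℝ) : Matrix (Fin n) (Fin n) ℝ) *ᵥ y)
      (((a⁻¹ : specialOrthogonalGroup (Fin n) ℝ) : Matrix (Fin n) (Fin n) ℝ) *ᵥ z)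
    rw [key, key, key] at this
    exact this.symm

/-- The one-parameter group `exp (t X)` lies in the stabilizer of `Υ`. -/
def ExpMemStab (n : ℕ) (X : Matrix (Fin n) (Fin n) ℝ) : Prop :=
  ∀ t : ℝ, ∃ h ∈ stabGroup n, (h : Matrix (Fin n) (Fin n) ℝ) = NormedSpace.exp (t • X)

section ExpDerivative

attribute [local instance] Matrix.linftyOpNormedRing Matrix.linftyOpNormedAlgebra

theorem hasDerivAt_exp_entry {n : ℕ} (X : Matrix (Fin n) (Fin n) ℝ) (t : ℝ) (i j : Fin n) :
    HasDerivAt (fun u : ℝ => NormedSpace.exp (u • X) i j) ((X * NormedSpace.exp (t • X)) i j) t := by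
  have h := hasDerivAt_exp_smul_const' (𝕂 := ℝ) X t
  let L : Matrix (Fin n) (Fin n) ℝ →ₗ[ℝ] ℝ := Matrix.entryLinearMap ℝ ℝ i j
  exact (LinearMap.toContinuousLinearMap L).hasFDerivAt.comp_hasDerivAt t h

end ExpDerivative

theorem hasDerivAt_exp_mulVec {n : ℕ} (X : Matrix (Fin n) (Fin n) ℝ) (v : Fin n → ℝ) (t : ℝ)
    (i : Fin n) :
    HasDerivAt (fun u : ℝ => (NormedSpace.exp (u • X) *ᵥ v) i)
      ((X *ᵥ (NormedSpace.exp (t • X) *ᵥ v)) i) t := by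
  rw [mulVec_mulVec]
  simp only [mulVec, dotProduct]
  exact HasDerivAt.fun_sum fun j _ => (hasDerivAt_exp_entry X t i j).mul_const (v j)

theorem hasDerivAt_upsilonForm_exp {n : ℕ} (X : Matrix (Fin n) (Fin n) ℝ) (x y z : Fin n → ℝ)
    (t : ℝ) :
    HasDerivAt (fun u : ℝ => upsilonForm n (NormedSpace.exp (u • X) *ᵥ x)
        (NormedSpace.exp (u • X) *ᵥ y) (NormedSpace.exp (u • X) *ᵥ z))
      (upsilonForm n (X *ᵥ (NormedSpace.exp (t • X) *ᵥ x))
          (NormedSpace.exp (t • X) *ᵥ y) (NormedSpace.exp (t • X) *ᵥ z)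
        + upsilonForm n (NormedSpace.exp (t • X) *ᵥ x)
          (X *ᵥ (NormedSpace.exp (t • X) *ᵥ y)) (NormedSpace.exp (t • X) *ᵥ z)
        + upsilonForm n (NormedSpace.exp (t • X) *ᵥ x)
          (NormedSpace.exp (t • X) *ᵥ y) (X *ᵥ (NormedSpace.exp (t • X) *ᵥ z))) t := by
  simp only [upsilonForm, ← Finset.sum_add_distrib]
  refine HasDerivAt.fun_sum fun I _ => HasDerivAt.fun_sum fun J _ => HasDerivAt.fun_sum fun K _ => ?_
  have h := (((hasDerivAt_exp_mulVec X x t I).const_mul (upsilon n I J K)).mul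
    (hasDerivAt_exp_mulVec X y t J)).mul (hasDerivAt_exp_mulVec X z t K)
  refine HasDerivAt.congr_deriv h ?_
  simp only [Pi.mul_apply]
  ring

theorem exp_mem_specialOrthogonalGroup {n : ℕ} {X : Matrix (Fin n) (Fin n) ℝ} (hX : Xᵀ = -X) :
    NormedSpace.exp X ∈ specialOrthogonalGroup (Fin n) ℝ := by
  have horth : ∀ Y : Matrix (Fin n) (Fin n) ℝ, Yᵀ = -Y →
      NormedSpace.exp Y * (NormedSpace.exp Y)ᵀ = 1 := by
    intro Y hY
    rw [← Matrix.exp_transpose, hY, Matrix.exp_neg,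
      Matrix.mul_nonsing_inv _ ((Matrix.isUnit_iff_isUnit_det _).1 (Matrix.isUnit_exp Y))]
  rw [mem_specialOrthogonalGroup_iff, mem_orthogonalGroup_iff]
  refine ⟨horth X hX, ?_⟩
  set Y : Matrix (Fin n) (Fin n) ℝ := (1 / 2 : ℝ) • X with hYdef
  have hY : Yᵀ = -Y := by rw [hYdef, transpose_smul, hX, smul_neg]
  have hXY : X = Y + Y := by rw [hYdef, ← add_smul]; norm_num
  rw [hXY, Matrix.exp_add_of_commute _ _ (Commute.refl Y), det_mul]
  have := congrArg det (horth Y hY)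
  rwa [det_mul, det_transpose, det_one] at this

/-- The infinitesimal description of the Lie algebra of the stabilizer. -/
theorem expMemStab_iff {n : ℕ} (X : Matrix (Fin n) (Fin n) ℝ) :
    ExpMemStab n X ↔ Xᵀ = -X ∧ ∀ x y z, upsilonForm n (X *ᵥ x) y z
      + upsilonForm n x (X *ᵥ y) z + upsilonForm n x y (X *ᵥ z) = 0 := by
  constructor
  · intro h
    constructor
    · ext i j
      have hc : (fun u : ℝ => ∑ k, NormedSpace.exp (u • X) k i * NormedSpace.exp (u • X) k j)
          = fun _ => (1 : Matrix (Fin n) (Fin n) ℝ) i j := by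
        funext u
        obtain ⟨g, -, hg⟩ := h u
        have h1 := ((mem_specialOrthogonalGroup_iff).1 g.2).1
        rw [mem_orthogonalGroup_iff'] at h1
        rw [← hg, ← h1]
        rfl
      have hd := HasDerivAt.fun_sum (u := Finset.univ) fun (k : Fin n) _ =>
        (hasDerivAt_exp_entry X 0 k i).mul (hasDerivAt_exp_entry X 0 k j)
      have hd' : HasDerivAt
          (fun u : ℝ => ∑ k, NormedSpace.exp (u • X) k i * NormedSpace.exp (u • X) k j) _ 0 := hd
      rw [hc] at hd'
      have := hd'.unique (hasDerivAt_const (0 : ℝ) _)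
      simp [NormedSpace.exp_zero, one_apply, Finset.sum_add_distrib] at this
      simp
      linarith
    · intro x y z
      have hc : (fun u : ℝ => upsilonForm n (NormedSpace.exp (u • X) *ᵥ x)
          (NormedSpace.exp (u • X) *ᵥ y) (NormedSpace.exp (u • X) *ᵥ z))
          = fun _ => upsilonForm n x y z := by
        funext u
        obtain ⟨g, hgs, hg⟩ := h u
        rw [← hg]
        exact hgs x y z
      have hd := hasDerivAt_upsilonForm_exp X x y z 0
      rw [hc] at hd
      have := hd.unique (hasDerivAt_const (0 : ℝ) _)
      simpa [NormedSpace.exp_zero] using this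
  · rintro ⟨hX, hU⟩ t
    have hso : NormedSpace.exp (t • X) ∈ specialOrthogonalGroup (Fin n) ℝ :=
      exp_mem_specialOrthogonalGroup (by rw [transpose_smul, hX, smul_neg])
    refine ⟨⟨_, hso⟩, ?_, rfl⟩
    intro x y z
    have hd : ∀ u : ℝ, HasDerivAt (fun u : ℝ => upsilonForm n (NormedSpace.exp (u • X) *ᵥ x)
        (NormedSpace.exp (u • X) *ᵥ y) (NormedSpace.exp (u • X) *ᵥ z)) 0 u := by
      intro u
      have := hasDerivAt_upsilonForm_exp X x y z u
      rwa [hU] at this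
    have := is_const_of_deriv_eq_zero (fun u => (hd u).differentiableAt) (fun u => (hd u).deriv) t 0
    simpa [NormedSpace.exp_zero] using this

theorem upsilonForm_add_left {n : ℕ} (x x' y z : Fin n → ℝ) :
    upsilonForm n (x + x') y z = upsilonForm n x y z + upsilonForm n x' y z := by
  simp only [upsilonForm, ← Finset.sum_add_distrib, Pi.add_apply]
  refine Finset.sum_congr rfl fun I _ => Finset.sum_congr rfl fun J _ =>
    Finset.sum_congr rfl fun K _ => ?_
  ring

theorem upsilonForm_add_mid {n : ℕ} (x y y' z : Fin n → ℝ) :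
    upsilonForm n x (y + y') z = upsilonForm n x y z + upsilonForm n x y' z := by
  simp only [upsilonForm, ← Finset.sum_add_distrib, Pi.add_apply]
  refine Finset.sum_congr rfl fun I _ => Finset.sum_congr rfl fun J _ =>
    Finset.sum_congr rfl fun K _ => ?_
  ring

theorem upsilonForm_add_right {n : ℕ} (x y z z' : Fin n → ℝ) :
    upsilonForm n x y (z + z') = upsilonForm n x y z + upsilonForm n x y z' := by
  simp only [upsilonForm, ← Finset.sum_add_distrib, Pi.add_apply]
  refine Finset.sum_congr rfl fun I _ => Finset.sum_congr rfl fun J _ =>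
    Finset.sum_congr rfl fun K _ => ?_
  ring

/-- The Lie algebra `𝔥 = {X | exp (t X) ∈ H for all t}` of the stabilizer `H` of `Υ` in `SO(n)`,
a subspace of `Λ²ℝⁿ = 𝔰𝔬(n)`. -/
def stabLie (n : ℕ) : Submodule ℝ (Matrix (Fin n) (Fin n) ℝ) where
  carrier := {X | ExpMemStab n X}
  zero_mem' := by
    intro t
    exact ⟨1, one_mem _, by simp [NormedSpace.exp_zero]⟩
  add_mem' := by
    intro X Y hX hY
    rw [Set.mem_ofPred_eq, expMemStab_iff] at *
    refine ⟨by rw [transpose_add, hX.1, hY.1, neg_add], fun x y z => ?_⟩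
    have h1 := hX.2 x y z
    have h2 := hY.2 x y z
    rw [add_mulVec, add_mulVec, add_mulVec, upsilonForm_add_left, upsilonForm_add_mid,
      upsilonForm_add_right]
    linarith
  smul_mem' := by
    intro c X hX t
    rw [smul_smul]
    exact hX (t * c)

/-! ### Tensors and the map `Υ'` -/

/-- `Λ²ℝⁿ ⊗ ℝⁿ`: the tensors `Γ_{MJI}` that are skew in the first two indices. -/
def wedgeTwoTensor (n : ℕ) : Submodule ℝ (Fin n → Fin n → Fin n → ℝ) where
  carrier := {Γ | ∀ M J I, Γ M J I = -Γ J M I}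
  zero_mem' := by intro M J I; simp
  add_mem' := by
    intro Γ Δ hΓ hΔ M J I
    simp only [Pi.add_apply]
    rw [hΓ M J I, hΔ M J I]; ring
  smul_mem' := by
    intro c Γ hΓ M J I
    simp only [Pi.smul_apply, smul_eq_mul]
    rw [hΓ M J I]; ring

/-- `⊙⁴ℝⁿ`: the totally symmetric tensors `T_{IJKL}`. -/
def symFour (n : ℕ) : Submodule ℝ (Fin n → Fin n → Fin n → Fin n → ℝ) where
  carrier := {T | ∀ I J K L, T I J K L = T J I K L ∧ T I J K L = T I K J L ∧
    T I J K L = T I J L K}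
  zero_mem' := by intro I J K L; simp
  add_mem' := by
    intro S T hS hT I J K L
    obtain ⟨a, b, c⟩ := hS I J K L
    obtain ⟨a', b', c'⟩ := hT I J K L
    simp only [Pi.add_apply]
    exact ⟨by rw [a, a'], by rw [b, b'], by rw [c, c']⟩
  smul_mem' := by
    intro r T hT I J K L
    obtain ⟨a, b, c⟩ := hT I J K L
    simp only [Pi.smul_apply]
    exact ⟨by rw [a], by rw [b], by rw [c]⟩

/-- The components `Υ'(Γ)_{IJKL} = 12 Γ_{M(JI} Υ_{KL)M}`, written out. -/
def upsilonPrimeFun (n : ℕ) (Γ : Fin n → Fin n → Fin n → ℝ) (I J K L : Fin n) : ℝ :=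
  let Υ := upsilon n
  ∑ M, (Γ M J I * Υ M K L + Γ M K I * Υ J M L + Γ M L I * Υ J K M
    + Γ M I J * Υ M K L + Γ M K J * Υ I M L + Γ M L J * Υ I K M
    + Γ M I K * Υ M J L + Γ M J K * Υ I M L + Γ M L K * Υ I J M
    + Γ M I L * Υ M J K + Γ M J L * Υ I M K + Γ M K L * Υ I J M)

theorem upsilonPrimeFun_mem (n : ℕ) (Γ : Fin n → Fin n → Fin n → ℝ) :
    upsilonPrimeFun n Γ ∈ symFour n := by
  have l1 : ∀ A B M : Fin n, upsilon n A M B = upsilon n M A B := fun A B M =>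
    upsilon_swap_left A M B
  have l2 : ∀ A B M : Fin n, upsilon n A B M = upsilon n M A B := fun A B M => by
    rw [upsilon_swap_right A B M, l1]
  intro I J K L
  simp only [upsilonPrimeFun]
  refine ⟨?_, ?_, ?_⟩ <;> refine Finset.sum_congr rfl fun M _ => ?_
  · rw [l1 J L M, l2 J K M, l1 I L M, l2 I K M, l2 I J M, l2 J I M, l1 I K M, l1 J K M,
      upsilon_swap_right M J I]
    ring
  · rw [l1 J L M, l2 J K M, l1 K L M, l2 K J M, l1 I L M, l2 I K M, l2 I J M, l1 I K M, l1 I J M,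
      upsilon_swap_right M K J]
    ring
  · rw [l1 J L M, l2 J K M, l1 J K M, l2 J L M, l1 I L M, l2 I K M, l2 I J M, l1 I K M, l2 I L M,
      upsilon_swap_right M L K]
    ring

/-- The linear map `Υ' : Λ²ℝⁿ ⊗ ℝⁿ → ⊙⁴ℝⁿ`. -/
def upsilonPrime (n : ℕ) : wedgeTwoTensor n →ₗ[ℝ] symFour n where
  toFun Γ := ⟨upsilonPrimeFun n Γ, upsilonPrimeFun_mem n Γ⟩
  map_add' := by
    intro Γ Δ
    ext I J K L
    simp only [upsilonPrimeFun, Submodule.coe_add, Pi.add_apply, ← Finset.sum_add_distrib]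
    refine Finset.sum_congr rfl fun M _ => ?_
    ring
  map_smul' := by
    intro c Γ
    ext I J K L
    simp only [upsilonPrimeFun, Submodule.coe_smul, Pi.smul_apply, smul_eq_mul, RingHom.id_apply,
      Finset.mul_sum]
    refine Finset.sum_congr rfl fun M _ => ?_
    ring

/-- `𝔥 ⊗ ℝⁿ ⊂ Λ²ℝⁿ ⊗ ℝⁿ`: the tensors all of whose slices `(Γ_{MJI})_{MJ}` lie in `𝔥`. -/
def stabLieTensor (n : ℕ) : Submodule ℝ (wedgeTwoTensor n) where
  carrier := {Γ | ∀ I, (Matrix.of fun M J => Γ.1 M J I) ∈ stabLie n}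
  zero_mem' := fun _ => (stabLie n).zero_mem
  add_mem' := fun hΓ hΔ I => (stabLie n).add_mem (hΓ I) (hΔ I)
  smul_mem' := fun c _ hΓ I => (stabLie n).smul_mem c (hΓ I)

/-- `𝔥 ⊗ ℝⁿ` is spanned by the decomposable tensors `X ⊗ v` with `X ∈ 𝔥`. -/
theorem stabLieTensor_eq_span (n : ℕ) :
    stabLieTensor n = Submodule.span ℝ {Γ | ∃ X ∈ stabLie n, ∃ v : Fin n → ℝ,
      Γ.1 = fun M J I => X M J * v I} := by
  apply le_antisymm
  · intro Γ hΓ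
    have hmem : ∀ i : Fin n, (fun M J I => Γ.1 M J i * Pi.single (M := fun _ => ℝ) i 1 I) ∈
        wedgeTwoTensor n := by
      intro i M J I
      have := Γ.2 M J i
      simp only
      rw [this]; ring
    have hsum : Γ = ∑ i, (⟨_, hmem i⟩ : wedgeTwoTensor n) := by
      ext M J I
      simp [Finset.sum_apply, Pi.single_apply]
    rw [hsum]
    exact Submodule.sum_mem _ fun i _ => Submodule.subset_span ⟨_, hΓ i, Pi.single i 1, rfl⟩
  · rw [Submodule.span_le]
    rintro Γ ⟨X, hX, v, h⟩ I
    have : (Matrix.of fun M J => Γ.1 M J I) = v I • X := by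
      ext M J
      simp [h, mul_comm]
    rw [this]
    exact (stabLie n).smul_mem _ hX

/-- `Λ³ℝⁿ ⊂ Λ²ℝⁿ ⊗ ℝⁿ`: the totally skew tensors. -/
def wedgeThree (n : ℕ) : Submodule ℝ (wedgeTwoTensor n) where
  carrier := {Γ | ∀ M J I, Γ.1 M J I = -Γ.1 M I J}
  zero_mem' := by intro M J I; simp
  add_mem' := by
    intro Γ Δ hΓ hΔ M J I
    simp only [Submodule.coe_add, Pi.add_apply]
    rw [hΓ M J I, hΔ M J I]; ring
  smul_mem' := by
    intro c Γ hΓ M J I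
    simp only [Submodule.coe_smul, Pi.smul_apply, smul_eq_mul]
    rw [hΓ M J I]; ring

/-! ### Representations of `H` -/

/-- The endomorphism `W^{IK} ↦ 4 Υ_{IJM} Υ_{KLM} W^{JL}` of `⊗²ℝⁿ`. -/
def upsilonHat (n : ℕ) : Module.End ℝ (Matrix (Fin n) (Fin n) ℝ) where
  toFun W := Matrix.of fun I K => ∑ J, ∑ L, ∑ M, 4 * upsilon n I J M * upsilon n K L M * W J L
  map_add' := by
    intro V W
    ext I K
    simp only [Matrix.add_apply, Matrix.of_apply, mul_add, Finset.sum_add_distrib]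
  map_smul' := by
    intro c W
    ext I K
    simp only [Matrix.smul_apply, Matrix.of_apply, smul_eq_mul, RingHom.id_apply, Finset.mul_sum]
    refine Finset.sum_congr rfl fun J _ => Finset.sum_congr rfl fun L _ =>
      Finset.sum_congr rfl fun M _ => ?_
    ring

/-- The action of a matrix on `⊗³ℝⁿ`: `(h · Γ)_{MJI} = h_{MA} h_{JB} h_{IC} Γ_{ABC}`. -/
def tensorAct {n : ℕ} (h : Matrix (Fin n) (Fin n) ℝ) (Γ : Fin n → Fin n → Fin n → ℝ) :
    Fin n → Fin n → Fin n → ℝ :=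
  fun M J I => ∑ A, ∑ B, ∑ C, h M A * h J B * h I C * Γ A B C

/-- The subspaces `E ⊂ ⊗²ℝⁿ` and `W ⊂ Λ²ℝⁿ ⊗ ℝⁿ` are invariant under the stabilizer `H` of `Υ`,
and they are isomorphic as representations of `H` (which acts on `⊗²ℝⁿ` by `F ↦ h F hᵀ`). -/
def IsoAsRep (n : ℕ) (E : Submodule ℝ (Matrix (Fin n) (Fin n) ℝ))
    (W : Submodule ℝ (wedgeTwoTensor n)) : Prop :=
  ∃ φ : E ≃ₗ[ℝ] W, ∀ h ∈ stabGroup n, ∀ F : E,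
    ∃ hF : (h : Matrix (Fin n) (Fin n) ℝ) * F * (h : Matrix (Fin n) (Fin n) ℝ)ᵀ ∈ E,
      ((φ ⟨_, hF⟩ : wedgeTwoTensor n) : Fin n → Fin n → Fin n → ℝ) =
        tensorAct (h : Matrix (Fin n) (Fin n) ℝ) ((φ F : wedgeTwoTensor n) : _)

end

/-! Write x∘y for the commutative product with ⟨x∘y, z⟩ = Υ(x, y, z) and U_x (`mulMat x`) for
multiplication by x. Up to a constant, Υ'(Γ) is the full polarisation of x ↦ ⟨Γ_x x, x∘x⟩, so Γ lies
in the kernel exactly when this quartic vanishes (`mem_ker_upsilonPrime_iff`), while Λ³ consists of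
the Γ with Γ_x x = 0. The kernel modulo Λ³ is therefore a space of quadratic vector fields x ↦ Γ_x x
tangent to the level sets of |x|² and of Υ(x, x, x). The central claim is that every such field has
the form D_x x + S(x∘x), with S ∈ 𝔥 and D_x ∈ 𝔥 linear in x (`SymComp.normalFields_le_derFields`,
`HermModel.exists_of_mem_ker`).

The claim is proved on hermitian 3 × 3 matrices over a composition algebra of dimension k, n = 3k +
2. The product conj(xy) is used because it treats the three off-diagonal slots cyclically.
Infinitesimal rotations and related triples, which are derivations, are subtracted until nothing is
left on the diagonal and the idempotents act trivially. What remains is the equation R(u) L_u = L_u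
P(u) + L_{c(u,u)}, solved by Clifford contractions and local triality (`SymComp.tri_normal`).

The field S(x∘x) also comes from the tensor S U_x + U_x S, which sends x to (3/2) S(x∘x). The
operator Υ̂ + 8 maps skew matrices into 𝔥 (`CartanCubic.upsilonHat_add_mem`); applied to that tensor
it gives an element of 𝔥 ⊗ ℝⁿ sending x to (14 - (n + 2)/2) S(x∘x). If n ≠ 26 the coefficient is
nonzero, and the field is already accounted for by 𝔥 ⊗ ℝⁿ. If n = 26 it vanishes, and the tensors S
U + U S are orthogonal to both other summands and form a copy W of 𝔥. This is the eigenspace of Υ̂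
for 28 = n + 2, and its dimension 52 is the trace of the projection (Υ̂ + 8)/(n + 10) on skew
matrices.

An element of (𝔥 ⊗ ℝⁿ) ∩ Λ³ is a linear family of derivations with D_z z = 0. Its coefficients along
the idempotents are skew maps β_i with x β_{i+1}(y) = β_i(x) y, and triality gives (2k - 4) β_i = 0.
So the intersection is zero for k ≠ 2, and for k = 2 it is spanned by w ↦ i[z, w]. The group H₂
preserves this three-form up to sign. The sign is positive: after composition with automorphisms of
sign +1 an element fixes diag(1, 0, -1), and sign -1 would then make it conjugate-linear on three
complex lines and the identity on diagonals, contradicting determinant 1. -/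

noncomputable section

/-! ### Symmetric composition algebras -/

/-- A symmetric composition algebra: a bilinear product with associative norm form satisfying
`(x y) x = |x|² y`. -/
structure SymComp (K : Type*) [NormedAddCommGroup K] [InnerProductSpace ℝ K] where
  mul : K →ₗ[ℝ] K →ₗ[ℝ] K
  inner_mul : ∀ x y z, inner ℝ (mul x y) z = inner ℝ x (mul y z)
  mul_mul_self : ∀ x y, mul (mul x y) x = inner ℝ x x • y

namespace SymComp

variable {K : Type*} [NormedAddCommGroup K] [InnerProductSpace ℝ K] (m : SymComp K)

/-- The trilinear form ⟨x y, z⟩ is cyclic; equivalently, the transpose of left multiplication by an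
element is right multiplication by it. -/
theorem inner_mul_cycle (x y z : K) : inner ℝ (m.mul x y) z = inner ℝ (m.mul z x) y := by
  rw [m.inner_mul, real_inner_comm, m.inner_mul, real_inner_comm, m.inner_mul, real_inner_comm]

theorem inner_mul_mul_left (x y z : K) :
    inner ℝ (m.mul x y) (m.mul x z) = inner ℝ x x * inner ℝ y z := by
  rw [← m.inner_mul, m.mul_mul_self, real_inner_smul_left]

/-- The norm identity |w x|² = |w|² |x|² is symmetric in the two factors, so it can be polarised in
the left factor as well. -/
theorem inner_mul_mul_right (x y z : K) :
    inner ℝ (m.mul y x) (m.mul z x) = inner ℝ x x * inner ℝ y z := by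
  have h : ∀ w, inner ℝ (m.mul w x) (m.mul w x) = inner ℝ x x * inner ℝ w w := fun w => by
    rw [m.inner_mul_mul_left, mul_comm]
  have h1 := h (y + z)
  simp only [map_add, LinearMap.add_apply, inner_add_left, inner_add_right] at h1
  have h2 := h y
  have h3 := h z
  have h4 := real_inner_comm (m.mul y x) (m.mul z x)
  have h5 := real_inner_comm y z
  rw [h2, h3, h4, h5] at h1
  linarith

theorem mul_mul_self' (x y : K) : m.mul x (m.mul y x) = inner ℝ x x • y := by
  refine ext_inner_right ℝ fun z => ?_
  rw [m.inner_mul_cycle, real_inner_comm, m.inner_mul_mul_right, real_inner_smul_left]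

/-- Polarisation of (u x) u = |u|² x. This is the Clifford relation that moves one vector past
another in all later contractions. -/
theorem mul_mul_add (u v x : K) :
    m.mul (m.mul u x) v + m.mul (m.mul v x) u = (2 * inner ℝ u v) • x := by
  have h := m.mul_mul_self (u + v) x
  simp only [map_add, LinearMap.add_apply, inner_add_left, inner_add_right, m.mul_mul_self,
    real_inner_comm u v] at h
  linear_combination (norm := module) (1 : ℝ) • h

theorem mul_mul_add' (u v x : K) :
    m.mul u (m.mul x v) + m.mul v (m.mul x u) = (2 * inner ℝ u v) • x := by
  have h := m.mul_mul_self' (u + v) x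
  simp only [map_add, LinearMap.add_apply, inner_add_left, inner_add_right, m.mul_mul_self',
    real_inner_comm u v] at h
  linear_combination (norm := module) (1 : ℝ) • h

theorem eq_zero_of_mul_eq_zero {c : K} (h : ∀ x, m.mul c x = 0) : c = 0 := by
  have h1 := m.mul_mul_self c c
  rw [h c, map_zero, LinearMap.zero_apply] at h1
  rcases smul_eq_zero.1 h1.symm with h | h
  · exact inner_self_eq_zero.1 h
  · exact h

/-- The related triples: triples of skew endomorphisms annihilating the form `⟨X₀, X₁ X₂⟩`. -/
def tri : Submodule ℝ (Fin 3 → K →ₗ[ℝ] K) where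
  carrier := {S | (∀ i x, inner ℝ (S i x) x = 0) ∧
    ∀ i x y z, inner ℝ (S i x) (m.mul y z) + inner ℝ (S (i + 1) y) (m.mul z x) +
      inner ℝ (S (i + 2) z) (m.mul x y) = 0}
  zero_mem' := by simp
  add_mem' := by
    rintro S T ⟨h1, h2⟩ ⟨h3, h4⟩
    refine ⟨fun i x => ?_, fun i x y z => ?_⟩
    · simp [inner_add_left, h1, h3]
    · have := h2 i x y z
      have := h4 i x y z
      simp only [Pi.add_apply, LinearMap.add_apply, inner_add_left]
      linarith
  smul_mem' := by
    rintro c S ⟨h1, h2⟩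
    refine ⟨fun i x => ?_, fun i x y z => ?_⟩
    · simp [real_inner_smul_left, h1]
    · have := h2 i x y z
      simp only [Pi.smul_apply, LinearMap.smul_apply, real_inner_smul_left]
      linear_combination c * this

theorem skew_swap {A : K →ₗ[ℝ] K} (h : ∀ x, inner ℝ (A x) x = 0) (x y : K) :
    inner ℝ (A x) y = - inner ℝ (A y) x := by
  have h1 := h (x + y)
  simp only [map_add, inner_add_left, inner_add_right, h] at h1
  linarith

/-- One Leibniz rule suffices: by cyclicity of ⟨x y, z⟩ the conditions for the other two indices are
the same identity with permuted arguments. -/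
theorem mem_tri_of {S : Fin 3 → K →ₗ[ℝ] K} (hs : ∀ i x, inner ℝ (S i x) x = 0) (j : Fin 3)
    (h : ∀ x y, S (j + 2) (m.mul x y) = m.mul (S j x) y + m.mul x (S (j + 1) y)) :
    S ∈ m.tri := by
  have key : ∀ x y z, inner ℝ (S j x) (m.mul y z) + inner ℝ (S (j + 1) y) (m.mul z x) +
      inner ℝ (S (j + 2) z) (m.mul x y) = 0 := by
    intro x y z
    rw [skew_swap (hs (j + 2)) z, h, inner_add_left, m.inner_mul, m.inner_mul_cycle x,
      ← m.inner_mul_cycle, real_inner_comm (m.mul z x), m.inner_mul_cycle z, m.inner_mul x,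
      real_inner_comm _ x, ← m.inner_mul_cycle]
    have : inner ℝ (m.mul (S (j+1) y) z) x = inner ℝ (m.mul x (S (j+1) y)) z := by
      rw [m.inner_mul_cycle]
    linarith
  refine ⟨hs, fun i x y z => ?_⟩
  have e1 : j + 1 + 1 = j + 2 := by rw [add_assoc]; rfl
  have e2 : j + 1 + 2 = j := by rw [add_assoc]; simp
  have e3 : j + 2 + 1 = j := by rw [add_assoc]; simp
  have e4 : j + 2 + 2 = j + 1 := by rw [add_assoc]; rfl
  have hi : i = j ∨ i = j + 1 ∨ i = j + 2 := by omega
  rcases hi with rfl | rfl | rfl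
  · exact key x y z
  · rw [e1, e2]; linarith [key z x y]
  · rw [e3, e4]; linarith [key y z x]

theorem tri_apply_mul {S : Fin 3 → K →ₗ[ℝ] K} (hS : S ∈ m.tri) (j : Fin 3) (x y : K) :
    S (j + 2) (m.mul x y) = m.mul (S j x) y + m.mul x (S (j + 1) y) := by
  refine ext_inner_right ℝ fun z => ?_
  have h1 : inner ℝ (S (j + 1) y) (m.mul z x) = inner ℝ (m.mul x (S (j + 1) y)) z := by
    rw [m.inner_mul_cycle, real_inner_comm]
  rw [inner_add_left]
  have h3 : inner ℝ (S j x) (m.mul y z) = inner ℝ (m.mul (S j x) y) z := (m.inner_mul _ _ _).symm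
  have h4 := hS.2 j x y z
  rw [skew_swap (hS.1 (j + 2)) z] at h4
  linarith

variable {k : ℕ} (e : OrthonormalBasis (Fin k) ℝ K)

/-- `ρ(A) = ∑ L_{A e} L_eᵀ`. -/
def rho : (K →ₗ[ℝ] K) →ₗ[ℝ] K →ₗ[ℝ] K where
  toFun A := ∑ s, m.mul (A (e s)) ∘ₗ m.mul.flip (e s)
  map_add' A B := by
    ext x
    simp [Finset.sum_add_distrib]
  map_smul' c A := by
    ext x
    simp [Finset.smul_sum]

/-- `ρ'(A) = ∑ L_{A e}ᵀ L_e`. -/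
def rho' : (K →ₗ[ℝ] K) →ₗ[ℝ] K →ₗ[ℝ] K where
  toFun A := ∑ s, m.mul.flip (A (e s)) ∘ₗ m.mul (e s)
  map_add' A B := by
    ext x
    simp [Finset.sum_add_distrib]
  map_smul' c A := by
    ext x
    simp [Finset.smul_sum]

theorem rho_apply (A : K →ₗ[ℝ] K) (y : K) :
    m.rho e A y = ∑ s, m.mul (A (e s)) (m.mul y (e s)) := by
  simp [rho]

theorem rho'_apply (A : K →ₗ[ℝ] K) (x : K) :
    m.rho' e A x = ∑ s, m.mul (m.mul (e s) x) (A (e s)) := by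
  simp [rho']

theorem sum_inner_smul (x : K) : ∑ s, inner ℝ x (e s) • e s = x := by
  conv_rhs => rw [← e.sum_repr' x]
  simp only [real_inner_comm]

theorem sum_inner_smul_map {E : Type*} [AddCommGroup E] [Module ℝ E] (A : K →ₗ[ℝ] E) (x : K) :
    ∑ s, inner ℝ x (e s) • A (e s) = A x := by
  conv_rhs => rw [← sum_inner_smul e x]
  simp

variable {A : K →ₗ[ℝ] K}

theorem sum_inner_skew (hA : ∀ x, inner ℝ (A x) x = 0) (x : K) :
    ∑ s, inner ℝ (A (e s)) x • e s = - A x := by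
  conv_rhs => rw [← sum_inner_smul e (A x)]
  rw [← Finset.sum_neg_distrib]
  refine Finset.sum_congr rfl fun s _ => ?_
  rw [skew_swap hA, neg_smul]

theorem rho_skew (hA : ∀ x, inner ℝ (A x) x = 0) (y : K) : inner ℝ (m.rho e A y) y = 0 := by
  rw [rho_apply, sum_inner]
  refine Finset.sum_eq_zero fun s _ => ?_
  rw [m.inner_mul, m.mul_mul_self, real_inner_smul_right, real_inner_comm, hA, mul_zero]

theorem rho'_skew (hA : ∀ x, inner ℝ (A x) x = 0) (y : K) : inner ℝ (m.rho' e A y) y = 0 := by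
  rw [rho'_apply, sum_inner]
  refine Finset.sum_eq_zero fun s _ => ?_
  rw [m.inner_mul_cycle, m.mul_mul_self', real_inner_smul_left, real_inner_comm (A (e s)), hA,
      mul_zero]

/-- Local triality. Two Clifford relations move `u` outwards past `e` and then past `A e`; each
crossing leaves a remainder that sums to `2 (A u) x`. Hence `A`, `ρ'(A) / 4` and `ρ(A) / 4` form a
related triple. -/
theorem rho_mul (hA : ∀ x, inner ℝ (A x) x = 0) (u x : K) :
    m.rho e A (m.mul u x) = (4 : ℝ) • m.mul (A u) x + m.mul u (m.rho' e A x) := by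
  have h1 : ∀ s, m.mul (A (e s)) (m.mul (m.mul u x) (e s)) =
      (2 : ℝ) • inner ℝ u (e s) • (m.mul.flip x ∘ₗ A) (e s)
      - (2 : ℝ) • m.mul (inner ℝ (A (e s)) u • e s) x
      + m.mul u (m.mul (m.mul (e s) x) (A (e s))) := by
    intro s
    have h2 := m.mul_mul_add u (e s) x
    have h3 := m.mul_mul_add' (A (e s)) u (m.mul (e s) x)
    rw [eq_sub_of_add_eq h2, map_sub, eq_sub_of_add_eq h3]
    simp only [map_smul, LinearMap.smul_apply, LinearMap.comp_apply, LinearMap.flip_apply]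
    module
  rw [rho_apply, Finset.sum_congr rfl fun s _ => h1 s, Finset.sum_add_distrib,
    Finset.sum_sub_distrib, ← Finset.smul_sum, ← Finset.smul_sum, sum_inner_smul_map,
    ← map_sum, rho'_apply]
  have : ∑ s, m.mul (inner ℝ (A (e s)) u • e s) x = - m.mul (A u) x := by
    rw [← LinearMap.sum_apply, ← map_sum, sum_inner_skew e hA]; simp
  rw [this]
  simp only [LinearMap.comp_apply, LinearMap.flip_apply]
  module

/-- The related triple with a given skew component. -/
def lift (i : Fin 3) : (K →ₗ[ℝ] K) →ₗ[ℝ] (Fin 3 → K →ₗ[ℝ] K) where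
  toFun A j := if j = i then A else if j = i + 1 then (1 / 4 : ℝ) • m.rho' e A
    else (1 / 4 : ℝ) • m.rho e A
  map_add' A B := by
    ext j x
    simp only [Pi.add_apply]
    split_ifs <;> simp
  map_smul' c A := by
    ext j x
    simp only [Pi.smul_apply, RingHom.id_apply]
    split_ifs
    · rfl
    · simp [smul_smul, mul_comm]
    · simp [smul_smul, mul_comm]

theorem lift_self (i : Fin 3) : m.lift e i A i = A := by simp [lift]

theorem lift_one (i : Fin 3) : m.lift e i A (i + 1) = (1 / 4 : ℝ) • m.rho' e A := by simp [lift]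

theorem lift_two (i : Fin 3) : m.lift e i A (i + 2) = (1 / 4 : ℝ) • m.rho e A := by simp [lift]

/-- This extends an arbitrary skew map in one slot to a related triple, in every dimension and
linearly in the map. -/
theorem lift_mem_tri (hA : ∀ x, inner ℝ (A x) x = 0) (i : Fin 3) : m.lift e i A ∈ m.tri := by
  refine m.mem_tri_of (fun j x => ?_) i fun x y => ?_
  · simp only [lift, LinearMap.coe_mk, AddHom.coe_mk]
    split_ifs
    · exact hA x
    · rw [LinearMap.smul_apply, real_inner_smul_left, m.rho'_skew e hA, mul_zero]
    · rw [LinearMap.smul_apply, real_inner_smul_left, m.rho_skew e hA, mul_zero]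
  · rw [lift_self, lift_one, lift_two, LinearMap.smul_apply, m.rho_mul e hA]
    simp only [LinearMap.smul_apply, map_smul]
    module

end SymComp
end

/-! ### The equation R(u) L_u = L_u P(u) + L_{c(u,u)} and its solutions. -/

noncomputable section

namespace SymComp

variable {K : Type*} [NormedAddCommGroup K] [InnerProductSpace ℝ K] (m : SymComp K)
  {k : ℕ} (e : OrthonormalBasis (Fin k) ℝ K)

theorem inner_basis_self (s : Fin k) : inner ℝ (e s) (e s) = 1 := by
  simp

/-- `∑ B e ⊗ e` is symmetric for self-adjoint `B`. -/
theorem sum_selfAdjoint_swap {E : Type*} [AddCommGroup E] [Module ℝ E]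
    (f : K →ₗ[ℝ] K →ₗ[ℝ] E) {B : K →ₗ[ℝ] K}
    (hB : ∀ x y, inner ℝ (B x) y = inner ℝ x (B y)) :
    ∑ s, f (B (e s)) (e s) = ∑ s, f (e s) (B (e s)) := by
  have h1 : ∀ s, f (B (e s)) (e s) = ∑ t, inner ℝ (B (e s)) (e t) • f (e t) (e s) := by
    intro s
    conv_lhs => rw [← sum_inner_smul e (B (e s))]
    simp
  have h2 : ∀ s, f (e s) (B (e s)) = ∑ t, inner ℝ (B (e s)) (e t) • f (e s) (e t) := by
    intro s
    conv_lhs => rw [← sum_inner_smul e (B (e s))]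
    simp
  rw [Finset.sum_congr rfl fun s _ => h1 s, Finset.sum_congr rfl fun s _ => h2 s,
    Finset.sum_comm]
  refine Finset.sum_congr rfl fun t _ => Finset.sum_congr rfl fun s _ => ?_
  rw [hB, real_inner_comm]

/-- For self-adjoint `B` the tensor `∑ B e ⊗ e` is symmetric, so averaging the sum with its swap
turns each term into a Clifford relation, and only the trace of `B` survives. -/
theorem rho_selfAdjoint {B : K →ₗ[ℝ] K} (hB : ∀ x y, inner ℝ (B x) y = inner ℝ x (B y))
    (y : K) : m.rho e B y = (∑ s, inner ℝ (B (e s)) (e s)) • y := by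
  have h1 := sum_selfAdjoint_swap e (m.mul.compl₂ (m.mul y)) hB
  simp only [LinearMap.compl₂_apply] at h1
  have h2 : ∑ s, (m.mul (B (e s)) (m.mul y (e s)) + m.mul (e s) (m.mul y (B (e s)))) =
      (2 : ℝ) • (∑ s, inner ℝ (B (e s)) (e s)) • y := by
    rw [Finset.sum_smul, Finset.smul_sum]
    refine Finset.sum_congr rfl fun s _ => ?_
    rw [m.mul_mul_add', smul_smul]
  rw [Finset.sum_add_distrib, ← h1, ← rho_apply m e B y] at h2
  linear_combination (norm := module) (1 / 2 : ℝ) • h2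

theorem rho'_selfAdjoint {B : K →ₗ[ℝ] K} (hB : ∀ x y, inner ℝ (B x) y = inner ℝ x (B y))
    (y : K) : m.rho' e B y = (∑ s, inner ℝ (B (e s)) (e s)) • y := by
  have h1 := sum_selfAdjoint_swap e (m.mul ∘ₗ m.mul.flip y) hB
  simp only [LinearMap.comp_apply, LinearMap.flip_apply] at h1
  have h2 : ∑ s, (m.mul (m.mul (B (e s)) y) (e s) + m.mul (m.mul (e s) y) (B (e s))) =
      (2 : ℝ) • (∑ s, inner ℝ (B (e s)) (e s)) • y := by
    rw [Finset.sum_smul, Finset.smul_sum]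
    refine Finset.sum_congr rfl fun s _ => ?_
    rw [m.mul_mul_add, smul_smul]
  rw [Finset.sum_add_distrib, h1, ← rho'_apply m e B y] at h2
  linear_combination (norm := module) (1 / 2 : ℝ) • h2

variable {c R : K →ₗ[ℝ] K →ₗ[ℝ] K}

theorem cyclic_of_inner_self (hc : ∀ u v, c u v = c v u) (hc0 : ∀ u, inner ℝ (c u u) u = 0)
    (u v z : K) : inner ℝ (c u v) z + inner ℝ (c v z) u + inner ℝ (c z u) v = 0 := by
  have h1 := hc0 (u + v + z)
  have h2 := hc0 (u + v)
  have h3 := hc0 (u + z)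
  have h4 := hc0 (v + z)
  simp only [map_add, LinearMap.add_apply, inner_add_left, inner_add_right, hc0] at h1 h2 h3 h4
  rw [hc v u, hc z u, hc z v] at h1
  rw [hc v u] at h2
  rw [hc z u] at h3
  rw [hc z v] at h4
  rw [hc z u]
  linarith

/-- The skew part of `c(u, ·)`. -/
def skewPart [FiniteDimensional ℝ K] (c : K →ₗ[ℝ] K →ₗ[ℝ] K) : K →ₗ[ℝ] K →ₗ[ℝ] K where
  toFun u := (1 / 2 : ℝ) • (c u - LinearMap.adjoint (c u))
  map_add' u v := by
    simp only [map_add]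
    module
  map_smul' r u := by
    simp only [map_smul, RingHom.id_apply]
    module

/-- `v ↦ ⟨d, v⟩ u - ⟨u, v⟩ d`. -/
def wedge (d : K) : K →ₗ[ℝ] K →ₗ[ℝ] K :=
  LinearMap.mk₂ ℝ (fun u v => inner ℝ d v • u - inner ℝ u v • d)
    (fun u u' v => by simp only [inner_add_left]; module)
    (fun r u v => by simp only [real_inner_smul_left]; module)
    (fun u v v' => by simp only [inner_add_right]; module)
    (fun r u v => by simp only [real_inner_smul_right]; module)

theorem wedge_apply (d u v : K) : wedge d u v = inner ℝ d v • u - inner ℝ u v • d := rfl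

theorem wedge_skew (d u v : K) : inner ℝ (wedge d u v) v = 0 := by
  rw [wedge_apply, inner_sub_left, real_inner_smul_left, real_inner_smul_left]; ring

theorem rho_wedge (d u y : K) :
    m.rho e (wedge d u) y = m.mul u (m.mul y d) - m.mul d (m.mul y u) := by
  have h1 : ∀ s, m.mul (wedge d u (e s)) (m.mul y (e s)) =
      inner ℝ d (e s) • (m.mul u ∘ₗ m.mul y) (e s) - inner ℝ u (e s) • (m.mul d ∘ₗ m.mul y) (e s)
          := by
    intro s
    simp [wedge_apply]
  rw [rho_apply, Finset.sum_congr rfl fun s _ => h1 s, Finset.sum_sub_distrib,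
    sum_inner_smul_map, sum_inner_smul_map]
  rfl

theorem rho'_wedge (d u x : K) :
    m.rho' e (wedge d u) x = m.mul (m.mul d x) u - m.mul (m.mul u x) d := by
  have h1 : ∀ s, m.mul (m.mul (e s) x) (wedge d u (e s)) =
      inner ℝ d (e s) • (m.mul.flip u ∘ₗ m.mul.flip x) (e s)
      - inner ℝ u (e s) • (m.mul.flip d ∘ₗ m.mul.flip x) (e s) := by
    intro s
    simp [wedge_apply]
  rw [rho'_apply, Finset.sum_congr rfl fun s _ => h1 s, Finset.sum_sub_distrib,
    sum_inner_smul_map, sum_inner_smul_map]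
  rfl

section
variable [FiniteDimensional ℝ K]

theorem inner_skewPart (u v z : K) :
    inner ℝ (skewPart c u v) z = 1 / 2 * (inner ℝ (c u v) z - inner ℝ (c u z) v) := by
  simp only [skewPart, LinearMap.coe_mk, AddHom.coe_mk, LinearMap.smul_apply,
    LinearMap.sub_apply, real_inner_smul_left, inner_sub_left, LinearMap.adjoint_inner_left]
  rw [real_inner_comm (c u z)]

theorem inner_skewPart_self (u v : K) : inner ℝ (skewPart c u v) v = 0 := by
  rw [inner_skewPart]; ring

theorem sub_skewPart_selfAdjoint (u x y : K) :
    inner ℝ ((c u - skewPart c u) x) y = inner ℝ x ((c u - skewPart c u) y) := by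
  rw [real_inner_comm _ x]
  simp only [LinearMap.sub_apply, inner_sub_left, inner_skewPart]
  ring

theorem rho_eq_skewPart (u y : K) : m.rho e (c u) y = m.rho e (skewPart c u) y +
    (∑ s, inner ℝ (c u (e s)) (e s)) • y := by
  have h := m.rho_selfAdjoint e (sub_skewPart_selfAdjoint (c := c) u) y
  simp only [map_sub, LinearMap.sub_apply, inner_sub_left, inner_skewPart_self, sub_zero] at h
  rw [← h]; abel

theorem rho'_eq_skewPart (u y : K) : m.rho' e (c u) y = m.rho' e (skewPart c u) y +
    (∑ s, inner ℝ (c u (e s)) (e s)) • y := by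
  have h := m.rho'_selfAdjoint e (sub_skewPart_selfAdjoint (c := c) u) y
  simp only [map_sub, LinearMap.sub_apply, inner_sub_left, inner_skewPart_self, sub_zero] at h
  rw [← h]; abel

/-- The cyclic identity gives ⟨c(u,u), z⟩ + 2⟨c(u,z), u⟩ = 0, whence the factor (1 + 1/2)/2 = 3/4.
-/
theorem skewPart_self (hc : ∀ u v, c u v = c v u) (hc0 : ∀ u, inner ℝ (c u u) u = 0) (u : K) :
    skewPart c u u = (3 / 4 : ℝ) • c u u := by
  refine ext_inner_right ℝ fun z => ?_
  have h := cyclic_of_inner_self hc hc0 u u z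
  rw [hc z u] at h
  rw [inner_skewPart, real_inner_smul_left]
  linarith

/-- The normal form when one component vanishes and `c` is trace free. -/
theorem tri_normal_core (hk : k ≠ 1) (hc : ∀ u v, c u v = c v u)
    (hc0 : ∀ u, inner ℝ (c u u) u = 0) (htr : ∑ s, c (e s) (e s) = 0)
    (hR : ∀ u x, inner ℝ (R u x) x = 0)
    (h : ∀ u x, R u (m.mul u x) = m.mul (c u u) x) :
    (∀ u x, m.rho' e (skewPart c u) x = 0) ∧
    (∀ u v x, R u (m.mul v x) = m.mul ((4 / 3 : ℝ) • skewPart c u v) x) := by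
  have hk2 : (0 : ℝ) < k + 2 := by positivity
  have hkk : (2 * k - 2 : ℝ) ≠ 0 := by
    intro h
    apply hk
    have : (k : ℝ) = 1 := by linarith
    exact_mod_cast this
  have pol : ∀ u v x, R u (m.mul v x) + R v (m.mul u x) = (2 : ℝ) • m.mul (c u v) x := by
    intro u v x
    have h1 := h (u + v) x
    simp only [map_add, LinearMap.add_apply, h, hc v u] at h1
    linear_combination (norm := module) (1 : ℝ) • h1
  -- Contract the polarised equation with the basis, using `e (y e) = y`. The first term gives `k
  -- R(u) y`. In the second, the Clifford relation yields `2 R(u) y` and a multiple of the trace `∑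
  -- c(e, e)`, which is zero.
  have hRrho : ∀ u y, ((k : ℝ) + 2) • R u y = (2 : ℝ) • m.rho e (c u) y := by
    intro u y
    have h1 : ∑ s, (R u (m.mul (e s) (m.mul y (e s))) + R (e s) (m.mul u (m.mul y (e s)))) =
        ∑ s, (2 : ℝ) • m.mul (c u (e s)) (m.mul y (e s)) :=
      Finset.sum_congr rfl fun s _ => pol u (e s) _
    have h2 : ∀ s, R (e s) (m.mul u (m.mul y (e s))) =
        (2 : ℝ) • inner ℝ u (e s) • R.flip y (e s) - m.mul (c (e s) (e s)) (m.mul y u) := by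
      intro s
      rw [eq_sub_of_add_eq (m.mul_mul_add' u (e s) y), map_sub, h]
      simp only [map_smul, LinearMap.flip_apply]
      module
    have s1 : ∑ s, inner ℝ u (e s) • R.flip y (e s) = R u y := sum_inner_smul_map e (R.flip y) u
    have s2 : ∑ s, m.mul (c (e s) (e s)) (m.mul y u) = 0 := by
      rw [← LinearMap.sum_apply, ← map_sum, htr, map_zero, LinearMap.zero_apply]
    have s3 : ∑ s, R u (m.mul (e s) (m.mul y (e s))) = (k : ℝ) • R u y := by
      simp only [m.mul_mul_self', inner_basis_self, one_smul, Finset.sum_const, Finset.card_univ,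
        Fintype.card_fin, ← Nat.cast_smul_eq_nsmul ℝ]
    rw [Finset.sum_add_distrib, Finset.sum_congr rfl fun s _ => h2 s, Finset.sum_sub_distrib,
      ← Finset.smul_sum, ← Finset.smul_sum, ← rho_apply, s1, s2, s3] at h1
    linear_combination (norm := module) (1 : ℝ) • h1
  -- Both `R u` and `ρ` of the skew part are skew, so the scalar part of `ρ(c u)`, which is the
  -- trace of `c u`, has to vanish.
  have htr0 : ∀ (u y : K), (∑ s, inner ℝ (c u (e s)) (e s)) * (inner ℝ y y : ℝ) = 0 := by
    intro u (y : K)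
    have h1 : inner ℝ (((k : ℝ) + 2) • R u y) y = inner ℝ ((2 : ℝ) • m.rho e (c u) y) y := by
      rw [hRrho]
    rw [m.rho_eq_skewPart] at h1
    simp only [real_inner_smul_left, hR, inner_add_left,
      m.rho_skew e (inner_skewPart_self u)] at h1
    linarith
  have htr1 : ∀ u y : K, (∑ s, inner ℝ (c u (e s)) (e s)) • y = 0 := by
    intro u y
    rcases mul_eq_zero.1 (htr0 u y) with h1 | h1
    · rw [h1, zero_smul]
    · rw [inner_self_eq_zero.1 h1, smul_zero]
  have hrho : ∀ u y, m.rho e (c u) y = m.rho e (skewPart c u) y := fun u y => by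
    rw [m.rho_eq_skewPart, htr1, add_zero]
  have hrho' : ∀ u y, m.rho' e (c u) y = m.rho' e (skewPart c u) y := fun u y => by
    rw [m.rho'_eq_skewPart, htr1, add_zero]
  -- Evaluate the previous relation on `u x` and expand by `rho_mul`. The term `8 (A u) x` with `A u
  -- = (3/4) c(u, u)` contributes 6, and (k + 2) - 6 = k - 4.
  have hP : ∀ u x, m.mul u ((2 : ℝ) • m.rho' e (skewPart c u) x) =
      m.mul (((k : ℝ) - 4) • c u u) x := by
    intro u x
    have h1 := hRrho u (m.mul u x)
    rw [h, hrho, m.rho_mul e (inner_skewPart_self u), skewPart_self hc hc0] at h1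
    simp only [map_smul, LinearMap.smul_apply] at h1 ⊢
    linear_combination (norm := module) (-1 : ℝ) • h1
  have hP' : ∀ u y, (2 : ℝ) • m.rho' e (skewPart c u) (m.mul y u) =
      - (((k : ℝ) - 4) • m.mul y (c u u)) := by
    intro u y
    refine ext_inner_right ℝ fun x => ?_
    have h1 : inner ℝ (m.mul u ((2 : ℝ) • m.rho' e (skewPart c u) x)) y =
        inner ℝ (m.mul (((k : ℝ) - 4) • c u u) x) y := by rw [hP]
    simp only [map_smul, LinearMap.smul_apply, real_inner_smul_left, inner_neg_left] at h1 ⊢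
    rw [skew_swap (m.rho'_skew e (inner_skewPart_self u))]
    have h2 := m.inner_mul_cycle u (m.rho' e (skewPart c u) x) y
    have h3 := m.inner_mul_cycle (c u u) x y
    rw [h2, h3] at h1
    rw [real_inner_comm (m.mul y u)]
    linarith
  have polP : ∀ u v y, (2 : ℝ) • m.rho' e (skewPart c u) (m.mul y v) +
      (2 : ℝ) • m.rho' e (skewPart c v) (m.mul y u) =
      - ((2 * ((k : ℝ) - 4)) • m.mul y (c u v)) := by
    intro u v y
    have h1 := hP' (u + v) y
    have h2 := hP' u y
    have h3 := hP' v y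
    simp only [map_add, LinearMap.add_apply, hc v u] at h1
    linear_combination (norm := module) (1 : ℝ) • h1 - (1 : ℝ) • h2 - (1 : ℝ) • h3
  -- The transposed relation, polarised and contracted in the same manner, reads (4k - 4) ρ' = 0 on
  -- the skew part. This is where dimension one has to be excluded.
  have hP0 : ∀ u x, m.rho' e (skewPart c u) x = 0 := by
    intro u x
    have h1 : ∑ s, ((2 : ℝ) • m.rho' e (skewPart c u) (m.mul (m.mul (e s) x) (e s)) +
        (2 : ℝ) • m.rho' e (skewPart c (e s)) (m.mul (m.mul (e s) x) u)) =
        ∑ s, - ((2 * ((k : ℝ) - 4)) • m.mul (m.mul (e s) x) (c u (e s))) :=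
      Finset.sum_congr rfl fun s _ => polP u (e s) _
    have h2 : ∀ s, (2 : ℝ) • m.rho' e (skewPart c (e s)) (m.mul (m.mul (e s) x) u) =
        (4 : ℝ) • inner ℝ u (e s) • ((m.rho' e ∘ₗ skewPart c).flip x) (e s)
        + (((k : ℝ) - 4) • m.mul (m.mul u x) (c (e s) (e s))) := by
      intro s
      rw [eq_sub_of_add_eq' (m.mul_mul_add u (e s) x), map_sub, smul_sub, hP']
      simp only [map_smul, LinearMap.flip_apply, LinearMap.comp_apply]
      module
    have s1 : ∑ s, inner ℝ u (e s) • ((m.rho' e ∘ₗ skewPart c).flip x) (e s) =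
        m.rho' e (skewPart c u) x := sum_inner_smul_map e ((m.rho' e ∘ₗ skewPart c).flip x) u
    have s2 : ∑ s, ((k : ℝ) - 4) • m.mul (m.mul u x) (c (e s) (e s)) = 0 := by
      rw [← Finset.smul_sum, ← map_sum, htr, map_zero, smul_zero]
    have s3 : ∑ s, (2 : ℝ) • m.rho' e (skewPart c u) (m.mul (m.mul (e s) x) (e s)) =
        (k : ℝ) • (2 : ℝ) • m.rho' e (skewPart c u) x := by
      simp only [m.mul_mul_self, inner_basis_self, one_smul, Finset.sum_const, Finset.card_univ,
        Fintype.card_fin, ← Nat.cast_smul_eq_nsmul ℝ]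
    rw [Finset.sum_add_distrib, Finset.sum_congr rfl fun s _ => h2 s, Finset.sum_add_distrib,
      s2, s3, ← Finset.smul_sum, s1, Finset.sum_neg_distrib, ← Finset.smul_sum, ← rho'_apply,
      hrho'] at h1
    have h3 : (2 * (2 * k - 2 : ℝ)) • m.rho' e (skewPart c u) x = 0 := by
      linear_combination (norm := module) (1 : ℝ) • h1
    rcases smul_eq_zero.1 h3 with h4 | h4
    · exact absurd h4 (mul_ne_zero two_ne_zero hkk)
    · exact h4
  refine ⟨hP0, fun u v x => ?_⟩
  have h1 := hRrho u (m.mul v x)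
  rw [hrho, m.rho_mul e (inner_skewPart_self u), hP0, map_zero, add_zero] at h1
  -- For k = 4 the coefficient is 8/6 = 4/3. Otherwise `hP` forces c(u, u) = 0, hence c = 0, and
  -- both sides vanish.
  by_cases h4 : (k : ℝ) = 4
  · rw [h4] at h1
    simp only [map_smul, LinearMap.smul_apply]
    linear_combination (norm := module) (1 / 6 : ℝ) • h1
  · have hcu : ∀ w, c w w = 0 := by
      intro w
      have h5 : ((k : ℝ) - 4) • c w w = 0 := by
        refine m.eq_zero_of_mul_eq_zero fun x => ?_
        rw [← hP, hP0, smul_zero, map_zero]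
      rcases smul_eq_zero.1 h5 with h6 | h6
      · exact absurd (by linarith) h4
      · exact h6
    have hcuv : ∀ w w', c w w' = 0 := by
      intro w w'
      have h5 := hcu (w + w')
      simp only [map_add, LinearMap.add_apply, hcu, hc w' w] at h5
      linear_combination (norm := module) (1 / 2 : ℝ) • h5
    have hA : skewPart c u v = 0 := by
      refine ext_inner_right ℝ fun z => ?_
      rw [inner_skewPart, hcuv, hcuv]; simp
    rw [hA] at h1 ⊢
    rw [smul_zero, map_zero, LinearMap.zero_apply]
    rw [map_zero, LinearMap.zero_apply, smul_zero, smul_zero] at h1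
    rcases smul_eq_zero.1 h1 with h6 | h6
    · exact absurd h6 hk2.ne'
    · exact h6
/-- Solutions of `R(u) L_u = L_u P(u) + L_{c(u)}` are, up to related triples depending linearly
on `u`, of the form `c = 0`, `P(u) = L_dᵀ L_u - L_uᵀ L_d`, `R(u) = L_u L_dᵀ - L_d L_uᵀ`. -/
theorem tri_normal (e : OrthonormalBasis (Fin k) ℝ K) {P : K →ₗ[ℝ] K →ₗ[ℝ] K} (hk : k ≠ 1) (hc : ∀
    u v, c u v = c v u)
    (hc0 : ∀ u, inner ℝ (c u u) u = 0) (hP : ∀ u x, inner ℝ (P u x) x = 0)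
    (hR : ∀ u x, inner ℝ (R u x) x = 0)
    (h : ∀ u x, R u (m.mul u x) = m.mul u (P u x) + m.mul (c u u) x) (i : Fin 3) :
    ∃ (d : K) (S : K →ₗ[ℝ] (Fin 3 → K →ₗ[ℝ] K)), (∀ u, S u ∈ m.tri) ∧
      ∀ u x, c u u = S u i u ∧
        P u x = S u (i + 1) x + (m.mul (m.mul u x) d - m.mul (m.mul d x) u) ∧
        R u x = S u (i + 2) x + (m.mul u (m.mul x d) - m.mul d (m.mul x u)) := by
  have hkk : (4 * (1 - k) : ℝ) ≠ 0 := by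
    intro h
    apply hk
    have : (k : ℝ) = 1 := by linarith
    exact_mod_cast this
  -- first make `P` vanish
  set T : K →ₗ[ℝ] (Fin 3 → K →ₗ[ℝ] K) := m.lift e (i + 1) ∘ₗ P with hT
  have e1 : i + 1 + 1 = i + 2 := by rw [add_assoc]; rfl
  have e2 : i + 1 + 2 = i := by rw [add_assoc]; simp
  have hTmem : ∀ u, T u ∈ m.tri := fun u => m.lift_mem_tri e (hP u) (i + 1)
  have hTP : ∀ u, T u (i + 1) = P u := fun u => m.lift_self e (i + 1)
  let c₁ : K →ₗ[ℝ] K →ₗ[ℝ] K :=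
    c - (1 / 2 : ℝ) • (LinearMap.proj i ∘ₗ T + (LinearMap.proj i ∘ₗ T).flip)
  have hc₁ : ∀ u v, c₁ u v = c u v - (1 / 2 : ℝ) • (T u i v + T v i u) := fun u v => rfl
  set c0 : K := ∑ s, c₁ (e s) (e s) with hc0def
  -- The map `2 (wedge d + (wedge d).flip)` has trace `4 (1 - k) d`, so this `d` makes `c₂` trace
  -- free, as `tri_normal_core` requires.
  set d : K := (1 / (4 * (1 - k) : ℝ)) • c0 with hd
  let c₂ : K →ₗ[ℝ] K →ₗ[ℝ] K := c₁ - (2 : ℝ) • (wedge d + (wedge d).flip)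
  have hc₂ : ∀ u v, c₂ u v = c₁ u v - (2 : ℝ) • (wedge d u v + wedge d v u) := fun u v => rfl
  let R₂ : K →ₗ[ℝ] K →ₗ[ℝ] K :=
    R - LinearMap.proj (i + 2) ∘ₗ T - (2 : ℝ) • (m.rho e ∘ₗ wedge d)
  have hR₂ : ∀ u x, R₂ u x = R u x - T u (i + 2) x - (2 : ℝ) • m.rho e (wedge d u) x :=
    fun u x => rfl
  have hlift : ∀ A : K →ₗ[ℝ] K, m.lift e i A i = A := fun A => m.lift_self e i
  -- In other words `c = 2 wedge d`, `P = 0`, `R = ρ(wedge d u)` solves the same equation, so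
  -- multiples of it can be subtracted.
  have hrw : ∀ u x, m.rho e (wedge d u) (m.mul u x) = (2 : ℝ) • m.mul (wedge d u u) x := by
    intro u x
    have h1 := m.mul_mul_add' u d (m.mul u x)
    rw [rho_wedge, eq_sub_of_add_eq h1, m.mul_mul_self, wedge_apply, real_inner_comm u d]
    simp only [map_sub, map_smul, LinearMap.sub_apply, LinearMap.smul_apply]
    module
  have hsymm : ∀ u v, c₂ u v = c₂ v u := by
    intro u v
    rw [hc₂, hc₂, hc₁, hc₁, hc u v]
    module
  have hinner : ∀ u, inner ℝ (c₂ u u) u = 0 := by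
    intro u
    rw [hc₂, hc₁]
    simp only [inner_sub_left, real_inner_smul_left, inner_add_left, hc0, (hTmem u).1, wedge_skew]
    ring
  have core := m.tri_normal_core e (c := c₂) (R := R₂) hk hsymm hinner ?_ ?_ ?_
  · obtain ⟨k1, k2⟩ := core
    -- Since `x (x x) = |x|² x`, knowing `R₂ u` on products determines it on every vector.
    have hR₂' : ∀ u x, R₂ u x = (4 / 3 : ℝ) • (1 / 4 : ℝ) • m.rho e (skewPart c₂ u) x := by
      intro u x
      have h1 := k2 u x (m.mul x x)
      have h2 := m.rho_mul e (inner_skewPart_self (c := c₂) u) x (m.mul x x)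
      rw [k1, map_zero, add_zero] at h2
      rw [m.mul_mul_self'] at h1 h2
      have h3 : (inner ℝ x x : ℝ) •
          (R₂ u x - (4 / 3 : ℝ) • (1 / 4 : ℝ) • m.rho e (skewPart c₂ u) x) = 0 := by
        simp only [map_smul, LinearMap.smul_apply] at h1 h2
        linear_combination (norm := module) (1 : ℝ) • h1 - (1 / 3 : ℝ) • h2
      rcases smul_eq_zero.1 h3 with h4 | h4
      · rw [inner_self_eq_zero.1 h4]; simp
      · exact sub_eq_zero.1 h4
    -- Of the two copies of `ρ(wedge d u)` subtracted in `R₂`, one is supplied by the related triple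
    -- `4 lift (wedge d u)` and the other is the explicit term in `d`. Their contributions to `P`
    -- cancel.
    refine ⟨d, T + (4 / 3 : ℝ) • (m.lift e i ∘ₗ skewPart c₂) +
      (4 : ℝ) • (m.lift e i ∘ₗ wedge d), ?_, ?_⟩
    · intro u
      exact Submodule.add_mem _ (Submodule.add_mem _ (hTmem u) (Submodule.smul_mem _ _
        (m.lift_mem_tri e (inner_skewPart_self u) i))) (Submodule.smul_mem _ _
        (m.lift_mem_tri e (wedge_skew d u) i))
    · intro u x
      simp only [LinearMap.add_apply, LinearMap.smul_apply, LinearMap.comp_apply, Pi.add_apply,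
        Pi.smul_apply, hlift, lift_one, lift_two, hTP, k1]
      refine ⟨?_, ?_, ?_⟩
      · have h1 := hc₂ u u
        rw [hc₁] at h1
        rw [skewPart_self hsymm hinner]
        linear_combination (norm := module) (-1 : ℝ) • h1
      · rw [rho'_wedge]; module
      · have h1 := hR₂ u x
        rw [hR₂'] at h1
        rw [← rho_wedge m e]
        linear_combination (norm := module) (-1 : ℝ) • h1
  · have h1 : ∀ s, wedge d (e s) (e s) = inner ℝ d (e s) • e s - d := by
      intro s
      rw [wedge_apply, inner_basis_self, one_smul]
    simp only [hc₂, h1, Finset.sum_sub_distrib, ← hc0def, ← Finset.smul_sum,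
      Finset.sum_add_distrib, sum_inner_smul, Finset.sum_const, Finset.card_univ,
      Fintype.card_fin, ← Nat.cast_smul_eq_nsmul ℝ]
    have h2 : c0 = (4 * (1 - k) : ℝ) • d := by
      rw [hd, smul_smul, mul_one_div_cancel hkk, one_smul]
    rw [h2]
    module
  · intro u x
    rw [hR₂]
    simp only [inner_sub_left, real_inner_smul_left, hR, (hTmem u).1,
      m.rho_skew e (wedge_skew d u)]
    ring
  · intro u x
    rw [hR₂, h, hrw, m.tri_apply_mul (hTmem u) i, hTP, hc₂, hc₁]
    simp only [map_sub, map_smul, map_add, LinearMap.sub_apply, LinearMap.smul_apply,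
      LinearMap.add_apply]
    module
end

end SymComp
end

noncomputable section

/-! ### Hermitian matrices over a symmetric composition algebra -/

/-- Hermitian `3 × 3` matrices over `K`: three real diagonal entries, and three off-diagonal
entries in `K`. -/
abbrev Herm (K : Type*) := (Fin 3 → ℝ) × (Fin 3 → K)

namespace Herm

variable {K : Type*} [NormedAddCommGroup K]

/-- The diagonal idempotents. -/
def idem (l : Fin 3) : Herm K := (Pi.single l 1, 0)

theorem idem_fst (l j : Fin 3) : (idem l : Herm K).1 j = if j = l then 1 else 0 := by
  simp [idem, Pi.single_apply]

theorem idem_snd (l j : Fin 3) : (idem l : Herm K).2 j = 0 := rfl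

variable [InnerProductSpace ℝ K]

/-- The matrices with a single off-diagonal entry. -/
def off (i : Fin 3) : K →ₗ[ℝ] Herm K :=
  LinearMap.inr ℝ (Fin 3 → ℝ) (Fin 3 → K) ∘ₗ LinearMap.single ℝ (fun _ => K) i

theorem off_fst (i j : Fin 3) (X : K) : (off i X).1 j = 0 := rfl

theorem off_snd (i j : Fin 3) (X : K) : (off i X).2 j = if j = i then X else 0 := by
  simp [off, Pi.single_apply]

theorem eq_sum (x : Herm K) : x = ∑ l, x.1 l • idem l + ∑ i, off i (x.2 i) := by
  refine Prod.ext (funext fun j => ?_) (funext fun j => ?_)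
  · simp [Prod.fst_sum, idem_fst, off_fst]
  · simp [Prod.snd_sum, idem_snd, off_snd]

/-- The trace. -/
def tr : Herm K →ₗ[ℝ] ℝ := ∑ l, LinearMap.proj l ∘ₗ LinearMap.fst ℝ (Fin 3 → ℝ) (Fin 3 → K)

theorem tr_apply (x : Herm K) : tr x = x.1 0 + x.1 1 + x.1 2 := by
  simp [tr, Fin.sum_univ_three]

/-- The trace form. -/
def form : Herm K →ₗ[ℝ] Herm K →ₗ[ℝ] ℝ :=
  LinearMap.mk₂ ℝ (fun x y => ∑ i, (x.1 i * y.1 i + 2 * inner ℝ (x.2 i) (y.2 i)))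
    (fun x x' y => by
      rw [← Finset.sum_add_distrib]
      refine Finset.sum_congr rfl fun i _ => ?_
      simp only [Prod.fst_add, Prod.snd_add, Pi.add_apply, inner_add_left]; ring)
    (fun r x y => by
      rw [Finset.smul_sum]
      refine Finset.sum_congr rfl fun i _ => ?_
      simp only [Prod.smul_fst, Prod.smul_snd, Pi.smul_apply, real_inner_smul_left,
        smul_eq_mul]; ring)
    (fun x y y' => by
      rw [← Finset.sum_add_distrib]
      refine Finset.sum_congr rfl fun i _ => ?_
      simp only [Prod.fst_add, Prod.snd_add, Pi.add_apply, inner_add_right]; ring)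
    (fun r x y => by
      rw [Finset.smul_sum]
      refine Finset.sum_congr rfl fun i _ => ?_
      simp only [Prod.smul_fst, Prod.smul_snd, Pi.smul_apply, real_inner_smul_right,
        smul_eq_mul]; ring)

theorem form_apply (x y : Herm K) :
    form x y = ∑ i, (x.1 i * y.1 i + 2 * inner ℝ (x.2 i) (y.2 i)) := rfl

theorem form_comm (x y : Herm K) : form x y = form y x := by
  simp only [form_apply, mul_comm (x.1 _), real_inner_comm (x.2 _)]

theorem form_idem (x : Herm K) (l : Fin 3) : form x (idem l) = x.1 l := by
  simp [form_apply, idem_fst, idem_snd]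

theorem form_off (x : Herm K) (i : Fin 3) (X : K) :
    form x (off i X) = 2 * inner ℝ (x.2 i) X := by
  rw [form_apply, Finset.sum_eq_single i]
  · simp [off_fst, off_snd]
  · intro j _ hj; simp [off_fst, off_snd, hj]
  · simp

theorem eq_of_form {x y : Herm K} (h : ∀ z, form x z = form y z) : x = y := by
  refine Prod.ext (funext fun j => ?_) (funext fun j => ?_)
  · rw [← form_idem, ← form_idem, h]
  · refine ext_inner_right ℝ fun X => ?_
    have := h (off j X)
    rw [form_off, form_off] at this
    linarith

end Herm

namespace SymComp
open Herm

variable {K : Type*} [NormedAddCommGroup K] [InnerProductSpace ℝ K] (m : SymComp K)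

/-- The polarised adjoint on hermitian matrices. -/
def cross : Herm K →ₗ[ℝ] Herm K →ₗ[ℝ] Herm K :=
  LinearMap.mk₂ ℝ (fun x y =>
    (fun i => 1 / 2 * (x.1 (i + 1) * y.1 (i + 2) + x.1 (i + 2) * y.1 (i + 1))
        - inner ℝ (x.2 i) (y.2 i),
      fun i => (1 / 2 : ℝ) • (m.mul (x.2 (i + 1)) (y.2 (i + 2)) + m.mul (y.2 (i + 1)) (x.2 (i + 2))
        - x.1 i • y.2 i - y.1 i • x.2 i)))
    (fun x x' y => by
      refine Prod.ext (funext fun j => ?_) (funext fun j => ?_)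
      · simp [inner_add_left]; ring
      · simp [map_add]; module)
    (fun r x y => by
      refine Prod.ext (funext fun j => ?_) (funext fun j => ?_)
      · simp [real_inner_smul_left]; ring
      · simp; module)
    (fun x y y' => by
      refine Prod.ext (funext fun j => ?_) (funext fun j => ?_)
      · simp [inner_add_right]; ring
      · simp [map_add]; module)
    (fun r x y => by
      refine Prod.ext (funext fun j => ?_) (funext fun j => ?_)
      · simp [real_inner_smul_right]; ring
      · simp; module)

theorem cross_fst (x y : Herm K) (i : Fin 3) : (m.cross x y).1 i =
    1 / 2 * (x.1 (i + 1) * y.1 (i + 2) + x.1 (i + 2) * y.1 (i + 1))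
        - inner ℝ (x.2 i) (y.2 i) := rfl

theorem cross_snd (x y : Herm K) (i : Fin 3) : (m.cross x y).2 i =
    (1 / 2 : ℝ) • (m.mul (x.2 (i + 1)) (y.2 (i + 2)) + m.mul (y.2 (i + 1)) (x.2 (i + 2))
        - x.1 i • y.2 i - y.1 i • x.2 i) := rfl

theorem cross_comm (x y : Herm K) : m.cross x y = m.cross y x := by
  refine Prod.ext (funext fun j => ?_) (funext fun j => ?_)
  · rw [cross_fst, cross_fst, real_inner_comm]; ring
  · rw [cross_snd, cross_snd]; module

/-- The three indices of `Fin 3` sum to zero, so for `i ≠ j` the remaining index is `-(i + j) = 2 *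
(i + j)`. The same expression names the third slot below. -/
theorem cross_idem_idem (i j : Fin 3) : m.cross (idem i) (idem j) =
    if i = j then 0 else (1 / 2 : ℝ) • idem (2 * (i + j)) := by
  refine Prod.ext (funext fun l => ?_) (funext fun l => ?_)
  · rw [cross_fst]
    fin_cases i <;> fin_cases j <;> fin_cases l <;> simp [idem_fst, idem_snd]
  · rw [cross_snd]
    split_ifs <;> simp [idem_snd]

theorem cross_idem_off (l i : Fin 3) (X : K) : m.cross (idem l) (off i X) =
    if l = i then -(1 / 2 : ℝ) • off i X else 0 := by
  refine Prod.ext (funext fun j => ?_) (funext fun j => ?_)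
  · rw [cross_fst]
    split_ifs <;> simp [off_fst, idem_snd]
  · rw [cross_snd]
    fin_cases i <;> fin_cases j <;> fin_cases l <;> simp [idem_snd, idem_fst, off_snd, off_fst]

theorem cross_off_idem (l i : Fin 3) (X : K) : m.cross (off i X) (idem l) =
    if l = i then -(1 / 2 : ℝ) • off i X else 0 := by
  rw [cross_comm, cross_idem_off]

theorem cross_off_off (i j : Fin 3) (X Y : K) : m.cross (off i X) (off j Y) =
    if i = j then (- inner ℝ X Y : ℝ) • idem i else if j = i + 1 then
      (1 / 2 : ℝ) • off (2 * (i + j)) (m.mul X Y) else (1 / 2 : ℝ) • off (2 * (i + j)) (m.mul Y X)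
          := by
  refine Prod.ext (funext fun l => ?_) (funext fun l => ?_)
  · rw [cross_fst]
    fin_cases i <;> fin_cases j <;> fin_cases l <;> simp [idem_fst, off_snd, off_fst]
  · rw [cross_snd]
    fin_cases i <;> fin_cases j <;> fin_cases l <;> simp [idem_snd, off_snd, off_fst]

/-- The derivations of the cubic norm structure on hermitian matrices. -/
def der : Submodule ℝ (Herm K →ₗ[ℝ] Herm K) where
  carrier := {D | (∀ x, tr (D x) = 0) ∧ (∀ x y, form (D x) y + form (D y) x = 0) ∧
    ∀ x y z, form (D x) (m.cross y z) + form (D y) (m.cross z x) + form (D z) (m.cross x y) = 0}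
  zero_mem' := by simp
  add_mem' := by
    rintro C D ⟨h1, h2, h3⟩ ⟨h4, h5, h6⟩
    simp only [Set.mem_ofPred_eq, LinearMap.add_apply, map_add]
    refine ⟨fun x => ?_, fun x y => ?_, fun x y z => ?_⟩
    · rw [h1, h4, add_zero]
    · linarith [h2 x y, h5 x y]
    · linarith [h3 x y z, h6 x y z]
  smul_mem' := by
    rintro c D ⟨h1, h2, h3⟩
    simp only [Set.mem_ofPred_eq, LinearMap.smul_apply, map_smul, smul_eq_mul]
    refine ⟨fun x => ?_, fun x y => ?_, fun x y z => ?_⟩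
    · rw [h1, mul_zero]
    · linear_combination c * h2 x y
    · linear_combination c * h3 x y z

/-- Symmetric bilinear maps `b` such that `b(x, x)` is orthogonal to `1`, `x` and the adjoint
of `x`. -/
def normalFields : Submodule ℝ (Herm K →ₗ[ℝ] Herm K →ₗ[ℝ] Herm K) where
  carrier := {b | (∀ x y, b x y = b y x) ∧ (∀ x y, tr (b x y) = 0) ∧
    (∀ x y z, form (b x y) z + form (b y z) x + form (b z x) y = 0) ∧
    ∀ x y z w, form (b x y) (m.cross z w) + form (b x z) (m.cross y w) +
      form (b x w) (m.cross y z) + form (b y z) (m.cross x w) + form (b y w) (m.cross x z) +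
      form (b z w) (m.cross x y) = 0}
  zero_mem' := by simp
  add_mem' := by
    rintro C D ⟨h0, h1, h2, h3⟩ ⟨h4, h5, h6, h7⟩
    simp only [Set.mem_ofPred_eq, LinearMap.add_apply, map_add]
    refine ⟨fun x y => ?_, fun x y => ?_, fun x y z => ?_, fun x y z w => ?_⟩
    · rw [h0, h4]
    · rw [h1, h5, add_zero]
    · linarith [h2 x y z, h6 x y z]
    · linarith [h3 x y z w, h7 x y z w]
  smul_mem' := by
    rintro c D ⟨h0, h1, h2, h3⟩
    simp only [Set.mem_ofPred_eq, LinearMap.smul_apply, map_smul, smul_eq_mul]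
    refine ⟨fun x y => ?_, fun x y => ?_, fun x y z => ?_, fun x y z w => ?_⟩
    · rw [h0]
    · rw [h1, mul_zero]
    · linear_combination c * h2 x y z
    · linear_combination c * h3 x y z w

/-- The bilinear map `(D_x y + D_y x) / 2`. -/
def symm : (Herm K →ₗ[ℝ] Herm K →ₗ[ℝ] Herm K) →ₗ[ℝ] Herm K →ₗ[ℝ] Herm K →ₗ[ℝ] Herm K where
  toFun D := (1 / 2 : ℝ) • (D + D.flip)
  map_add' C D := by
    refine LinearMap.ext₂ fun x y => ?_
    simp only [LinearMap.add_apply, LinearMap.smul_apply, LinearMap.flip_apply]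
    module
  map_smul' c D := by
    refine LinearMap.ext₂ fun x y => ?_
    simp only [LinearMap.add_apply, LinearMap.smul_apply, LinearMap.flip_apply, RingHom.id_apply]
    module

theorem symm_apply (D : Herm K →ₗ[ℝ] Herm K →ₗ[ℝ] Herm K) (x y : Herm K) :
    symm D x y = (1 / 2 : ℝ) • (D x y + D y x) := rfl

theorem symm_mem_normalFields {D : Herm K →ₗ[ℝ] Herm K →ₗ[ℝ] Herm K} (hD : ∀ z, D z ∈ m.der) :
    symm D ∈ m.normalFields := by
  have h1 := fun z => (hD z).1
  have h2 := fun z => (hD z).2.1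
  have h3 := fun z => (hD z).2.2
  refine ⟨fun x y => ?_, fun x y => ?_, fun x y z => ?_, fun x y z w => ?_⟩
  · rw [symm_apply, symm_apply, add_comm]
  · rw [symm_apply, map_smul, map_add, h1, h1]; simp
  · simp only [symm_apply, map_smul, map_add, LinearMap.add_apply, LinearMap.smul_apply,
      smul_eq_mul]
    linarith [h2 x y z, h2 y x z, h2 z x y]
  · simp only [symm_apply, map_smul, map_add, LinearMap.add_apply, LinearMap.smul_apply,
      smul_eq_mul]
    rw [m.cross_comm x w, m.cross_comm y w, m.cross_comm z w]
    have a1 := h3 x y z w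
    have a2 := h3 y x z w
    have a3 := h3 z x y w
    have a4 := h3 w x y z
    rw [m.cross_comm z w] at a1 a2
    rw [m.cross_comm y w] at a3
    rw [m.cross_comm z x] at a4
    linarith

/-- Write x# for the adjoint of x. Then S x# is orthogonal to x# because S is skew, and to x because
⟨S x#, x⟩ = -⟨x#, S x⟩, which is zero by invariance of the cubic form. -/
theorem comp_cross_mem_normalFields {S : Herm K →ₗ[ℝ] Herm K} (hS : S ∈ m.der) :
    m.cross.compr₂ S ∈ m.normalFields := by
  obtain ⟨h1, h2, h3⟩ := hS
  refine ⟨fun x y => ?_, fun x y => ?_, fun x y z => ?_, fun x y z w => ?_⟩ <;>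
    simp only [LinearMap.compr₂_apply]
  · rw [m.cross_comm]
  · exact h1 _
  · have a1 := h2 (m.cross x y) z
    have a2 := h2 (m.cross y z) x
    have a3 := h2 (m.cross z x) y
    linarith [h3 x y z]
  · linarith [h2 (m.cross x y) (m.cross z w), h2 (m.cross x z) (m.cross y w),
      h2 (m.cross x w) (m.cross y z)]

/-- The bilinear maps obtained from linear families of derivations and from single
derivations. -/
def derFields : Submodule ℝ (Herm K →ₗ[ℝ] Herm K →ₗ[ℝ] Herm K) where
  carrier := {b | ∃ D : Herm K →ₗ[ℝ] Herm K →ₗ[ℝ] Herm K, (∀ z, D z ∈ m.der) ∧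
    ∃ S ∈ m.der, b = symm D + m.cross.compr₂ S}
  zero_mem' := by
    refine ⟨0, fun z => zero_mem _, 0, zero_mem _, ?_⟩
    refine LinearMap.ext₂ fun x y => ?_
    simp
  add_mem' := by
    rintro _ _ ⟨C, hC, S, hS, rfl⟩ ⟨D, hD, T, hT, rfl⟩
    refine ⟨C + D, fun z => add_mem (hC z) (hD z), S + T, add_mem hS hT, ?_⟩
    rw [map_add]
    refine LinearMap.ext₂ fun x y => ?_
    simp only [LinearMap.add_apply, LinearMap.compr₂_apply]
    abel
  smul_mem' := by
    rintro c _ ⟨C, hC, S, hS, rfl⟩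
    refine ⟨c • C, fun z => Submodule.smul_mem _ _ (hC z), c • S, Submodule.smul_mem _ _ hS, ?_⟩
    rw [map_smul]
    refine LinearMap.ext₂ fun x y => ?_
    simp only [LinearMap.add_apply, LinearMap.smul_apply, LinearMap.compr₂_apply]
    module

theorem symm_mem_derFields {D : Herm K →ₗ[ℝ] Herm K →ₗ[ℝ] Herm K} (hD : ∀ z, D z ∈ m.der) :
    symm D ∈ m.derFields := by
  refine ⟨D, hD, 0, zero_mem _, ?_⟩
  refine LinearMap.ext₂ fun x y => ?_
  simp

theorem comp_cross_mem_derFields {S : Herm K →ₗ[ℝ] Herm K} (hS : S ∈ m.der) :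
    m.cross.compr₂ S ∈ m.derFields := by
  refine ⟨0, fun z => zero_mem _, S, hS, ?_⟩
  simp

theorem derFields_le_normalFields : m.derFields ≤ m.normalFields := by
  rintro _ ⟨D, hD, S, hS, rfl⟩
  exact add_mem (m.symm_mem_normalFields hD) (m.comp_cross_mem_normalFields hS)

end SymComp
end

/-! ### Explicit derivations, and the first constraints on the diagonal of a normal field. -/

noncomputable section

namespace SymComp
open Herm

variable {K : Type*} [NormedAddCommGroup K] [InnerProductSpace ℝ K] (m : SymComp K)

theorem mem_der_of {D : Herm K →ₗ[ℝ] Herm K} (h1 : ∀ x, tr (D x) = 0)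
    (h2 : ∀ x, form (D x) x = 0) (h3 : ∀ x, form (D x) (m.cross x x) = 0) : D ∈ m.der := by
  refine ⟨h1, fun x y => ?_, fun x y z => ?_⟩
  · have := h2 (x + y)
    simp only [map_add, LinearMap.add_apply, h2] at this
    linarith
  · have a1 := h3 (x + y + z)
    have a2 := h3 (x + y)
    have a3 := h3 (x + z)
    have a4 := h3 (y + z)
    simp only [map_add, LinearMap.add_apply, h3] at a1 a2 a3 a4
    rw [m.cross_comm z y, m.cross_comm z x, m.cross_comm y x] at a1
    rw [m.cross_comm y x] at a2
    rw [m.cross_comm z x] at a3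
    rw [m.cross_comm z y] at a4
    rw [m.cross_comm z x]
    linarith

/-- The derivation acting on the off-diagonal entries by endomorphisms. -/
def diagDer : (Fin 3 → K →ₗ[ℝ] K) →ₗ[ℝ] Herm K →ₗ[ℝ] Herm K :=
  LinearMap.mk₂ ℝ (fun S x => (0, fun i => S i (x.2 i)))
    (fun S T x => by ext <;> simp) (fun c S x => by ext <;> simp)
    (fun S x y => by ext <;> simp) (fun c S x => by ext <;> simp)

theorem diagDer_fst (S : Fin 3 → K →ₗ[ℝ] K) (x : Herm K) (i : Fin 3) :
    (diagDer S x).1 i = 0 := rfl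

theorem diagDer_snd (S : Fin 3 → K →ₗ[ℝ] K) (x : Herm K) (i : Fin 3) :
    (diagDer S x).2 i = S i (x.2 i) := rfl

/-- The cubic form depends on the off-diagonal entries only through their norms and the trilinear
form ⟨x₀, x₁ x₂⟩. Skewness preserves the former, relatedness the latter. -/
theorem diagDer_mem_der {S : Fin 3 → K →ₗ[ℝ] K} (hS : S ∈ m.tri) : diagDer S ∈ m.der := by
  refine m.mem_der_of (fun x => ?_) (fun x => ?_) fun x => ?_
  · simp [tr_apply, diagDer_fst]
  · simp [form_apply, diagDer_fst, diagDer_snd, hS.1]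
  · have := hS.2 0 (x.2 0) (x.2 1) (x.2 2)
    simp [form_apply, diagDer_fst, diagDer_snd, Fin.sum_univ_three, cross_snd, inner_smul_right,
      inner_sub_right, inner_add_right, hS.1] at this ⊢
    linarith

/-- The infinitesimal rotation in the plane of two diagonal idempotents. -/
def rot (i : Fin 3) : K →ₗ[ℝ] Herm K →ₗ[ℝ] Herm K :=
  LinearMap.mk₂ ℝ (fun d x =>
    (fun j => if j = i then 0 else if j = i + 1 then -(2 * inner ℝ (x.2 i) d)
        else 2 * inner ℝ (x.2 i) d,
      fun j => if j = i then (x.1 (i + 1) - x.1 (i + 2)) • d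
        else if j = i + 1 then m.mul (x.2 (i + 2)) d else - m.mul d (x.2 (i + 1))))
    (fun d d' x => by
      refine Prod.ext (funext fun j => ?_) (funext fun j => ?_)
      · simp only [inner_add_right, Prod.fst_add, Pi.add_apply]; split_ifs <;> ring
      · simp only [map_add, LinearMap.add_apply, Prod.snd_add, Pi.add_apply]
        split_ifs <;> module)
    (fun r d x => by
      refine Prod.ext (funext fun j => ?_) (funext fun j => ?_)
      · simp only [inner_smul_right, Prod.smul_fst, Pi.smul_apply, smul_eq_mul]
        split_ifs <;> ring
      · simp only [map_smul, LinearMap.smul_apply, Prod.smul_snd, Pi.smul_apply]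
        split_ifs <;> module)
    (fun d x y => by
      refine Prod.ext (funext fun j => ?_) (funext fun j => ?_)
      · simp only [inner_add_left, Prod.fst_add, Prod.snd_add, Pi.add_apply]
        split_ifs <;> ring
      · simp only [map_add, LinearMap.add_apply, Prod.fst_add, Prod.snd_add, Pi.add_apply]
        split_ifs <;> module)
    (fun r d x => by
      refine Prod.ext (funext fun j => ?_) (funext fun j => ?_)
      · simp only [real_inner_smul_left, Prod.smul_fst, Prod.smul_snd, Pi.smul_apply, smul_eq_mul]
        split_ifs <;> ring
      · simp only [map_smul, LinearMap.smul_apply, Prod.smul_fst, Prod.smul_snd, Pi.smul_apply,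
          smul_eq_mul]
        split_ifs <;> module)

theorem rot_fst (i : Fin 3) (d : K) (x : Herm K) (j : Fin 3) : (m.rot i d x).1 j =
    if j = i then 0 else if j = i + 1 then -(2 * inner ℝ (x.2 i) d)
      else 2 * inner ℝ (x.2 i) d := rfl

theorem rot_snd (i : Fin 3) (d : K) (x : Herm K) (j : Fin 3) : (m.rot i d x).2 j =
    if j = i then (x.1 (i + 1) - x.1 (i + 2)) • d
      else if j = i + 1 then m.mul (x.2 (i + 2)) d else - m.mul d (x.2 (i + 1)) := rfl

theorem sum_eq_cycle {M : Type*} [AddCommMonoid M] (f : Fin 3 → M) (i : Fin 3) :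
    ∑ j, f j = f i + f (i + 1) + f (i + 2) := by
  fin_cases i <;> simp [Fin.sum_univ_three] <;> abel

theorem cycle_simps (i : Fin 3) : i + 1 + 1 = i + 2 ∧ i + 1 + 2 = i ∧ i + 2 + 1 = i ∧
    i + 2 + 2 = i + 1 ∧ i + 1 ≠ i ∧ i + 2 ≠ i ∧ i + 2 ≠ i + 1 := by
  fin_cases i <;> decide

/-- Invariance of the cubic form uses the composition law: the terms quadratic in a neighbouring
slot are ⟨x d, x y⟩ = |x|² ⟨d, y⟩ and its mirror image. -/
theorem rot_mem_der (i : Fin 3) (d : K) : m.rot i d ∈ m.der := by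
  obtain ⟨c1, c2, c3, c4, c5, c6, c7⟩ := cycle_simps i
  refine m.mem_der_of (fun x => ?_) (fun x => ?_) fun x => ?_
  · have := sum_eq_cycle (fun j => (m.rot i d x).1 j) i
    simp only [Fin.sum_univ_three, rot_fst, if_true, c5, c6, c7, if_false] at this
    simp only [tr_apply, rot_fst]
    linarith
  · rw [form_apply, sum_eq_cycle _ i]
    simp only [rot_fst, rot_snd, if_true, c5, c6, c7, if_false, inner_neg_left,
      real_inner_smul_left]
    have h1 := m.inner_mul (x.2 (i + 2)) d (x.2 (i + 1))
    rw [real_inner_comm d, h1, real_inner_comm (m.mul d (x.2 (i + 1)))]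
    ring
  · rw [form_apply, sum_eq_cycle _ i]
    simp only [rot_fst, rot_snd, if_true, c1, c2, c3, c4, c5, c6, c7, if_false, inner_neg_left,
      real_inner_smul_left, cross_fst, cross_snd, inner_smul_right, inner_sub_right,
      inner_add_right]
    have h1 := m.inner_mul (x.2 (i + 2)) d (x.2 (i + 1))
    have h2 := m.inner_mul_cycle (x.2 (i + 2)) d (x.2 (i + 1))
    have h3 := real_inner_comm d (m.mul (x.2 (i + 1)) (x.2 (i + 2)))
    have h4 := real_inner_comm (x.2 (i + 2)) (m.mul d (x.2 (i + 1)))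
    have h5 := m.inner_mul_mul_left (x.2 (i + 2)) d (x.2 i)
    have h6 := m.inner_mul_mul_right (x.2 (i + 1)) d (x.2 i)
    have h7 := real_inner_comm d (x.2 i)
    rw [h5, h6, h4, h1, h7, ← h3, ← h2, h1]
    ring

variable {m}
variable {b : Herm K →ₗ[ℝ] Herm K →ₗ[ℝ] Herm K}

theorem third_ne : ∀ {i j : Fin 3}, i ≠ j → i ≠ 2 * (i + j) ∧ j ≠ 2 * (i + j) ∧
    2 * (i + 2 * (i + j)) = j ∧ 2 * (j + 2 * (i + j)) = i := by decide

theorem third_cases : ∀ {l n : Fin 3} (j : Fin 3), l ≠ n → j = l ∨ j = n ∨ j = 2 * (l + n) := by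
  decide

theorem tr_eq {i j : Fin 3} (h : i ≠ j) (x : Herm K) :
    tr x = x.1 i + x.1 j + x.1 (2 * (i + j)) := by
  rw [tr_apply]
  fin_cases i <;> fin_cases j <;> simp at h ⊢ <;> ring

/-- For j = l this is orthogonality of b(x, x) to x. For j ≠ l, let n be the third index: in the
quartic condition at e_l, e_l, e_l, e_n only e_l × e_n = e_j / 2 contributes, because e_l × e_l = 0.
-/
theorem normalFields.idem_self_fst (hb : b ∈ m.normalFields) (l j : Fin 3) :
    (b (idem l) (idem l)).1 j = 0 := by
  obtain ⟨h0, h1, h2, h3⟩ := hb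
  by_cases h : l = j
  · subst h
    have := h2 (idem l) (idem l) (idem l)
    simp only [form_idem] at this
    linarith
  · obtain ⟨n1, n2, n3, n4⟩ := third_ne h
    have := h3 (idem l) (idem l) (idem l) (idem (2 * (l + j)))
    simp only [cross_idem_idem, n1, if_false, if_true, n3, map_smul, form_idem, map_zero,
      smul_eq_mul] at this
    linarith

theorem normalFields.idem_idem_fst (hb : b ∈ m.normalFields) (l n j : Fin 3) :
    (b (idem l) (idem n)).1 j = 0 := by
  have h0 := idem_self_fst hb
  obtain ⟨hs, h1, h2, -⟩ := hb
  have key : ∀ l n, (b (idem l) (idem n)).1 l = 0 := by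
    intro l n
    have := h2 (idem l) (idem l) (idem n)
    rw [hs (idem n)] at this
    simp only [form_idem, h0] at this
    linarith
  by_cases h : l = n
  · subst h; exact h0 l j
  · have e1 := key l n
    have e2 := key n l
    rw [hs] at e2
    have e3 := h1 (idem l) (idem n)
    rw [tr_eq h, e1, e2] at e3
    rcases third_cases j h with rfl | rfl | rfl
    · exact e1
    · exact e2
    · linarith

theorem normalFields.idem_off_fst (hb : b ∈ m.normalFields) (l i : Fin 3) (X : K) :
    (b (idem l) (off i X)).1 i = 0 := by
  obtain ⟨hs, h1, h2, h3⟩ := hb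
  by_cases h : l = i
  · subst h
    have e1 := h3 (idem l) (idem l) (idem l) (off l X)
    have e2 := h2 (idem l) (idem l) (off l X)
    rw [hs (off l X)] at e2
    simp only [cross_idem_off, cross_idem_idem, if_true, map_smul, form_idem, map_zero,
      smul_eq_mul] at e1 e2
    linarith
  · obtain ⟨n1, n2, n3, n4⟩ := third_ne h
    have e1 := h3 (idem i) (idem i) (idem l) (off i X)
    have e2 := h2 (idem i) (idem l) (off i X)
    have e3 := h1 (idem i) (off i X)
    rw [tr_eq h] at e3
    rw [hs (off i X)] at e2
    simp only [cross_idem_off, cross_idem_idem, if_true, map_smul, form_idem, map_zero,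
      smul_eq_mul, h, Ne.symm h, if_false, add_comm i l] at e1 e2
    have e4 := h3 (idem i) (idem i) (idem i) (off i X)
    have e5 := h2 (idem i) (idem i) (off i X)
    rw [hs (off i X)] at e5
    simp only [cross_idem_off, cross_idem_idem, if_true, map_smul, form_idem, map_zero,
      smul_eq_mul] at e4 e5
    linarith

theorem normalFields.off_off_fst (hb : b ∈ m.normalFields) (i : Fin 3) (X Y : K) :
    (b (off i X) (off i Y)).1 i = 0 := by
  have h0 := idem_self_fst hb
  obtain ⟨hs, h1, h2, h3⟩ := hb
  have e1 := h3 (idem i) (idem i) (off i X) (off i Y)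
  have e2 := h2 (idem i) (off i X) (off i Y)
  rw [hs (off i Y)] at e2
  simp only [cross_idem_off, cross_idem_idem, cross_off_off, if_true, map_smul, form_idem,
    map_zero, smul_eq_mul, h0] at e1 e2
  linarith

end SymComp
end

/-! ### Removing the diagonal entries by rotations. -/

noncomputable section

namespace SymComp
open Herm

variable {K : Type*} [NormedAddCommGroup K] [InnerProductSpace ℝ K] {m : SymComp K}
  {k : ℕ}
variable {b : Herm K →ₗ[ℝ] Herm K →ₗ[ℝ] Herm K}

theorem exists_linear_of_bilinear {E : Type*} [AddCommGroup E] [Module ℝ E]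
    (e : OrthonormalBasis (Fin k) ℝ K) (B : E →ₗ[ℝ] K →ₗ[ℝ] ℝ) :
    ∃ α : E →ₗ[ℝ] K, ∀ y X, inner ℝ (α y) X = B y X := by
  refine ⟨∑ s, (B.flip (e s)).smulRight (e s), fun y X => ?_⟩
  conv_rhs => rw [← sum_inner_smul e X]
  simp only [LinearMap.sum_apply, LinearMap.smulRight_apply, LinearMap.flip_apply, sum_inner,
    real_inner_smul_left, map_sum, map_smul, smul_eq_mul]
  exact Finset.sum_congr rfl fun s _ => by rw [real_inner_comm, mul_comm]

theorem bilin_eq_zero {E : Type*} [AddCommGroup E] [Module ℝ E] {b : Herm K →ₗ[ℝ] Herm K →ₗ[ℝ] E}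
    (hs : ∀ x y, b x y = b y x) (h : ∀ x, b x x = 0) (x y : Herm K) : b x y = 0 := by
  have := h (x + y)
  simp only [map_add, LinearMap.add_apply, h, hs y x] at this
  linear_combination (norm := module) (1 / 2 : ℝ) • this

/-- The entry on the diagonal. -/
def entry (j : Fin 3) : Herm K →ₗ[ℝ] ℝ :=
  LinearMap.proj j ∘ₗ LinearMap.fst ℝ (Fin 3 → ℝ) (Fin 3 → K)

theorem entry_apply (j : Fin 3) (x : Herm K) : entry j x = x.1 j := rfl

/-- The diagonal part. -/
def diagPart : Herm K →ₗ[ℝ] Herm K :=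
  LinearMap.inl ℝ (Fin 3 → ℝ) (Fin 3 → K) ∘ₗ LinearMap.fst ℝ (Fin 3 → ℝ) (Fin 3 → K)

/-- An off-diagonal part. -/
def offPart (i : Fin 3) : Herm K →ₗ[ℝ] Herm K :=
  off i ∘ₗ LinearMap.proj i ∘ₗ LinearMap.snd ℝ (Fin 3 → ℝ) (Fin 3 → K)

theorem offPart_apply (i : Fin 3) (x : Herm K) : offPart i x = off i (x.2 i) := rfl

theorem diagPart_eq (x : Herm K) : diagPart x = ∑ l, x.1 l • idem l := by
  refine Prod.ext (funext fun j => ?_) (funext fun j => ?_)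
  · simp [Prod.fst_sum, idem_fst, diagPart]
  · simp [Prod.snd_sum, idem_snd, diagPart]

theorem eq_parts (x : Herm K) (i : Fin 3) :
    x = diagPart x + offPart i x + offPart (i + 1) x + offPart (i + 2) x := by
  conv_lhs => rw [eq_sum x, sum_eq_cycle (fun i => off i (x.2 i)) i, ← diagPart_eq]
  simp only [offPart_apply]
  abel

theorem tr_eq_cycle (i : Fin 3) (x : Herm K) : tr x = x.1 i + x.1 (i + 1) + x.1 (i + 2) := by
  rw [← sum_eq_cycle, tr_apply, Fin.sum_univ_three]

theorem normalFields.sub {c : Herm K →ₗ[ℝ] Herm K →ₗ[ℝ] Herm K} (hb : b ∈ m.normalFields)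
    (hc : c ∈ m.normalFields) : b - c ∈ m.normalFields := by
  have : b - c = b + (-1 : ℝ) • c := by
    refine LinearMap.ext₂ fun x y => ?_
    simp only [LinearMap.sub_apply, LinearMap.add_apply, LinearMap.smul_apply]
    module
  rw [this]
  exact Submodule.add_mem _ hb (Submodule.smul_mem _ _ hc)

theorem derFields_of_sub {c : Herm K →ₗ[ℝ] Herm K →ₗ[ℝ] Herm K} (h : b - c ∈ m.derFields)
    (hc : c ∈ m.derFields) : b ∈ m.derFields := by
  have h1 := Submodule.add_mem _ h hc
  have : b = b - c + c := by
    refine LinearMap.ext₂ fun x y => ?_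
    simp only [LinearMap.sub_apply, LinearMap.add_apply]
    abel
  rwa [← this] at h1

/-- The right-hand side is the diagonal of `∑ rot i (α i y) y`, so a family of rotations absorbs the
diagonal of b(y, y). Vanishing of the trace is what makes contributions to different diagonal
entries consistent. -/
theorem normalFields.exists_rot (e : OrthonormalBasis (Fin k) ℝ K) (hb : b ∈ m.normalFields) :
    ∃ α : Fin 3 → Herm K →ₗ[ℝ] K, ∀ y j,
      (b y y).1 j = 2 * inner ℝ (α (j + 1) y) (y.2 (j + 1))
        - 2 * inner ℝ (α (j + 2) y) (y.2 (j + 2)) := by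
  -- The 1/2 prevents double counting of the part quadratic in `y_i`. A pair of distinct slots
  -- enters both corresponding functionals, through two different diagonal entries with opposite
  -- signs; the trace condition recovers the third entry.
  have hB : ∀ i : Fin 3, ∃ α : Herm K →ₗ[ℝ] K, ∀ y X, inner ℝ (α y) X =
      (b (diagPart y + (1 / 2 : ℝ) • offPart i y + offPart (i + 2) y) (off i X)).1 (i + 2)
        - (b (offPart (i + 1) y) (off i X)).1 (i + 1) := by
    intro i
    exact exists_linear_of_bilinear e
      ((b.compl₁₂ (diagPart + (1 / 2 : ℝ) • offPart i + offPart (i + 2)) (off i)).compr₂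
        (entry (i + 2)) - (b.compl₁₂ (offPart (i + 1)) (off i)).compr₂ (entry (i + 1)))
  choose α hα using hB
  refine ⟨α, fun y j => ?_⟩
  obtain ⟨c1, c2, c3, c4, c5, c6, c7⟩ := cycle_simps j
  have d1 : ∀ i (X : K), (b (diagPart y) (off i X)).1 i = 0 := by
    intro i X
    rw [diagPart_eq, map_sum, LinearMap.sum_apply, Prod.fst_sum, Finset.sum_apply]
    refine Finset.sum_eq_zero fun l _ => ?_
    rw [map_smul, LinearMap.smul_apply, Prod.smul_fst, Pi.smul_apply, idem_off_fst hb, smul_zero]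
  have d2 : (b (diagPart y) (diagPart y)).1 j = 0 := by
    simp only [diagPart_eq, map_sum, LinearMap.sum_apply, Prod.fst_sum, Finset.sum_apply, map_smul,
      LinearMap.smul_apply, Prod.smul_fst, Pi.smul_apply, idem_idem_fst hb, smul_zero,
      Finset.sum_const_zero]
  have d3 := off_off_fst hb
  obtain ⟨hs, ht, -⟩ := hb
  have t1 := ht (diagPart y) (off (j + 2) (y.2 (j + 2)))
  have t2 := ht (off (j + 2) (y.2 (j + 2))) (off (j + 2) (y.2 (j + 2)))
  have t3 := ht (off (j + 1) (y.2 (j + 1))) (off (j + 2) (y.2 (j + 2)))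
  rw [tr_eq_cycle j] at t1 t2 t3
  rw [d1] at t1
  rw [d3] at t2
  rw [hα, hα]
  conv_lhs => rw [eq_parts y j]
  simp only [c1, c2, c3, c4, map_add, map_smul, LinearMap.add_apply, LinearMap.smul_apply,
    Prod.fst_add, Prod.smul_fst, Pi.add_apply, Pi.smul_apply, offPart_apply, smul_eq_mul, d2, d3]
  rw [hs _ (diagPart y), hs _ (diagPart y), hs _ (diagPart y), d1]
  rw [hs (off (j + 1) (y.2 (j + 1))) (off j _), hs (off (j + 2) (y.2 (j + 2))) (off j _),
    hs (off (j + 2) (y.2 (j + 2))) (off (j + 1) _)]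
  linarith

theorem normalFields.exists_diag_zero (e : OrthonormalBasis (Fin k) ℝ K)
    (hb : b ∈ m.normalFields) :
    ∃ b' ∈ m.normalFields, (∀ x y j, (b' x y).1 j = 0) ∧ (b' ∈ m.derFields → b ∈ m.derFields) := by
  obtain ⟨α, hα⟩ := exists_rot e hb
  set D : Herm K →ₗ[ℝ] Herm K →ₗ[ℝ] Herm K := ∑ i, m.rot i ∘ₗ α i with hD
  have hDm : ∀ z, D z ∈ m.der := by
    intro z
    rw [hD, LinearMap.sum_apply]
    exact Submodule.sum_mem _ fun i _ => m.rot_mem_der i _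
  have hmem := normalFields.sub hb (m.symm_mem_normalFields hDm)
  refine ⟨b - symm D, hmem, fun x y j => ?_, fun h => ?_⟩
  · refine bilin_eq_zero (b := (b - symm D).compr₂ (entry j)) (fun x y => ?_) (fun x => ?_) x y
    · simp only [LinearMap.compr₂_apply]; rw [hmem.1]
    · obtain ⟨c1, c2, c3, c4, c5, c6, c7⟩ := cycle_simps j
      simp only [LinearMap.compr₂_apply, entry_apply, LinearMap.sub_apply, symm_apply, hD,
        LinearMap.sum_apply, LinearMap.comp_apply, Prod.fst_sub, Prod.smul_fst, Prod.fst_add,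
        Prod.fst_sum, Finset.sum_apply, Pi.sub_apply, Pi.smul_apply, Pi.add_apply, hα]
      rw [sum_eq_cycle _ j]
      simp only [rot_fst, c1, c3, c5.symm, c6.symm, if_true, if_false, smul_eq_mul]
      rw [real_inner_comm (α (j + 1) x), real_inner_comm (α (j + 2) x)]
      ring
  · exact derFields_of_sub h (m.symm_mem_derFields hDm)

end SymComp
end

/-! ### Removing the action of the diagonal idempotents. -/

noncomputable section

namespace SymComp
open Herm

variable {K : Type*} [NormedAddCommGroup K] [InnerProductSpace ℝ K] {m : SymComp K}
  {k : ℕ}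
variable {b : Herm K →ₗ[ℝ] Herm K →ₗ[ℝ] Herm K}

/-- The off-diagonal entry. -/
def slot (i : Fin 3) : Herm K →ₗ[ℝ] K :=
  LinearMap.proj i ∘ₗ LinearMap.snd ℝ (Fin 3 → ℝ) (Fin 3 → K)

theorem slot_apply (i : Fin 3) (x : Herm K) : slot i x = x.2 i := rfl

theorem eq_zero_of_inner {x : K} (h : ∀ y, inner ℝ x y = 0) : x = 0 := by
  refine ext_inner_right ℝ fun y => ?_
  rw [h, inner_zero_left]

theorem third_cycle : ∀ i : Fin 3, 2 * (i + 1 + (i + 2)) = i ∧ 2 * (i + (i + 2)) = i + 1 ∧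
    2 * (i + (i + 1)) = i + 2 := by decide

theorem normalFields.inner_off_self (hb : b ∈ m.normalFields) (i : Fin 3) (X : K) :
    inner ℝ ((b (off i X) (off i X)).2 i) X = 0 := by
  have e1 := hb.2.2.1 (off i X) (off i X) (off i X)
  simp only [form_off] at e1
  linarith

section
variable (hb : b ∈ m.normalFields) (hd : ∀ x y j, (b x y).1 j = 0)
include hb hd

/-- Tested against an off-diagonal element, the cubic condition leaves only diagonal entries of `b`,
which are zero. -/
theorem normalFields.idem_idem (l n : Fin 3) : b (idem l) (idem n) = 0 := by
  refine Prod.ext (funext fun j => hd _ _ _) (funext fun j => eq_zero_of_inner fun X => ?_)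
  have := hb.2.2.1 (idem l) (idem n) (off j X)
  simp only [form_idem, hd, form_off] at this
  linarith

theorem normalFields.idem_off_snd {l i j : Fin 3} (h : i ≠ j) (X : K) :
    (b (idem l) (off i X)).2 j = 0 := by
  refine eq_zero_of_inner fun Y => ?_
  have e0 := idem_idem hb hd
  have e1 := hb.2.2.1 (idem l) (off i X) (off j Y)
  rw [hb.1 (off j Y)] at e1
  simp only [form_idem, hd, form_off] at e1
  by_cases hl : l = i
  · subst hl
    have e2 := hb.2.2.2 (idem l) (idem l) (off l X) (off j Y)
    simp only [e0, cross_idem_idem, cross_idem_off, h, if_true, if_false, map_zero,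
      LinearMap.zero_apply, form_off, map_smul, smul_eq_mul] at e2
    linarith
  · have e2 := hb.2.2.2 (idem l) (idem j) (off i X) (off j Y)
    rw [cross_idem_idem] at e2
    split_ifs at e2 with h1
    · subst h1
      simp only [e0, cross_idem_off, h.symm, if_true, if_false, map_zero,
        LinearMap.zero_apply, form_off, map_smul, smul_eq_mul] at e2
      linarith
    · simp only [e0, cross_idem_off, h.symm, h1, hl, if_true, if_false, map_zero,
        LinearMap.zero_apply, form_off, map_smul, smul_eq_mul, form_idem, hd] at e2
      linarith

theorem normalFields.idem_off_eq (l i : Fin 3) (X : K) :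
    b (idem l) (off i X) = off i ((b (idem l) (off i X)).2 i) := by
  refine Prod.ext (funext fun j => hd _ _ _) (funext fun j => ?_)
  rw [off_snd]
  split_ifs with h
  · rw [h]
  · exact idem_off_snd hb hd (Ne.symm h) X

theorem normalFields.inner_idem_off (l i : Fin 3) (X : K) :
    inner ℝ ((b (idem l) (off i X)).2 i) X = 0 := by
  have e1 := hb.2.2.1 (idem l) (off i X) (off i X)
  rw [hb.1 (off i X) (idem l)] at e1
  simp only [form_idem, hd, form_off] at e1
  linarith

theorem normalFields.off_self_snd {i n : Fin 3} (h : i ≠ n) (X Y : K) :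
    (b (off i X) (off i Y)).2 n = 0 := by
  refine eq_zero_of_inner fun Z => ?_
  obtain ⟨n1, n2, -, -⟩ := third_ne h
  have e2 := hb.2.2.2 (idem n) (off i X) (off i Y) (off n Z)
  simp only [cross_idem_off, cross_off_off, h, h.symm, if_true, if_false, map_zero,
    form_off, map_smul, smul_eq_mul, form_idem, hd, apply_ite (form _),
    idem_off_snd hb hd n1, inner_zero_left] at e2
  split_ifs at e2 <;> linarith

theorem normalFields.inner_off_off {i n : Fin 3} (h : i ≠ n) (X Z : K) :
    inner ℝ ((b (off i X) (off n Z)).2 i) X = 0 := by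
  obtain ⟨n1, n2, -, -⟩ := third_ne h
  have e2 := hb.2.2.2 (idem i) (off i X) (off i X) (off n Z)
  simp only [cross_idem_off, cross_off_off, h, if_true, if_false, map_zero,
    form_off, map_smul, smul_eq_mul, form_idem, hd, apply_ite (form _),
    idem_off_snd hb hd n1, inner_zero_left] at e2
  split_ifs at e2 <;> linarith

/-- The quartic condition at e_l and one element of each slot. The left side measures how far the
three skew maps attached to e_l are from being related; the right side is the part of `b` leading
from two slots to the third. -/
theorem normalFields.inner_off_off_off (l i : Fin 3) (X Y Z : K)
    (h : l = i ∨ l = i + 1 ∨ l = i + 2) :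
    inner ℝ ((b (idem l) (off i X)).2 i) (m.mul Y Z)
      + inner ℝ ((b (idem l) (off (i + 1) Y)).2 (i + 1)) (m.mul Z X)
      + inner ℝ ((b (idem l) (off (i + 2) Z)).2 (i + 2)) (m.mul X Y)
      = (if l = i then inner ℝ ((b (off (i + 1) Y) (off (i + 2) Z)).2 i) X else 0)
       + (if l = i + 1 then inner ℝ ((b (off i X) (off (i + 2) Z)).2 (i + 1)) Y else 0)
       + (if l = i + 2 then inner ℝ ((b (off i X) (off (i + 1) Y)).2 (i + 2)) Z else 0) := by
  have e2 := hb.2.2.2 (idem l) (off i X) (off (i + 1) Y) (off (i + 2) Z)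
  obtain ⟨p1, p2, p3⟩ := third_cycle i
  obtain ⟨c1, c2, c3, c4, c5, c6, c7⟩ := cycle_simps i
  simp only [cross_idem_off, cross_off_off, c1, c7, c5.symm, c6.symm, c7.symm,
    if_true, if_false, p1, p2, p3, form_off, map_smul, smul_eq_mul, apply_ite (form _),
    map_zero] at e2
  rcases h with rfl | rfl | rfl <;>
    simp only [c5, c6, c7, c5.symm, c6.symm, c7.symm, if_true, if_false] at e2 ⊢ <;> linarith

end

/-- The endomorphism of an off-diagonal entry induced by an idempotent. -/
def idemSlot (b : Herm K →ₗ[ℝ] Herm K →ₗ[ℝ] Herm K) (l i : Fin 3) : K →ₗ[ℝ] K :=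
  slot i ∘ₗ b (idem l) ∘ₗ off i

theorem idemSlot_apply (b : Herm K →ₗ[ℝ] Herm K →ₗ[ℝ] Herm K) (l i : Fin 3) (X : K) :
    idemSlot b l i X = (b (idem l) (off i X)).2 i := rfl

theorem diagDer_comp_diag_zero (S : Herm K →ₗ[ℝ] (Fin 3 → K →ₗ[ℝ] K)) (x y : Herm K)
    (j : Fin 3) : (symm (diagDer ∘ₗ S) x y).1 j = 0 := by
  simp [symm_apply, diagDer_fst]

/-- The skew map of e_l on its own slot extends to a related triple by `lift`, and the family `z ↦ ∑
z_l S_l` cancels it. The factor 2 in the family compensates the 1/2 in `symm`, since these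
derivations kill the idempotents. -/
theorem normalFields.exists_idemSlot_self (e : OrthonormalBasis (Fin k) ℝ K)
    (hb : b ∈ m.normalFields) (hd : ∀ x y j, (b x y).1 j = 0) :
    ∃ b' ∈ m.normalFields, (∀ x y j, (b' x y).1 j = 0) ∧ (∀ i, idemSlot b' i i = 0) ∧
      (b' ∈ m.derFields → b ∈ m.derFields) := by
  set S : Herm K →ₗ[ℝ] (Fin 3 → K →ₗ[ℝ] K) :=
    ∑ l, (entry l).smulRight (m.lift e l ((2 : ℝ) • idemSlot b l l)) with hS
  have hSa : ∀ z, S z = ∑ l, z.1 l • m.lift e l ((2 : ℝ) • idemSlot b l l) := by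
    intro z; simp [hS, entry_apply]
  have hSi : ∀ i, S (idem i) = m.lift e i ((2 : ℝ) • idemSlot b i i) := by
    intro i
    simp only [hSa, idem_fst, ite_smul, one_smul, zero_smul, Finset.sum_ite_eq', Finset.mem_univ,
      if_true]
  have hD : ∀ z, (diagDer ∘ₗ S) z ∈ m.der := by
    intro z
    refine m.diagDer_mem_der ?_
    rw [hSa]
    refine sum_mem fun l _ => Submodule.smul_mem _ _ (m.lift_mem_tri e (fun x => ?_) l)
    rw [LinearMap.smul_apply, real_inner_smul_left, idemSlot_apply, inner_idem_off hb hd, mul_zero]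
  refine ⟨b - symm (diagDer ∘ₗ S), normalFields.sub hb (m.symm_mem_normalFields hD), fun x y j =>
      ?_,
    fun i => ?_, fun h => derFields_of_sub h (m.symm_mem_derFields hD)⟩
  · have := diagDer_comp_diag_zero S x y j
    simp only [LinearMap.sub_apply, Prod.fst_sub, Pi.sub_apply, hd, this, sub_zero]
  · ext X
    rw [idemSlot_apply]
    simp only [LinearMap.sub_apply, symm_apply, LinearMap.comp_apply, Prod.snd_sub, Prod.smul_snd,
      Prod.snd_add, Pi.sub_apply, Pi.smul_apply, Pi.add_apply, diagDer_snd, hSi, idem_snd, map_zero,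
      off_snd, if_true, add_zero, lift_self, LinearMap.smul_apply, idemSlot_apply,
      LinearMap.zero_apply]
    module

/-- The rotation `rot i d` sends e_{i+1} and e_{i+2} to opposite elements of slot i, so rotations
remove the difference of the two actions on that slot. The coefficient maps are skew, which keeps
the diagonal equal to zero. -/
theorem normalFields.exists_idemSlot_eq
    (hb : b ∈ m.normalFields) (hd : ∀ x y j, (b x y).1 j = 0) (h0 : ∀ i, idemSlot b i i = 0) :
    ∃ b' ∈ m.normalFields, (∀ x y j, (b' x y).1 j = 0) ∧ (∀ i, idemSlot b' i i = 0) ∧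
      (∀ i, idemSlot b' (i + 1) i = idemSlot b' (i + 2) i) ∧
      (b' ∈ m.derFields → b ∈ m.derFields) := by
  set β : Fin 3 → K →ₗ[ℝ] K := fun i => idemSlot b (i + 1) i - idemSlot b (i + 2) i with hβ
  have hβs : ∀ i X, inner ℝ (β i X) X = 0 := by
    intro i X
    simp only [hβ, LinearMap.sub_apply, inner_sub_left, idemSlot_apply, inner_idem_off hb hd]
    ring
  set D : Herm K →ₗ[ℝ] Herm K →ₗ[ℝ] Herm K := ∑ i, m.rot i ∘ₗ β i ∘ₗ slot i with hD'
  have hDa : ∀ z, D z = ∑ i, m.rot i (β i (z.2 i)) := by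
    intro z; simp [hD', slot_apply]
  have hD : ∀ z, D z ∈ m.der := by
    intro z
    rw [hDa]
    exact sum_mem fun i _ => m.rot_mem_der i _
  have hval : ∀ l i X, (symm D (idem l) (off i X)).2 i =
      (1 / 2 : ℝ) • ((idem l : Herm K).1 (i + 1) - (idem l : Herm K).1 (i + 2)) • β i X := by
    intro l i X
    obtain ⟨c1, c2, c3, c4, c5, c6, c7⟩ := cycle_simps i
    rw [symm_apply, hDa, hDa, sum_eq_cycle _ i, sum_eq_cycle _ i]
    simp only [off_snd, idem_snd, map_zero, c5, c6, if_true, if_false,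
      LinearMap.zero_apply, add_zero, zero_add, Prod.smul_snd, Pi.smul_apply, rot_snd]
  have hb' := normalFields.sub hb (m.symm_mem_normalFields hD)
  refine ⟨b - symm D, hb', fun x y j => ?_,
    fun i => ?_, fun i => ?_, fun h => derFields_of_sub h (m.symm_mem_derFields hD)⟩
  · refine bilin_eq_zero (b := (b - symm D).compr₂ (entry j)) (fun x y => ?_) (fun x => ?_) x y
    · simp only [LinearMap.compr₂_apply]; rw [hb'.1]
    · obtain ⟨c1, c2, c3, c4, c5, c6, c7⟩ := cycle_simps j
      simp only [LinearMap.compr₂_apply, entry_apply, LinearMap.sub_apply, symm_apply, hDa,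
        LinearMap.sum_apply, Prod.fst_sub, Prod.smul_fst, Prod.fst_add,
        Prod.fst_sum, Finset.sum_apply, Pi.sub_apply, Pi.smul_apply, Pi.add_apply, hd]
      rw [sum_eq_cycle _ j]
      simp only [rot_fst, c1, c3, c5.symm, c6.symm, if_true, if_false,
        smul_eq_mul]
      rw [real_inner_comm (β (j + 1) _), real_inner_comm (β (j + 2) _), hβs, hβs]
      ring
  · obtain ⟨c1, c2, c3, c4, c5, c6, c7⟩ := cycle_simps i
    ext X
    have h1 : (b (idem i) (off i X)).2 i = 0 := by rw [← idemSlot_apply, h0]; rfl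
    rw [idemSlot_apply, LinearMap.sub_apply, LinearMap.sub_apply, Prod.snd_sub, Pi.sub_apply, hval,
      h1]
    simp [idem_fst, c5, c6]
  · obtain ⟨c1, c2, c3, c4, c5, c6, c7⟩ := cycle_simps i
    ext X
    rw [idemSlot_apply, idemSlot_apply, LinearMap.sub_apply, LinearMap.sub_apply,
      LinearMap.sub_apply, LinearMap.sub_apply, Prod.snd_sub, Pi.sub_apply, Prod.snd_sub,
      Pi.sub_apply, hval, hval]
    simp only [idem_fst, c7, c7.symm, if_true, if_false, hβ, LinearMap.sub_apply, idemSlot_apply]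
    module

/-- What remains is a single map S_i / 2 on slot i, the same for both l ≠ i. Summing
`inner_off_off_off` over l and applying the cubic condition to the right side shows that S is
related. It cannot be removed by a linear family alone: this is where the single derivation in
`derFields` originates. -/
theorem normalFields.exists_idem_zero (e : OrthonormalBasis (Fin k) ℝ K)
    (hb : b ∈ m.normalFields) (hd : ∀ x y j, (b x y).1 j = 0) :
    ∃ b' ∈ m.normalFields, (∀ x y j, (b' x y).1 j = 0) ∧ (∀ l i X, b' (idem l) (off i X) = 0) ∧
      (b' ∈ m.derFields → b ∈ m.derFields) := by
  obtain ⟨b₁, hb₁, hd₁, h₁, hf₁⟩ := exists_idemSlot_self e hb hd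
  obtain ⟨b₂, hb₂, hd₂, h₂, h₂', hf₂⟩ := exists_idemSlot_eq hb₁ hd₁ h₁
  set S : Fin 3 → K →ₗ[ℝ] K := fun i => (2 : ℝ) • idemSlot b₂ (i + 1) i with hS
  have hcases : ∀ l i : Fin 3, l = i ∨ l = i + 1 ∨ l = i + 2 := by decide
  have hS3 : S ∈ m.tri := by
    refine ⟨fun i x => ?_, fun i x y z => ?_⟩
    · simp only [hS, LinearMap.smul_apply, real_inner_smul_left, idemSlot_apply,
        inner_idem_off hb₂ hd₂, mul_zero]
    · obtain ⟨c1, c2, c3, c4, c5, c6, c7⟩ := cycle_simps i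
      have f0 := inner_off_off_off hb₂ hd₂ i i x y z (hcases _ _)
      have f1 := inner_off_off_off hb₂ hd₂ (i + 1) i x y z (hcases _ _)
      have f2 := inner_off_off_off hb₂ hd₂ (i + 2) i x y z (hcases _ _)
      have f3 := hb₂.2.2.1 (off i x) (off (i + 1) y) (off (i + 2) z)
      rw [hb₂.1 (off (i + 2) z)] at f3
      simp only [form_off] at f3
      have g : ∀ i, idemSlot b₂ i (i + 2) = idemSlot b₂ (i + 1) (i + 2) := by
        intro i
        obtain ⟨c1, c2, c3, c4, c5, c6, c7⟩ := cycle_simps i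
        have := h₂' (i + 2)
        rwa [c3, c4] at this
      have g' : ∀ i, idemSlot b₂ (i + 2) (i + 1) = idemSlot b₂ i (i + 1) := by
        intro i
        obtain ⟨c1, c2, c3, c4, c5, c6, c7⟩ := cycle_simps i
        have := h₂' (i + 1)
        rwa [c1, c2] at this
      simp only [← idemSlot_apply, h₂, LinearMap.zero_apply, inner_zero_left, c5, c6, c7, c5.symm,
        c6.symm, c7.symm, if_true, if_false] at f0 f1 f2
      simp only [hS, LinearMap.smul_apply, real_inner_smul_left, c1, c3, ← h₂' i, g,
        g'] at f0 f1 f2 ⊢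
      linarith
  have hDS := m.diagDer_mem_der hS3
  -- As each e_l has trace 1, the family `τ` contributes S_i / 2 on slot i for every l. As e_i × X =
  -- -X / 2, the term `S ∘ cross` takes it away again for l = i.
  set τ : Herm K →ₗ[ℝ] Herm K →ₗ[ℝ] Herm K := tr.smulRight (diagDer S) with hτ
  have hτm : ∀ z, τ z ∈ m.der := fun z => Submodule.smul_mem _ _ hDS
  have hmem := normalFields.sub (normalFields.sub hb₂ (m.symm_mem_normalFields hτm))
      (m.comp_cross_mem_normalFields hDS)
  have hd' : ∀ x y j, ((b₂ - symm τ - m.cross.compr₂ (diagDer S)) x y).1 j = 0 := by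
    intro x y j
    simp [hd₂, symm_apply, hτ, diagDer_fst]
  refine ⟨b₂ - symm τ - m.cross.compr₂ (diagDer S), hmem, hd', fun l i X => ?_, fun h => ?_⟩
  · rw [idem_off_eq hmem hd']
    have htri : tr (idem l : Herm K) = 1 := by
      rw [tr_apply]; simp only [idem_fst]; fin_cases l <;> simp
    have hval : ((b₂ - symm τ - m.cross.compr₂ (diagDer S)) (idem l) (off i X)).2 i =
        (b₂ (idem l) (off i X)).2 i - (1 / 2 : ℝ) • S i X
          - (if l = i then -(1 / 2 : ℝ) else 0) • S i X := by
      simp only [LinearMap.sub_apply, LinearMap.compr₂_apply, symm_apply, hτ,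
        LinearMap.smulRight_apply, LinearMap.smul_apply, Prod.snd_sub, Prod.smul_snd, Prod.snd_add,
        Pi.sub_apply, Pi.smul_apply, Pi.add_apply, diagDer_snd, idem_snd, map_zero, off_snd,
        if_true, smul_zero, add_zero, htri, one_smul, cross_idem_off]
      split_ifs <;> simp [off_snd]
    rw [hval, ← idemSlot_apply]
    rcases hcases l i with rfl | rfl | rfl
    · rw [h₂]; simp
    · obtain ⟨c1, c2, c3, c4, c5, c6, c7⟩ := cycle_simps i
      simp [hS, c5]
    · obtain ⟨c1, c2, c3, c4, c5, c6, c7⟩ := cycle_simps i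
      simp [hS, c6, h₂']
  · exact hf₁ (hf₂ (derFields_of_sub (derFields_of_sub h (m.comp_cross_mem_derFields hDS))
      (m.symm_mem_derFields hτm)))

end SymComp
end

/-! ### The off-diagonal part and the normal form theorem. -/

noncomputable section

namespace SymComp
open Herm

variable {K : Type*} [NormedAddCommGroup K] [InnerProductSpace ℝ K] {m : SymComp K}
  {k : ℕ}
variable {b : Herm K →ₗ[ℝ] Herm K →ₗ[ℝ] Herm K}

theorem skew_eq_zero_of_rank_one (e : OrthonormalBasis (Fin 1) ℝ K) {A : K →ₗ[ℝ] K}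
    (hA : ∀ x, inner ℝ (A x) x = 0) : A = 0 := by
  have h1 : A (e 0) = 0 := by
    rw [← sum_inner_smul e (A (e 0))]
    simp [hA]
  ext x
  rw [← sum_inner_smul e x]
  simp [h1]

/-- In dimension one there are no nonzero skew maps, and c(u, u) orthogonal to u forces c(u, u) = 0;
all other dimensions are covered by `tri_normal`. -/
theorem exists_tri_normal (e : OrthonormalBasis (Fin k) ℝ K) {c P R : K →ₗ[ℝ] K →ₗ[ℝ] K}
    (hc : ∀ u v, c u v = c v u)
    (hc0 : ∀ u, inner ℝ (c u u) u = 0) (hP : ∀ u x, inner ℝ (P u x) x = 0)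
    (hR : ∀ u x, inner ℝ (R u x) x = 0)
    (h : ∀ u x, R u (m.mul u x) = m.mul u (P u x) + m.mul (c u u) x) (i : Fin 3) :
    ∃ (d : K) (S : K →ₗ[ℝ] (Fin 3 → K →ₗ[ℝ] K)), (∀ u, S u ∈ m.tri) ∧
      ∀ u x, c u u = S u i u ∧
        P u x = S u (i + 1) x + (m.mul (m.mul u x) d - m.mul (m.mul d x) u) ∧
        R u x = S u (i + 2) x + (m.mul u (m.mul x d) - m.mul d (m.mul x u)) := by
  have : FiniteDimensional ℝ K := e.toBasis.finiteDimensional_of_finite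
  by_cases hk : k = 1
  · subst hk
    refine ⟨0, 0, fun u => zero_mem _, fun u x => ⟨?_, ?_, ?_⟩⟩
    · have h1 : c (e 0) (e 0) = 0 := by
        rw [← sum_inner_smul e (c (e 0) (e 0))]
        simp [hc0]
      rw [← sum_inner_smul e u]
      simp [h1]
    · rw [skew_eq_zero_of_rank_one e (hP u)]; simp
    · rw [skew_eq_zero_of_rank_one e (hR u)]; simp
  · exact m.tri_normal e hk hc hc0 hP hR h i

/-- The bilinear map obtained from the derivation `rot i d` after removing its diagonal part. -/
def rotField (m : SymComp K) (i : Fin 3) (d : K) : Herm K →ₗ[ℝ] Herm K →ₗ[ℝ] Herm K :=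
  m.cross.compr₂ (m.rot i d) + symm ((entry i).smulRight (m.rot i d) +
    m.rot (i + 1) ∘ₗ m.mul.flip d ∘ₗ slot (i + 2) + m.rot (i + 2) ∘ₗ m.mul d ∘ₗ slot (i + 1))

theorem rotField_mem (i : Fin 3) (d : K) : m.rotField i d ∈ m.derFields := by
  refine Submodule.add_mem _ (m.comp_cross_mem_derFields (m.rot_mem_der i d))
    (m.symm_mem_derFields fun z => ?_)
  exact add_mem (add_mem (Submodule.smul_mem _ _ (m.rot_mem_der i d)) (m.rot_mem_der _ _))
    (m.rot_mem_der _ _)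

theorem cycle_cases : ∀ i j : Fin 3, j = i ∨ j = i + 1 ∨ j = i + 2 := by decide

/-- Applying `rot i d` to the adjoint of x produces diagonal terms and scalar multiples of entries
of x. Three rotations with coefficients linear in x cancel them and leave precisely the terms in `d`
from `tri_normal`. -/
theorem rotField_self (i : Fin 3) (d : K) (x : Herm K) : m.rotField i d x x =
    off (i + 1) (m.mul (m.mul (x.2 i) (x.2 (i + 1))) d - m.mul (m.mul d (x.2 (i + 1))) (x.2 i))
    + off (i + 2) (m.mul (x.2 i) (m.mul (x.2 (i + 2)) d)
      - m.mul d (m.mul (x.2 (i + 2)) (x.2 i))) := by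
  obtain ⟨c1, c2, c3, c4, c5, c6, c7⟩ := cycle_simps i
  have h0 : m.rotField i d x x = m.rot i d (m.cross x x) + (x.1 i • m.rot i d x
      + m.rot (i + 1) (m.mul (x.2 (i + 2)) d) x + m.rot (i + 2) (m.mul d (x.2 (i + 1))) x) := by
    simp only [rotField, LinearMap.add_apply, LinearMap.compr₂_apply, symm_apply,
      LinearMap.smulRight_apply, LinearMap.comp_apply, LinearMap.flip_apply, slot_apply,
      entry_apply, LinearMap.smul_apply]
    module
  have hj := cycle_cases i
  rw [h0]
  refine Prod.ext (funext fun j => ?_) (funext fun j => ?_)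
  · simp only [Prod.fst_add, Prod.smul_fst, Pi.add_apply, Pi.smul_apply, off_fst, smul_eq_mul]
    have i1 := m.inner_mul_cycle (x.2 (i + 1)) (x.2 (i + 2)) d
    have i2 := m.inner_mul_cycle (x.2 (i + 2)) d (x.2 (i + 1))
    have i3 := real_inner_comm (x.2 (i + 1)) (m.mul (x.2 (i + 2)) d)
    have i4 := real_inner_comm (x.2 (i + 2)) (m.mul d (x.2 (i + 1)))
    rcases hj j with rfl | rfl | rfl <;>
    simp only [rot_fst, c1, c3, c5, c6, c7, c5.symm, c6.symm, c7.symm, if_true, if_false,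
      cross_snd, real_inner_smul_left, inner_sub_left, inner_add_left] <;>
    linarith
  · simp only [Prod.snd_add, Prod.smul_snd, Pi.add_apply, Pi.smul_apply, off_snd]
    have i1 := m.mul_mul_self (x.2 (i + 2)) d
    have i2 := m.mul_mul_self' (x.2 (i + 1)) d
    rcases hj j with rfl | rfl | rfl <;>
    simp only [rot_snd, c1, c2, c3, c4, c5, c6, c7, c5.symm, c6.symm, c7.symm, if_true, if_false,
      cross_snd, cross_fst, map_smul, map_sub, map_add, LinearMap.smul_apply, LinearMap.sub_apply,
      LinearMap.add_apply, i1, i2] <;>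
    module

/-- Only products of off-diagonal elements are left, and the quartic condition at (u, u, x, y), one
repeated slot and the other two, is the triality equation. In its solution the related triples give
`diagDer` and the terms in `d` give `rotField`. -/
theorem normalFields.mem_derFields_of_idem_zero (e : OrthonormalBasis (Fin k) ℝ K)
    (hb : b ∈ m.normalFields) (hd : ∀ x y j, (b x y).1 j = 0)
    (hE : ∀ l i X, b (idem l) (off i X) = 0) : b ∈ m.derFields := by
  have hthird : ∀ i X Y, (b (off (i + 1) X) (off (i + 2) Y)).2 i = 0 := by
    intro i X Y
    refine eq_zero_of_inner fun Z => ?_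
    obtain ⟨c1, c2, c3, c4, c5, c6, c7⟩ := cycle_simps i
    have := inner_off_off_off hb hd i i Z X Y (Or.inl rfl)
    simp only [hE, Prod.snd_zero, Pi.zero_apply, inner_zero_left, c5.symm, c6.symm, if_true,
      if_false] at this
    linarith
  have hN : ∀ i : Fin 3, ∃ (d : K) (S : K →ₗ[ℝ] (Fin 3 → K →ₗ[ℝ] K)), (∀ u, S u ∈ m.tri) ∧
      ∀ u x, (b (off i u) (off i u)).2 i = S u i u ∧
        (2 : ℝ) • (b (off i u) (off (i + 1) x)).2 (i + 1) =
          S u (i + 1) x + (m.mul (m.mul u x) d - m.mul (m.mul d x) u) ∧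
        (2 : ℝ) • (b (off i u) (off (i + 2) x)).2 (i + 2) =
          S u (i + 2) x + (m.mul u (m.mul x d) - m.mul d (m.mul x u)) := by
    intro i
    obtain ⟨c1, c2, c3, c4, c5, c6, c7⟩ := cycle_simps i
    have hR : ∀ u x, inner ℝ ((2 : ℝ) • (b (off i u) (off (i + 2) x)).2 (i + 2)) x = 0 := by
      intro u x
      rw [real_inner_smul_left, hb.1, inner_off_off hb hd c6, mul_zero]
    refine exists_tri_normal e (c := ((b.compl₁₂ (off i) (off i)).compr₂ (slot i)))
      (P := (2 : ℝ) • ((b.compl₁₂ (off i) (off (i + 1))).compr₂ (slot (i + 1))))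
      (R := (2 : ℝ) • ((b.compl₁₂ (off i) (off (i + 2))).compr₂ (slot (i + 2))))
      ?_ ?_ ?_ ?_ ?_ i
    · intro u v
      simp only [LinearMap.compr₂_apply, LinearMap.compl₁₂_apply]
      rw [hb.1]
    · intro u
      exact inner_off_self hb i u
    · intro u x
      simp only [LinearMap.smul_apply, LinearMap.compr₂_apply, LinearMap.compl₁₂_apply, slot_apply]
      rw [real_inner_smul_left, hb.1, inner_off_off hb hd c5, mul_zero]
    · exact hR
    -- The diagonal term of the quartic condition vanishes by `hd`; skewness of `R` and cyclicity of
    -- the trilinear form rewrite the remaining terms as the equation tested against y.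
    · intro u x
      refine ext_inner_right ℝ fun y => ?_
      have h1 := hb.2.2.2 (off i u) (off i u) (off (i + 1) x) (off (i + 2) y)
      obtain ⟨p1, p2, p3⟩ := third_cycle i
      simp only [cross_off_off, c1, c7, c5.symm, c6.symm, c7.symm, if_true, if_false, p1, p2, p3,
        map_smul, form_off, form_idem, hd, smul_eq_mul] at h1
      have h2 := skew_swap (A := ((2 : ℝ) • ((b.compl₁₂ (off i) (off (i + 2))).compr₂
        (slot (i + 2)))) u) (hR u) (m.mul u x) y
      rw [h2]
      simp only [LinearMap.smul_apply, LinearMap.compr₂_apply, LinearMap.compl₁₂_apply, slot_apply,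
        real_inner_smul_left, inner_add_left, map_smul]
      rw [m.inner_mul_cycle u, real_inner_comm _ (m.mul y u), m.inner_mul]
      linarith
  choose d S hS hval using hN
  set T : Herm K →ₗ[ℝ] Herm K →ₗ[ℝ] Herm K := diagDer ∘ₗ ∑ i, S i ∘ₗ slot i with hT
  have hTm : ∀ z, T z ∈ m.der := by
    intro z
    refine m.diagDer_mem_der ?_
    rw [LinearMap.sum_apply]
    exact Submodule.sum_mem _ fun i _ => hS i _
  have hTf := m.symm_mem_derFields hTm
  have hdF : symm T + ∑ i, m.rotField i (d i) ∈ m.derFields :=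
    Submodule.add_mem _ hTf (Submodule.sum_mem _ fun i _ => rotField_mem i (d i))
  have heq : b - (symm T + ∑ i, m.rotField i (d i)) = 0 := by
    refine LinearMap.ext₂ fun x y => bilin_eq_zero (fun x y => ?_) (fun x => ?_) x y
    · rw [(normalFields.sub hb (m.derFields_le_normalFields hdF)).1]
    · have hE2 : ∀ i X, b (diagPart x) (off i X) = 0 := by
        intro i X
        rw [diagPart_eq, map_sum, LinearMap.sum_apply]
        exact Finset.sum_eq_zero fun l _ => by
          rw [map_smul, LinearMap.smul_apply, hE, smul_zero]
      have hE3 : b (diagPart x) (diagPart x) = 0 := by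
        simp only [diagPart_eq, map_sum, LinearMap.sum_apply, map_smul, LinearMap.smul_apply,
          idem_idem hb hd, smul_zero, Finset.sum_const_zero]
      refine Prod.ext (funext fun j => ?_) (funext fun j => ?_)
      · simp [hd, symm_apply, hT, diagDer_fst, rotField_self, off_fst, Prod.fst_sum]
      · obtain ⟨c1, c2, c3, c4, c5, c6, c7⟩ := cycle_simps j
        have hbx : (b x x).2 j = (b (off j (x.2 j)) (off j (x.2 j))).2 j
            + (2 : ℝ) • (b (off (j + 1) (x.2 (j + 1))) (off j (x.2 j))).2 j
            + (2 : ℝ) • (b (off (j + 2) (x.2 (j + 2))) (off j (x.2 j))).2 j := by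
          conv_lhs => rw [eq_parts x j]
          simp only [map_add, LinearMap.add_apply, Prod.snd_add, Pi.add_apply, offPart_apply,
            hE2, hE3, hb.1 _ (diagPart x), zero_add,
            off_self_snd hb hd c5, off_self_snd hb hd c6, hthird, add_zero,
            hb.1 (off j (x.2 j)), hb.1 (off (j + 2) (x.2 (j + 2))) (off (j + 1) (x.2 (j + 1)))]
          module
        have v0 := (hval j (x.2 j) 0).1
        have v1 := (hval (j + 1) (x.2 (j + 1)) (x.2 j)).2.2
        have v2 := (hval (j + 2) (x.2 (j + 2)) (x.2 j)).2.1
        rw [c2] at v1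
        rw [c3] at v2
        rw [LinearMap.sub_apply, LinearMap.sub_apply, Prod.snd_sub, Pi.sub_apply, hbx, v0, v1, v2]
        simp only [LinearMap.add_apply, LinearMap.sum_apply, rotField_self, symm_apply, hT,
          LinearMap.comp_apply, Prod.snd_add, Pi.add_apply, Prod.smul_snd, Pi.smul_apply,
          diagDer_snd, Prod.snd_sum, Finset.sum_apply, slot_apply]
        rw [sum_eq_cycle _ j, sum_eq_cycle _ j]
        simp only [off_snd, c1, c2, c3, c4, c5.symm, c6.symm, if_true, if_false]
        simp only [Prod.snd_zero, Pi.zero_apply]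
        module
  refine derFields_of_sub (c := symm T + ∑ i, m.rotField i (d i)) ?_ hdF
  rw [heq]
  exact Submodule.zero_mem _

/-- Quadratic maps whose values at `x` are orthogonal to `1`, `x` and the adjoint of `x` come
from derivations. -/
theorem normalFields_le_derFields (e : OrthonormalBasis (Fin k) ℝ K) :
    m.normalFields ≤ m.derFields := by
  intro b hb
  obtain ⟨b₁, hb₁, hd₁, h₁⟩ := normalFields.exists_diag_zero e hb
  obtain ⟨b₂, hb₂, hd₂, hE, h₂⟩ := normalFields.exists_idem_zero e hb₁ hd₁
  exact h₁ (h₂ (normalFields.mem_derFields_of_idem_zero e hb₂ hd₂ hE))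

end SymComp
end

/-! ### Linear families of derivations with `D_z z = 0`. -/

noncomputable section

namespace SymComp
open Herm

variable {K : Type*} [NormedAddCommGroup K] [InnerProductSpace ℝ K] {m : SymComp K}
  {k : ℕ}

theorem form_cross (x y z : Herm K) : form (m.cross x y) z = form x (m.cross y z) := by
  have f1 : (1 + 1 : Fin 3) = 2 := rfl
  have f2 : (1 + 2 : Fin 3) = 0 := rfl
  have f3 : (2 + 1 : Fin 3) = 0 := rfl
  have f4 : (2 + 2 : Fin 3) = 1 := rfl
  have c : ∀ u v w : K, inner ℝ (m.mul u v) w = inner ℝ (m.mul v w) u :=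
    fun u v w => by rw [m.inner_mul, real_inner_comm]
  have d : ∀ u v w : K, inner ℝ u (m.mul v w) = inner ℝ (m.mul v w) u :=
    fun u v w => real_inner_comm _ _
  simp only [form_apply, Fin.sum_univ_three, cross_fst, cross_snd, real_inner_smul_left,
    inner_smul_right, inner_add_left, inner_add_right, inner_sub_left, inner_sub_right, zero_add,
    f1, f2, f3, f4, d]
  rw [c (x.2 1) (y.2 2) (z.2 0), c (x.2 2) (y.2 0) (z.2 1), c (x.2 0) (y.2 1) (z.2 2),
    c (z.2 1) (y.2 2) (x.2 0), c (z.2 2) (y.2 0) (x.2 1), c (z.2 0) (y.2 1) (x.2 2),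
    c (y.2 2) (x.2 0) (z.2 1), c (y.2 0) (x.2 1) (z.2 2), c (y.2 1) (x.2 2) (z.2 0)]
  ring

/-- Moving D across the trace form by skewness turns invariance of the cubic form into a Leibniz
rule for its adjoint. -/
theorem der_cross {D : Herm K →ₗ[ℝ] Herm K} (hD : D ∈ m.der) (x y : Herm K) :
    D (m.cross x y) = m.cross (D x) y + m.cross x (D y) := by
  refine eq_of_form fun z => ?_
  rw [map_add, LinearMap.add_apply, form_cross, m.cross_comm x (D y), form_cross]
  have h1 := hD.2.1 (m.cross x y) z
  have h2 := hD.2.2 x y z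
  rw [m.cross_comm z x] at h2
  linarith

variable {D : Herm K →ₗ[ℝ] Herm K}

/-- The unit matrix. -/
def _root_.Herm.one : Herm K := (fun _ => 1, 0)

theorem one_eq (i : Fin 3) : (Herm.one : Herm K) = idem i + idem (i + 1) + idem (i + 2) := by
  obtain ⟨c1, c2, c3, c4, c5, c6, c7⟩ := cycle_simps i
  refine Prod.ext (funext fun j => ?_) (funext fun j => ?_)
  · simp only [Prod.fst_add, Pi.add_apply, idem_fst, Herm.one]
    rcases cycle_cases i j with rfl | rfl | rfl <;> simp [c5.symm, c6.symm, c7.symm, c5, c6, c7]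
  · simp [Herm.one, idem_snd]

theorem form_one (x : Herm K) : form x Herm.one = tr x := by
  rw [one_eq 0, map_add, map_add, form_idem, form_idem, form_idem, tr_apply]
  rfl

theorem der_one (hD : D ∈ m.der) : D Herm.one = 0 := by
  refine eq_of_form fun z => ?_
  have := hD.2.1 Herm.one z
  rw [form_one, hD.1] at this
  simpa using this

theorem der_idem_fst (hD : D ∈ m.der) (l j : Fin 3) : (D (idem l)).1 j = 0 := by
  have h0 : ∀ l, (D (idem l)).1 l = 0 := fun l => by
    have := hD.2.1 (idem l) (idem l)
    rw [form_idem] at this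
    linarith
  by_cases h : l = j
  · subst h; exact h0 l
  · obtain ⟨n1, n2, n3, n4⟩ := third_ne h
    have := hD.2.2 (idem l) (idem l) (idem (2 * (l + j)))
    simp only [cross_idem_idem, n1, n1.symm, if_false, if_true, n3, map_smul, form_idem, map_zero,
      smul_eq_mul, add_comm (2 * (l + j)) l] at this
    linarith

theorem der_idem_snd_self (hD : D ∈ m.der) (l : Fin 3) : (D (idem l)).2 l = 0 := by
  refine eq_zero_of_inner fun X => ?_
  have := hD.2.2 (idem l) (idem l) (off l X)
  simp only [cross_idem_idem, cross_idem_off, cross_off_idem, if_true, map_smul, form_off,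
    map_zero, smul_eq_mul] at this
  linarith

theorem der_idem_snd (hD : D ∈ m.der) (i : Fin 3) :
    (D (idem (i + 2))).2 i = - (D (idem (i + 1))).2 i := by
  have := congrArg (fun z : Herm K => z.2 i) (der_one hD)
  rw [one_eq i] at this
  simp only [map_add, Prod.snd_add, Pi.add_apply, der_idem_snd_self hD, Prod.snd_zero,
    Pi.zero_apply, zero_add] at this
  rw [add_comm] at this
  exact eq_neg_of_add_eq_zero_left this

/-- Skew endomorphisms acting in the same way on the three arguments of `⟨x y, z⟩` vanish unless
the dimension is two. -/
theorem eq_zero_of_central (e : OrthonormalBasis (Fin k) ℝ K) (hk : k ≠ 2)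
    {β : Fin 3 → K →ₗ[ℝ] K} (hβ : ∀ i x, inner ℝ (β i x) x = 0)
    (h1 : ∀ i x y, m.mul x (β (i + 1) y) = m.mul (β i x) y)
    (h2 : ∀ i x y, β (i + 2) (m.mul x y) = - m.mul (β i x) y) (i : Fin 3) : β i = 0 := by
  -- The two relations make every summand of `ρ'` equal to the same vector, so the sum is just k
  -- times it; likewise for `ρ`. Inserted into `rho_mul`, this leaves (2k - 4) β_i(u) x = 0.
  have hr' : ∀ i y, m.rho' e (β i) y = -(k : ℝ) • β (i + 1) y := by
    intro i y
    have : ∀ s, m.mul (m.mul (e s) y) (β i (e s)) = - β (i + 1) y := by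
      intro s
      have a := h1 (i + 2) (m.mul (e s) y) (e s)
      have b := h2 (i + 2) (m.mul (e s) y) (e s)
      have c3 : i + 2 + 1 = i := (cycle_simps i).2.2.1
      have c4 : i + 2 + 2 = i + 1 := (cycle_simps i).2.2.2.1
      rw [c3] at a
      rw [c4, m.mul_mul_self, inner_basis_self, one_smul] at b
      rw [a, b, neg_neg]
    rw [rho'_apply, Finset.sum_congr rfl fun s _ => this s]
    simp [← Nat.cast_smul_eq_nsmul ℝ]
  have hr : ∀ i y, m.rho e (β i) y = -(k : ℝ) • β (i + 2) y := by
    intro i y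
    have : ∀ s, m.mul (β i (e s)) (m.mul y (e s)) = - β (i + 2) y := by
      intro s
      have b := h2 i (e s) (m.mul y (e s))
      rw [m.mul_mul_self', inner_basis_self, one_smul] at b
      rw [b, neg_neg]
    rw [rho_apply, Finset.sum_congr rfl fun s _ => this s]
    simp [← Nat.cast_smul_eq_nsmul ℝ]
  have hk' : (2 * k - 4 : ℝ) ≠ 0 := by
    intro h
    have : (k : ℝ) = 2 := by linarith
    exact hk (by exact_mod_cast this)
  refine LinearMap.ext fun u => m.eq_zero_of_mul_eq_zero fun x => ?_
  have h := m.rho_mul e (hβ i) u x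
  rw [hr, hr', h2, map_smul, h1] at h
  have : (2 * k - 4 : ℝ) • m.mul (β i u) x = 0 := by
    linear_combination (norm := module) (1 : ℝ) • h
  exact (smul_eq_zero.1 this).resolve_left hk'

variable {D : Herm K →ₗ[ℝ] Herm K →ₗ[ℝ] Herm K}

/-- The coefficient of a family of derivations along an off-diagonal entry. -/
def rotCoeff (D : Herm K →ₗ[ℝ] Herm K →ₗ[ℝ] Herm K) (i : Fin 3) : K →ₗ[ℝ] K :=
  slot i ∘ₗ D.flip (idem (i + 1)) ∘ₗ off i

theorem rotCoeff_apply (i : Fin 3) (X : K) :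
    rotCoeff D i X = (D (off i X) (idem (i + 1))).2 i := rfl

theorem family_skew (hD0 : ∀ z, D z z = 0) (z w : Herm K) : D z w = - D w z := by
  have := hD0 (z + w)
  simp only [map_add, LinearMap.add_apply, hD0] at this
  exact eq_neg_of_add_eq_zero_right (by simpa using this)

/-- With D_z w = -D_w z and each D_z skew, ⟨D_z w, v⟩ is totally skew, in particular cyclic. -/
theorem family_form_swap (hD : ∀ z, D z ∈ m.der) (hD0 : ∀ z, D z z = 0) (z w v : Herm K) :
    form (D z w) v = form (D v z) w := by
  have h1 := (hD z).2.1 w v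
  rw [family_skew hD0 z v, map_neg, LinearMap.neg_apply] at h1
  linarith

theorem family_idem_idem (hD : ∀ z, D z ∈ m.der) (hD0 : ∀ z, D z z = 0) (l n : Fin 3) :
    D (idem l) (idem n) = 0 := by
  refine Prod.ext (funext fun j => der_idem_fst (hD _) n j) (funext fun j => ?_)
  refine eq_zero_of_inner fun Y => ?_
  have := family_form_swap hD hD0 (idem l) (idem n) (off j Y)
  rw [form_off, form_idem, der_idem_fst (hD _)] at this
  linarith

theorem family_off_idem_snd (hD : ∀ z, D z ∈ m.der) (hD0 : ∀ z, D z z = 0) {i j : Fin 3}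
    (h : j ≠ i) (l : Fin 3) (X : K) : (D (off i X) (idem l)).2 j = 0 := by
  have hj := der_idem_snd_self (hD (off i X)) j
  have hi : (D (off i X) (idem i)).2 j = 0 := by
    refine eq_zero_of_inner fun Y => ?_
    have h1 := family_form_swap hD hD0 (off i X) (idem i) (off j Y)
    have h2 := (hD (off j Y)).2.1 (off i X) (idem i)
    rw [form_off] at h1 h2
    rw [der_idem_snd_self (hD _) i, inner_zero_left] at h2
    linarith
  have h3 := der_idem_snd (hD (off i X)) j
  rcases cycle_cases j l with rfl | rfl | rfl
  · exact hj
  · rcases cycle_cases j i with rfl | rfl | rfl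
    · exact absurd rfl h
    · exact hi
    · rw [hi] at h3
      simpa using h3.symm
  · rcases cycle_cases j i with rfl | rfl | rfl
    · exact absurd rfl h
    · rw [hi] at h3
      simpa using h3
    · exact hi

theorem family_eq_off (hD : ∀ z, D z ∈ m.der) (hD0 : ∀ z, D z z = 0) (i l : Fin 3) (X : K) :
    D (off i X) (idem l) = off i ((D (off i X) (idem l)).2 i) := by
  refine Prod.ext (funext fun j => der_idem_fst (hD _) l j) (funext fun j => ?_)
  rw [off_snd]
  split_ifs with h
  · rw [h]
  · exact family_off_idem_snd hD hD0 h l X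

theorem family_idem_off (hD : ∀ z, D z ∈ m.der) (hD0 : ∀ z, D z z = 0) (i : Fin 3) (X : K) :
    D (idem i) (off i X) = 0 ∧ D (idem (i + 1)) (off i X) = - off i (rotCoeff D i X) ∧
      D (idem (i + 2)) (off i X) = off i (rotCoeff D i X) := by
  refine ⟨?_, ?_, ?_⟩ <;> rw [family_skew hD0, family_eq_off hD hD0]
  · rw [der_idem_snd_self (hD _), map_zero, neg_zero]
  · rfl
  · rw [der_idem_snd (hD _), map_neg, neg_neg]
    rfl

theorem rotCoeff_skew (hD : ∀ z, D z ∈ m.der) (hD0 : ∀ z, D z z = 0) (i : Fin 3) (X : K) :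
    inner ℝ (rotCoeff D i X) X = 0 := by
  have h1 := (hD (off i X)).2.1 (idem (i + 1)) (off i X)
  rw [hD0, map_zero, LinearMap.zero_apply, form_off] at h1
  rw [rotCoeff_apply]
  linarith

theorem cross_off_succ (i : Fin 3) (X Y : K) : m.cross (off i X) (off (i + 1) Y) =
    (1 / 2 : ℝ) • off (i + 2) (m.mul X Y) := by
  obtain ⟨c1, c2, c3, c4, c5, c6, c7⟩ := cycle_simps i
  simp only [cross_off_off, c5.symm, if_true, if_false, (third_cycle i).2.2]

/-- On slot i the derivations attached to e_i, e_{i+1}, e_{i+2} act by 0, -β_i, β_i. The two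
relations come from the Leibniz rule of the first two on a product of an element of slot i with one
of slot i + 1. -/
theorem rotCoeff_mul (hD : ∀ z, D z ∈ m.der) (hD0 : ∀ z, D z z = 0) (i : Fin 3) (X Y : K) :
    m.mul X (rotCoeff D (i + 1) Y) = m.mul (rotCoeff D i X) Y ∧
      rotCoeff D (i + 2) (m.mul X Y) = - m.mul (rotCoeff D i X) Y := by
  obtain ⟨c1, c2, c3, c4, c5, c6, c7⟩ := cycle_simps i
  have a0 := family_idem_off hD hD0 i X
  have a1 := family_idem_off hD hD0 (i + 1) Y
  have a2 := family_idem_off hD hD0 (i + 2) (m.mul X Y)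
  rw [c1, c2] at a1
  rw [c3, c4] at a2
  have h1 := der_cross (hD (idem i)) (off i X) (off (i + 1) Y)
  have h2 := der_cross (hD (idem (i + 1))) (off i X) (off (i + 1) Y)
  rw [cross_off_succ, map_smul, a0.1, a1.2.2, a2.2.1, map_zero, LinearMap.zero_apply, zero_add,
    cross_off_succ] at h1
  rw [cross_off_succ, map_smul, a0.2.1, a1.1, a2.2.2, map_zero, add_zero, ← map_neg,
    cross_off_succ] at h2
  have g1 := congrArg (fun z : Herm K => z.2 (i + 2)) h1
  have g2 := congrArg (fun z : Herm K => z.2 (i + 2)) h2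
  simp only [Prod.smul_snd, Pi.smul_apply, Prod.snd_neg, Pi.neg_apply, off_snd, if_true,
    map_neg, LinearMap.neg_apply] at g1 g2
  constructor
  · linear_combination (norm := module) (-2 : ℝ) • g1 - (2 : ℝ) • g2
  · linear_combination (norm := module) (2 : ℝ) • g2

/-- Once the idempotents act trivially, the Leibniz rule at e_j × Y = -Y / 2 confines D_X Y to the
slot of Y. By skewness in the two arguments it also lies in the slot of X, hence is zero for
different slots. For equal slots, multiplying by an arbitrary element of the next slot gives zero.
-/
theorem family_eq_zero (hD : ∀ z, D z ∈ m.der) (hD0 : ∀ z, D z z = 0)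
    (hβ : ∀ i, rotCoeff D i = 0) : D = 0 := by
  have hEX : ∀ l i X, D (idem l) (off i X) = 0 := by
    intro l i X
    obtain ⟨h0, h1, h2⟩ := family_idem_off hD hD0 i X
    rw [hβ, LinearMap.zero_apply, map_zero] at h1 h2
    rcases cycle_cases i l with rfl | rfl | rfl
    · exact h0
    · rw [h1, neg_zero]
    · exact h2
  have hXE : ∀ l i X, D (off i X) (idem l) = 0 := fun l i X => by
    rw [family_skew hD0, hEX, neg_zero]
  have hfst : ∀ i X j Y l, (D (off i X) (off j Y)).1 l = 0 := by
    intro i X j Y l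
    have := (hD (off i X)).2.1 (off j Y) (idem l)
    rwa [form_idem, hXE, map_zero, LinearMap.zero_apply, add_zero] at this
  have hsnd : ∀ i X j Y l, l ≠ j → (D (off i X) (off j Y)).2 l = 0 := by
    intro i X j Y l h
    have := der_cross (hD (off i X)) (idem j) (off j Y)
    rw [hXE, map_zero, LinearMap.zero_apply, zero_add, cross_idem_off, if_pos rfl, map_smul] at this
    have h2 := congrArg (fun z : Herm K => z.2 l) this
    simp only [Prod.smul_snd, Pi.smul_apply, cross_snd, idem_snd, idem_fst, h, if_false, map_zero,
      LinearMap.zero_apply, smul_zero, zero_smul, sub_zero, add_zero] at h2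
    simpa using h2
  have hoff : ∀ i X j Y, i ≠ j → D (off i X) (off j Y) = 0 := by
    intro i X j Y h
    refine Prod.ext (funext fun l => hfst _ _ _ _ _) (funext fun l => ?_)
    by_cases hl : l = j
    · rw [family_skew hD0, Prod.snd_neg, Pi.neg_apply, hsnd _ _ _ _ _ (hl ▸ h.symm)]
      simp
    · exact hsnd _ _ _ _ _ hl
  have hself : ∀ i X Y, D (off i X) (off i Y) = 0 := by
    intro i X Y
    obtain ⟨c1, c2, c3, c4, c5, c6, c7⟩ := cycle_simps i
    refine Prod.ext (funext fun l => hfst _ _ _ _ _) (funext fun l => ?_)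
    by_cases hl : l = i
    · subst hl
      refine m.eq_zero_of_mul_eq_zero fun Z => ?_
      have h1 := der_cross (hD (off l X)) (off l Y) (off (l + 1) Z)
      rw [cross_off_succ, map_smul, hoff _ _ _ _ c6.symm, hoff _ _ _ _ c5.symm, map_zero,
        add_zero, smul_zero] at h1
      have h2 := congrArg (fun z : Herm K => z.2 (l + 2)) h1
      simp only [cross_snd, off_snd, off_fst, c3, c4, c7, if_true, if_false,
        smul_zero, zero_smul, sub_zero, Prod.snd_zero,
        Pi.zero_apply] at h2
      simpa using h2.symm
    · exact hsnd _ _ _ _ _ hl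
  have hEE := family_idem_idem hD hD0
  refine LinearMap.ext₂ fun x y => ?_
  rw [eq_sum x, eq_sum y]
  simp only [map_add, map_sum, LinearMap.add_apply, LinearMap.sum_apply, map_smul,
    LinearMap.smul_apply, hEE, hEX, hXE, smul_zero, Finset.sum_const_zero, zero_add, add_zero,
    LinearMap.zero_apply]
  refine Finset.sum_eq_zero fun i _ => Finset.sum_eq_zero fun j _ => ?_
  by_cases h : i = j
  · subst h; exact hself _ _ _
  · exact hoff _ _ _ _ (Ne.symm h)

/-- A linear family of derivations with `D_z z = 0` vanishes, unless the dimension is two. -/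
theorem family_eq_zero_of_ne_two (e : OrthonormalBasis (Fin k) ℝ K) (hk : k ≠ 2)
    (hD : ∀ z, D z ∈ m.der) (hD0 : ∀ z, D z z = 0) : D = 0 :=
  family_eq_zero hD hD0 fun i => eq_zero_of_central e hk (fun i x => rotCoeff_skew hD hD0 i x)
    (fun i x y => (rotCoeff_mul hD hD0 i x y).1) (fun i x y => (rotCoeff_mul hD hD0 i x y).2) i

/-- The relation x β_{i+1}(y) = β_i(x) y lets one coefficient determine the next, in any dimension;
this is what remains usable for k = 2. -/
theorem family_eq_zero_of_rotCoeff (hD : ∀ z, D z ∈ m.der) (hD0 : ∀ z, D z z = 0)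
    (h0 : rotCoeff D 0 = 0) : D = 0 := by
  have h : ∀ i, rotCoeff D i = 0 → rotCoeff D (i + 1) = 0 := by
    intro i hi
    refine LinearMap.ext fun y => ?_
    have h1 := (rotCoeff_mul hD hD0 i (rotCoeff D (i + 1) y) y).1
    rw [hi, LinearMap.zero_apply, map_zero, LinearMap.zero_apply] at h1
    have h2 := m.inner_mul_mul_left (rotCoeff D (i + 1) y) (rotCoeff D (i + 1) y)
      (rotCoeff D (i + 1) y)
    rw [h1, inner_zero_left] at h2
    exact inner_self_eq_zero.1 (mul_self_eq_zero.1 h2.symm)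
  refine family_eq_zero hD hD0 fun i => ?_
  fin_cases i
  · exact h0
  · exact h 0 h0
  · exact h 1 (h 0 h0)

end SymComp
end

noncomputable section

/-! ### The commutative product on `ℝⁿ` defined by the cubic form -/

/-- The symmetric matrix `Υ_{IJK} x^K`. -/
def mulMat {n : ℕ} : (Fin n → ℝ) →ₗ[ℝ] Matrix (Fin n) (Fin n) ℝ where
  toFun x := Matrix.of fun I J => ∑ K, upsilon n I J K * x K
  map_add' x y := by
    ext I J
    simp [mul_add, Finset.sum_add_distrib]
  map_smul' c x := by
    ext I J
    simp only [of_apply, Pi.smul_apply, smul_eq_mul, Matrix.smul_apply, RingHom.id_apply,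
      Finset.mul_sum]
    exact Finset.sum_congr rfl fun K _ => by ring

/-- The standard basis vectors. -/
def stdVec {n : ℕ} (M : Fin n) : Fin n → ℝ := Pi.single M 1

section

variable {n : ℕ}

theorem mulMat_apply (x : Fin n → ℝ) (I J : Fin n) :
    mulMat x I J = ∑ K, upsilon n I J K * x K := rfl

theorem mulMat_stdVec (I J K : Fin n) : mulMat (stdVec K) I J = upsilon n I J K := by
  simp [mulMat_apply, stdVec, Pi.single_apply]

theorem mulMat_transpose (x : Fin n → ℝ) : (mulMat x)ᵀ = mulMat x := by
  ext I J
  simp only [transpose_apply, mulMat_apply, upsilon_swap_left J I]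

theorem mulMat_mulVec_comm (x y : Fin n → ℝ) : mulMat x *ᵥ y = mulMat y *ᵥ x := by
  ext I
  simp only [mulVec, dotProduct, mulMat_apply, Finset.sum_mul]
  rw [Finset.sum_comm]
  refine Finset.sum_congr rfl fun J _ => Finset.sum_congr rfl fun K _ => ?_
  rw [upsilon_swap_right]
  ring

theorem upsilonForm_eq (x y z : Fin n → ℝ) : upsilonForm n x y z = (mulMat x *ᵥ y) ⬝ᵥ z := by
  rw [mulMat_mulVec_comm]
  have : ∀ I J K, upsilon n I J K = upsilon n K I J := fun I J K => by
    rw [upsilon_swap_right, upsilon_swap_left]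
  simp only [upsilonForm, mulVec, dotProduct, mulMat_apply, Finset.sum_mul]
  rw [Finset.sum_comm_cycle]
  refine Finset.sum_congr rfl fun K _ => Finset.sum_congr rfl fun I _ =>
    Finset.sum_congr rfl fun J _ => ?_
  rw [this I J K]
  ring

theorem mulMat_dotProduct (x y z : Fin n → ℝ) :
    (mulMat x *ᵥ y) ⬝ᵥ z = y ⬝ᵥ (mulMat x *ᵥ z) := by
  rw [dotProduct_mulVec, ← mulVec_transpose, mulMat_transpose]

theorem mulMat_dotProduct_swap (x y z : Fin n → ℝ) :
    (mulMat x *ᵥ y) ⬝ᵥ z = (mulMat z *ᵥ y) ⬝ᵥ x := by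
  rw [mulMat_dotProduct, mulMat_mulVec_comm, dotProduct_comm, mulMat_dotProduct,
    mulMat_dotProduct, dotProduct_comm, mulMat_dotProduct, dotProduct_comm, mulMat_dotProduct]

theorem mulVec_stdVec (A : Matrix (Fin n) (Fin n) ℝ) (M I : Fin n) :
    (A *ᵥ stdVec M) I = A I M := by
  simp [stdVec]

theorem vec_eq_sum (x : Fin n → ℝ) : x = ∑ M, x M • stdVec M := by
  ext I
  simp [stdVec, Finset.sum_apply, Pi.single_apply]

theorem sum_basis_adjoint {E : Type*} [AddCommGroup E] [Module ℝ E]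
    (B : (Fin n → ℝ) →ₗ[ℝ] (Fin n → ℝ) →ₗ[ℝ] E) (A : Matrix (Fin n) (Fin n) ℝ) :
    ∑ M, B (A *ᵥ stdVec M) (stdVec M) = ∑ M, B (stdVec M) (Aᵀ *ᵥ stdVec M) := by
  have h1 : ∀ M, B (A *ᵥ stdVec M) (stdVec M) = ∑ N, A N M • B (stdVec N) (stdVec M) := by
    intro M
    rw [vec_eq_sum (A *ᵥ stdVec M)]
    simp only [mulVec_stdVec, map_sum, map_smul, LinearMap.sum_apply, LinearMap.smul_apply]
  have h2 : ∀ M, B (stdVec M) (Aᵀ *ᵥ stdVec M) = ∑ N, A M N • B (stdVec M) (stdVec N) := by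
    intro M
    rw [vec_eq_sum (Aᵀ *ᵥ stdVec M)]
    simp only [mulVec_stdVec, map_sum, map_smul, transpose_apply]
  simp only [h1, h2]
  rw [Finset.sum_comm]

theorem eq_of_mulVec {A B : Matrix (Fin n) (Fin n) ℝ} (h : ∀ x, A *ᵥ x = B *ᵥ x) : A = B := by
  ext I J
  rw [← mulVec_stdVec A, h, mulVec_stdVec]

theorem sum_vecMulVec (A B : Matrix (Fin n) (Fin n) ℝ) :
    ∑ M, vecMulVec (A *ᵥ stdVec M) (B *ᵥ stdVec M) = A * Bᵀ := by
  ext I J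
  simp [Matrix.sum_apply, vecMulVec_apply, mulVec_stdVec, mul_apply]

/-- The endomorphism `W ↦ 4 ∑ U_M W U_M`. -/
theorem upsilonHat_eq (W : Matrix (Fin n) (Fin n) ℝ) :
    upsilonHat n W = (4 : ℝ) • ∑ M, mulMat (stdVec M) * W * mulMat (stdVec M) := by
  ext I K
  simp only [upsilonHat, LinearMap.coe_mk, AddHom.coe_mk, of_apply, Matrix.smul_apply,
    Matrix.sum_apply, mul_apply, mulMat_stdVec, smul_eq_mul, Finset.sum_mul, Finset.mul_sum]
  rw [Finset.sum_comm_cycle]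
  refine Finset.sum_congr rfl fun M _ => ?_
  rw [Finset.sum_comm]
  refine Finset.sum_congr rfl fun L _ => Finset.sum_congr rfl fun J _ => ?_
  rw [upsilon_swap_left K L]
  ring

/-- Total symmetry of Υ moves `W` from between the two multiplications into the argument of one of
them. -/
theorem upsilonHat_eq' (W : Matrix (Fin n) (Fin n) ℝ) :
    upsilonHat n W = (4 : ℝ) • ∑ M, mulMat (W *ᵥ stdVec M) * mulMat (stdVec M) := by
  ext I K
  simp only [upsilonHat, LinearMap.coe_mk, AddHom.coe_mk, of_apply, Matrix.smul_apply,
    Matrix.sum_apply, mul_apply, mulMat_stdVec]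
  simp only [mulMat_apply, mulVec_stdVec, smul_eq_mul, Finset.sum_mul, Finset.mul_sum]
  rw [Finset.sum_comm]
  refine Finset.sum_congr rfl fun L _ => ?_
  rw [Finset.sum_comm]
  refine Finset.sum_congr rfl fun M _ => Finset.sum_congr rfl fun J _ => ?_
  rw [upsilon_swap_right I J M, upsilon_swap_right K L M, upsilon_swap_left K M L]
  ring

theorem upsilonHat_transpose (W : Matrix (Fin n) (Fin n) ℝ) :
    (upsilonHat n W)ᵀ = upsilonHat n Wᵀ := by
  rw [upsilonHat_eq, upsilonHat_eq, transpose_smul, transpose_sum]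
  simp only [transpose_mul, mulMat_transpose, Matrix.mul_assoc]

theorem trace_upsilonHat_mul (V W : Matrix (Fin n) (Fin n) ℝ) :
    (upsilonHat n V * W).trace = (V * upsilonHat n W).trace := by
  rw [upsilonHat_eq, upsilonHat_eq, Matrix.smul_mul, Matrix.mul_smul, trace_smul, trace_smul,
      Finset.sum_mul,
    Finset.mul_sum, trace_sum, trace_sum]
  congr 1
  refine Finset.sum_congr rfl fun M _ => ?_
  rw [Matrix.mul_assoc, Matrix.mul_assoc, trace_mul_comm]
  simp only [Matrix.mul_assoc]

theorem eq_zero_of_trace_transpose_mul {A : Matrix (Fin n) (Fin n) ℝ}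
    (h : (Aᵀ * A).trace = 0) : A = 0 := by
  have := Matrix.trace_conjTranspose_mul_self_eq_zero_iff (A := A)
  rw [conjTranspose_eq_transpose_of_trivial] at this
  exact this.1 h

theorem trace_transpose_mul_nonneg (A : Matrix (Fin n) (Fin n) ℝ) : 0 ≤ (Aᵀ * A).trace := by
  simp only [trace, diag, mul_apply, transpose_apply]
  exact Finset.sum_nonneg fun i _ => Finset.sum_nonneg fun j _ => mul_self_nonneg _

/-- The identities satisfied by the cubic form: `Υ_{MMK} = 0` and `|x ∘ x| = |x|²`. -/
structure CartanCubic (n : ℕ) : Prop where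
  trace : ∑ M : Fin n, mulMat (stdVec M) *ᵥ stdVec M = 0
  norm : ∀ x : Fin n → ℝ, (mulMat x *ᵥ x) ⬝ᵥ (mulMat x *ᵥ x) = (x ⬝ᵥ x) ^ 2

namespace CartanCubic

variable (h : CartanCubic n)
include h

/-- The derivative of |x∘x|² = |x|⁴ in an arbitrary direction. -/
theorem cube (x : Fin n → ℝ) : mulMat x *ᵥ (mulMat x *ᵥ x) = (x ⬝ᵥ x) • x := by
  have key : ∀ y, (mulMat x *ᵥ (mulMat x *ᵥ x)) ⬝ᵥ y = (x ⬝ᵥ x) * (x ⬝ᵥ y) := by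
    intro y
    have h1 := h.norm (x + y)
    have h2 := h.norm (x - y)
    have h3 := h.norm (x + (2 : ℝ) • y)
    have h4 := h.norm (x - (2 : ℝ) • y)
    simp only [map_add, map_sub, map_smul, add_mulVec, sub_mulVec, smul_mulVec, mulVec_add,
      mulVec_sub, mulVec_smul, mulMat_mulVec_comm y x, add_dotProduct, sub_dotProduct,
      dotProduct_add, dotProduct_sub, dotProduct_smul, smul_dotProduct, smul_eq_mul,
      dotProduct_comm y x, dotProduct_comm (mulMat x *ᵥ y) (mulMat x *ᵥ x),
      dotProduct_comm (mulMat y *ᵥ y) (mulMat x *ᵥ x),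
      dotProduct_comm (mulMat y *ᵥ y) (mulMat x *ᵥ y)] at h1 h2 h3 h4
    rw [mulMat_dotProduct]
    -- Differences at ±y and ±2y isolate the coefficient of t in the quartic polynomial obtained
    -- from x + t y; that coefficient is 4⟨x∘x, x∘y⟩ on the left of `norm`.
    linear_combination (1 / 6 : ℝ) * (h1 - h2) - (1 / 48 : ℝ) * (h3 - h4)
  refine dotProduct_eq _ _ fun y => ?_
  rw [key, smul_dotProduct, smul_eq_mul]

theorem cube_polar (x y z : Fin n → ℝ) :
    mulMat x *ᵥ (mulMat y *ᵥ z) + mulMat y *ᵥ (mulMat x *ᵥ z) + mulMat (mulMat x *ᵥ y) *ᵥ z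
      = (x ⬝ᵥ y) • z + (y ⬝ᵥ z) • x + (x ⬝ᵥ z) • y := by
  have h1 := h.cube (x + y + z)
  have h2 := h.cube (x + y)
  have h3 := h.cube (x + z)
  have h4 := h.cube (y + z)
  have h5 := h.cube x
  have h6 := h.cube y
  have h7 := h.cube z
  rw [mulMat_mulVec_comm (mulMat x *ᵥ y) z]
  simp only [map_add, add_mulVec, mulVec_add, mulMat_mulVec_comm y x, mulMat_mulVec_comm z x,
    mulMat_mulVec_comm z y, add_dotProduct, dotProduct_add, dotProduct_comm y x,
    dotProduct_comm z x, dotProduct_comm z y] at h1 h2 h3 h4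
  linear_combination (norm := module) (1 / 2 : ℝ) • (h1 - h2 - h3 - h4 + h5 + h6 + h7)

theorem mulMat_mul (x y : Fin n → ℝ) :
    mulMat x * mulMat y + mulMat y * mulMat x + mulMat (mulMat x *ᵥ y)
      = (x ⬝ᵥ y) • 1 + vecMulVec x y + vecMulVec y x := by
  refine eq_of_mulVec fun z => ?_
  simp only [add_mulVec, ← mulVec_mulVec, h.cube_polar, smul_mulVec, one_mulVec, vecMulVec_mulVec]
  simp only [op_smul_eq_smul]

/-- Contraction of `mulMat_mul` over the basis. The term with `∑ e∘e` drops out by trace-freeness,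
and the rank-one terms add up to twice the identity. -/
theorem sum_mulMat_sq : ∑ M, mulMat (stdVec M) * mulMat (stdVec M) =
    ((n + 2 : ℝ) / 2) • (1 : Matrix (Fin n) (Fin n) ℝ) := by
  have h1 : ∑ M, (mulMat (stdVec M) * mulMat (stdVec M) + mulMat (stdVec M) * mulMat (stdVec M) +
      mulMat (mulMat (stdVec M) *ᵥ stdVec M)) =
      ∑ M : Fin n, ((stdVec M ⬝ᵥ stdVec M) • (1 : Matrix (Fin n) (Fin n) ℝ) + vecMulVec (stdVec M)
          (stdVec M)
        + vecMulVec (stdVec M) (stdVec M)) := Finset.sum_congr rfl fun M _ => h.mulMat_mul _ _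
  have h2 := sum_vecMulVec (1 : Matrix (Fin n) (Fin n) ℝ) 1
  simp only [one_mulVec, transpose_one, mul_one] at h2
  have h3 : ∀ M : Fin n, stdVec M ⬝ᵥ stdVec M = 1 := fun M => by simp [stdVec]
  simp only [Finset.sum_add_distrib, ← map_sum, h.trace, map_zero, h2, h3, one_smul,
    Finset.sum_const, Finset.card_univ, Fintype.card_fin, add_zero,
    ← Nat.cast_smul_eq_nsmul ℝ] at h1
  linear_combination (norm := module) (1 / 2 : ℝ) • h1

end CartanCubic
end
end

/-! ### Derivations of the product and eigenvalues of `upsilonHat`. -/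

noncomputable section

section

variable {n : ℕ}

/-- Skewness turns infinitesimal invariance of Υ into the Leibniz rule for ∘, which is then written
as an identity between operators. -/
theorem mem_stabLie_iff {D : Matrix (Fin n) (Fin n) ℝ} : D ∈ stabLie n ↔ Dᵀ = -D ∧
    ∀ x, D * mulMat x = mulMat (D *ᵥ x) + mulMat x * D := by
  have hm : D ∈ stabLie n ↔ ExpMemStab n D := Iff.rfl
  rw [hm, expMemStab_iff]
  refine and_congr_right fun hD => ?_
  have hskew : ∀ x y, x ⬝ᵥ (D *ᵥ y) = -((D *ᵥ x) ⬝ᵥ y) := by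
    intro x y
    rw [dotProduct_mulVec, ← mulVec_transpose, hD, neg_mulVec, neg_dotProduct]
  constructor
  · refine fun h x => eq_of_mulVec fun y => dotProduct_eq _ _ fun z => ?_
    have := h x y z
    simp only [upsilonForm_eq, hskew] at this
    simp only [add_mulVec, ← mulVec_mulVec, add_dotProduct]
    linarith
  · intro h x y z
    have := congrArg (fun A => (A *ᵥ y) ⬝ᵥ z) (h x)
    simp only [add_mulVec, ← mulVec_mulVec, add_dotProduct] at this
    simp only [upsilonForm_eq, hskew]
    linarith

theorem stabLie_mulVec {D : Matrix (Fin n) (Fin n) ℝ} (hD : D ∈ stabLie n) (x y : Fin n → ℝ) :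
    D *ᵥ (mulMat x *ᵥ y) = mulMat (D *ᵥ x) *ᵥ y + mulMat x *ᵥ (D *ᵥ y) := by
  rw [mulVec_mulVec, (mem_stabLie_iff.1 hD).2, add_mulVec, mulVec_mulVec]

theorem stabLie_mulVec_self {D : Matrix (Fin n) (Fin n) ℝ} (hD : D ∈ stabLie n) (x : Fin n → ℝ) :
    D *ᵥ (mulMat x *ᵥ x) = (2 : ℝ) • mulMat x *ᵥ (D *ᵥ x) := by
  rw [stabLie_mulVec hD, mulMat_mulVec_comm (D *ᵥ x), two_smul]

/-- The failure of a matrix to be a derivation of the product. -/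
def defect (W : Matrix (Fin n) (Fin n) ℝ) (x : Fin n → ℝ) : Matrix (Fin n) (Fin n) ℝ :=
  W * mulMat x - mulMat x * W - mulMat (W *ᵥ x)

theorem defect_linear (W : Matrix (Fin n) (Fin n) ℝ) (x : Fin n → ℝ) :
    defect W x = ∑ M, x M • defect W (stdVec M) := by
  conv_lhs => rw [vec_eq_sum x]
  simp only [defect, map_sum, map_smul, mulVec_sum, mulVec_smul, Finset.mul_sum, Finset.sum_mul,
    Matrix.mul_smul, Matrix.smul_mul, ← Finset.sum_sub_distrib, smul_sub]

theorem defect_transpose {W : Matrix (Fin n) (Fin n) ℝ} (hW : Wᵀ = -W) (x : Fin n → ℝ) :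
    (defect W x)ᵀ = defect W x := by
  simp only [defect, transpose_sub, transpose_mul, mulMat_transpose, hW]
  noncomm_ring

theorem sum_mulMat_mulMat_mulVec (W : Matrix (Fin n) (Fin n) ℝ) :
    ∑ M, mulMat (stdVec M) * mulMat (W *ᵥ stdVec M) = (1 / 4 : ℝ) • upsilonHat n Wᵀ := by
  rw [← upsilonHat_transpose, upsilonHat_eq', transpose_smul, transpose_sum, smul_smul]
  simp only [transpose_mul, mulMat_transpose]
  norm_num

theorem sum_mulMat_mulVec_mulMat (W : Matrix (Fin n) (Fin n) ℝ) :
    ∑ M, mulMat (W *ᵥ stdVec M) * mulMat (stdVec M) = (1 / 4 : ℝ) • upsilonHat n W := by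
  rw [upsilonHat_eq', smul_smul]
  norm_num

theorem sum_mulMat_mul_mulMat (W : Matrix (Fin n) (Fin n) ℝ) :
    ∑ M, mulMat (stdVec M) * W * mulMat (stdVec M) = (1 / 4 : ℝ) • upsilonHat n W := by
  rw [upsilonHat_eq, smul_smul]
  norm_num

namespace CartanCubic

variable (h : CartanCubic n)
include h

/-- By total symmetry the trace is ⟨x, ∑ U_M² y⟩, so it is given by `sum_mulMat_sq`. -/
theorem trace_mulMat_mul (x y : Fin n → ℝ) :
    (mulMat x * mulMat y).trace = (n + 2 : ℝ) / 2 * (x ⬝ᵥ y) := by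
  have h1 := congrArg (fun A => x ⬝ᵥ (A *ᵥ y)) h.sum_mulMat_sq
  simp only [smul_mulVec, one_mulVec, dotProduct_smul, smul_eq_mul, sum_mulVec,
    dotProduct_sum] at h1
  rw [← h1, Matrix.trace]
  refine Finset.sum_congr rfl fun M _ => ?_
  rw [diag_apply, ← mulVec_stdVec (mulMat x * mulMat y), ← mulVec_mulVec, ← mulVec_mulVec, ←
      mulMat_dotProduct,
    mulMat_mulVec_comm _ x, mulMat_mulVec_comm _ y, mulMat_dotProduct]
  simp [stdVec]

/-- The defect of a skew matrix is symmetric, so for V = W the left side is a sum of squares that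
vanishes exactly on derivations. On the right every contraction reduces to Υ̂ or to `∑ U_M²`. Hence
𝔥 is the eigenspace of Υ̂ for n + 2 on skew matrices, and n + 2 is the largest eigenvalue there. -/
theorem sum_trace_defect {V W : Matrix (Fin n) (Fin n) ℝ} (hV : Vᵀ = -V) (hW : Wᵀ = -W) :
    ∑ M, (defect V (stdVec M) * defect W (stdVec M)).trace =
      3 / 2 * (V * upsilonHat n W).trace - 3 * ((n + 2 : ℝ) / 2) * (V * W).trace := by
  have hM : ∀ M : Fin n, (defect V (stdVec M) * defect W (stdVec M)).trace =
      2 * (V * (mulMat (stdVec M) * W * mulMat (stdVec M))).trace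
      - (mulMat (stdVec M) * mulMat (stdVec M) * (W * V)).trace
      - (mulMat (stdVec M) * mulMat (stdVec M) * (V * W)).trace
      - (V * (mulMat (stdVec M) * mulMat (W *ᵥ stdVec M))).trace
      + (V * (mulMat (W *ᵥ stdVec M) * mulMat (stdVec M))).trace
      - (W * (mulMat (stdVec M) * mulMat (V *ᵥ stdVec M))).trace
      + (W * (mulMat (V *ᵥ stdVec M) * mulMat (stdVec M))).trace
      + (mulMat (V *ᵥ stdVec M) * mulMat (W *ᵥ stdVec M)).trace := by
    intro M
    set U := mulMat (stdVec M)
    set A := mulMat (V *ᵥ stdVec M) with hA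
    set B := mulMat (W *ᵥ stdVec M) with hB
    have e1 : (U * (V * (U * W))).trace = (V * (U * (W * U))).trace := by
      rw [trace_mul_comm]; simp only [Matrix.mul_assoc]
    have e2 : (V * (U * (U * W))).trace = (U * (U * (W * V))).trace := by
      rw [trace_mul_comm]; simp only [Matrix.mul_assoc]
    have e3 : (U * (V * (W * U))).trace = (U * (U * (V * W))).trace := by
      rw [trace_mul_comm, Matrix.mul_assoc, Matrix.mul_assoc, trace_mul_comm]
      simp only [Matrix.mul_assoc]
      rw [trace_mul_comm]
      simp only [Matrix.mul_assoc]
    have e4 : (U * (V * B)).trace = (V * (B * U)).trace := by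
      rw [trace_mul_comm]; simp only [Matrix.mul_assoc]
    have e5 : (A * (W * U)).trace = (W * (U * A)).trace := by
      rw [trace_mul_comm]; simp only [Matrix.mul_assoc]
    have e6 : (A * (U * W)).trace = (W * (A * U)).trace := by
      rw [← Matrix.mul_assoc, trace_mul_comm]
    simp only [defect, ← hA, ← hB, sub_mul, mul_sub, trace_sub, Matrix.mul_assoc] at *
    rw [e1, e2, e3, e4, e5, e6]
    ring
  have t1 : ∑ M, (mulMat (V *ᵥ stdVec M) * mulMat (W *ᵥ stdVec M)).trace =
      - ((n + 2 : ℝ) / 2 * (V * W).trace) := by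
    have := sum_vecMulVec W V
    have h2 : ∀ M, (mulMat (V *ᵥ stdVec M) * mulMat (W *ᵥ stdVec M)).trace =
        (n + 2 : ℝ) / 2 * (vecMulVec (W *ᵥ stdVec M) (V *ᵥ stdVec M)).trace := by
      intro M
      rw [h.trace_mulMat_mul, trace_vecMulVec, dotProduct_comm]
    simp only [h2]
    rw [← Finset.mul_sum, ← trace_sum, this, hV, mul_neg, trace_neg, trace_mul_comm]
    ring
  simp only [hM, Finset.sum_add_distrib, Finset.sum_sub_distrib, ← Finset.mul_sum, ← trace_sum,
    ← Finset.sum_mul, sum_mulMat_mul_mulMat, h.sum_mulMat_sq, sum_mulMat_mulMat_mulVec,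
    sum_mulMat_mulVec_mulMat, t1]
  rw [hV, hW]
  have := trace_upsilonHat_mul V W
  rw [trace_mul_comm] at this
  simp only [Matrix.mul_smul, Matrix.smul_mul, one_mul, trace_smul, map_neg, mul_neg, trace_neg,
    smul_eq_mul, this, trace_mul_comm W V, smul_neg]
  ring

theorem mem_stabLie_of_upsilonHat {W : Matrix (Fin n) (Fin n) ℝ} (hW : Wᵀ = -W)
    (h0 : upsilonHat n W = (n + 2 : ℝ) • W) : W ∈ stabLie n := by
  have h1 := h.sum_trace_defect hW hW
  rw [h0, Matrix.mul_smul, trace_smul, smul_eq_mul] at h1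
  have h2 : ∑ M, ((defect W (stdVec M))ᵀ * defect W (stdVec M)).trace = 0 := by
    simp only [defect_transpose hW]
    rw [h1]
    ring
  rw [Finset.sum_eq_zero_iff_of_nonneg fun M _ => trace_transpose_mul_nonneg _] at h2
  refine mem_stabLie_iff.2 ⟨hW, fun x => ?_⟩
  have h3 : defect W x = 0 := by
    rw [defect_linear]
    refine Finset.sum_eq_zero fun M _ => ?_
    rw [eq_zero_of_trace_transpose_mul (h2 M (Finset.mem_univ _)), smul_zero]
  rw [defect, sub_sub, sub_eq_zero] at h3
  rw [h3, add_comm]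

/-- As D has no defect, the identity gives tr(V (Υ̂D - (n + 2)D)) = 0 for every skew V. Taking V to
be the second factor makes it zero. -/
theorem upsilonHat_of_mem {D : Matrix (Fin n) (Fin n) ℝ} (hD : D ∈ stabLie n) :
    upsilonHat n D = (n + 2 : ℝ) • D := by
  rw [mem_stabLie_iff] at hD
  set X := upsilonHat n D - (n + 2 : ℝ) • D with hX
  have hXs : Xᵀ = -X := by
    rw [hX, transpose_sub, upsilonHat_transpose, transpose_smul, hD.1, map_neg]
    module
  have h1 := h.sum_trace_defect hXs hD.1
  have h2 : ∀ x, defect D x = 0 := fun x => by rw [defect, hD.2]; abel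
  simp only [h2, mul_zero, trace_zero, Finset.sum_const_zero] at h1
  have h3 : (Xᵀ * X).trace = 0 := by
    conv_lhs => rw [hXs, hX, neg_mul, ← hX, mul_sub, trace_neg, trace_sub, Matrix.mul_smul,
      trace_smul, smul_eq_mul]
    linarith
  exact sub_eq_zero.1 (eq_zero_of_trace_transpose_mul h3)

/-- The sum of squares is a positive multiple of tr(W²), which is nonpositive for skew W. -/
theorem eq_zero_of_upsilonHat {W : Matrix (Fin n) (Fin n) ℝ} (hW : Wᵀ = -W) {r : ℝ}
    (h0 : upsilonHat n W = r • W) (hr : (n + 2 : ℝ) < r) : W = 0 := by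
  have h1 := h.sum_trace_defect hW hW
  rw [h0, Matrix.mul_smul, trace_smul, smul_eq_mul] at h1
  have h2 : 0 ≤ ∑ M, ((defect W (stdVec M))ᵀ * defect W (stdVec M)).trace :=
    Finset.sum_nonneg fun M _ => trace_transpose_mul_nonneg _
  simp only [defect_transpose hW] at h2
  have h3 := trace_transpose_mul_nonneg W
  refine eq_zero_of_trace_transpose_mul (le_antisymm ?_ h3)
  rw [hW, neg_mul, trace_neg] at h3 ⊢
  nlinarith

/-- The contraction of a matrix with the cubic form. -/
def _root_.contract : Matrix (Fin n) (Fin n) ℝ →ₗ[ℝ] Fin n → ℝ where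
  toFun A := ∑ M, mulMat (stdVec M) *ᵥ (A *ᵥ stdVec M)
  map_add' A B := by simp only [add_mulVec, mulVec_add, Finset.sum_add_distrib]
  map_smul' c A := by simp only [smul_mulVec, mulVec_smul, Finset.smul_sum, RingHom.id_apply]

end CartanCubic

theorem contract_apply (A : Matrix (Fin n) (Fin n) ℝ) :
    contract A = ∑ M, mulMat (stdVec M) *ᵥ (A *ᵥ stdVec M) := rfl

theorem contract_transpose (A : Matrix (Fin n) (Fin n) ℝ) : contract Aᵀ = contract A := by
  let B : (Fin n → ℝ) →ₗ[ℝ] (Fin n → ℝ) →ₗ[ℝ] (Fin n → ℝ) :=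
    LinearMap.mk₂ ℝ (fun x y => mulMat x *ᵥ y) (by simp [add_mulVec]) (by simp [smul_mulVec])
      (by simp [mulVec_add]) (by simp [mulVec_smul])
  have := sum_basis_adjoint B A
  simp only [B, LinearMap.mk₂_apply] at this
  rw [contract_apply, contract_apply, ← this]
  exact Finset.sum_congr rfl fun M _ => mulMat_mulVec_comm _ _

theorem contract_skew {A : Matrix (Fin n) (Fin n) ℝ} (hA : Aᵀ = -A) : contract A = 0 := by
  have := contract_transpose A
  rw [hA, map_neg] at this
  exact self_eq_neg.1 this.symm

theorem contract_vecMulVec (x y : Fin n → ℝ) : contract (vecMulVec x y) = mulMat y *ᵥ x := by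
  rw [contract_apply]
  conv_rhs => rw [vec_eq_sum y, map_sum, sum_mulVec]
  refine Finset.sum_congr rfl fun M _ => ?_
  rw [vecMulVec_mulVec, op_smul_eq_smul, mulVec_smul, map_smul, smul_mulVec]
  simp [stdVec]

namespace CartanCubic

variable (h : CartanCubic n)
include h

theorem contract_one : contract (1 : Matrix (Fin n) (Fin n) ℝ) = 0 := by
  simp only [contract_apply, one_mulVec, h.trace]

theorem contract_mulMat (x : Fin n → ℝ) : contract (mulMat x) = ((n + 2 : ℝ) / 2) • x := by
  have := congrArg (fun A => A *ᵥ x) h.sum_mulMat_sq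
  simp only [smul_mulVec, one_mulVec, sum_mulVec, ← mulVec_mulVec] at this
  rw [contract_apply, ← this]
  exact Finset.sum_congr rfl fun M _ => by rw [mulMat_mulVec_comm x]

theorem trace_mulMat (x : Fin n → ℝ) : (mulMat x).trace = 0 := by
  have : (mulMat x).trace = ∑ M, (mulMat (stdVec M) *ᵥ stdVec M) ⬝ᵥ x := by
    rw [Matrix.trace]
    refine Finset.sum_congr rfl fun M _ => ?_
    rw [diag_apply, mulMat_apply, dotProduct]
    refine Finset.sum_congr rfl fun K _ => ?_
    rw [mulVec_stdVec, mulMat_stdVec, upsilon_swap_right K M M, upsilon_swap_left K M M,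
      upsilon_swap_right M K M]
  rw [this, ← sum_dotProduct, h.trace, zero_dotProduct]

/-- The sum of `mulMat_mul` over all pairs `(e, W e)`. -/
theorem upsilonHat_add_transpose (W : Matrix (Fin n) (Fin n) ℝ) :
    (1 / 4 : ℝ) • (upsilonHat n W + upsilonHat n Wᵀ) + mulMat (contract W) =
      W.trace • (1 : Matrix (Fin n) (Fin n) ℝ) + W + Wᵀ := by
  have h1 := Finset.sum_congr rfl fun (M : Fin n) (_ : M ∈ Finset.univ) =>
    h.mulMat_mul (stdVec M) (W *ᵥ stdVec M)
  have h2 := sum_vecMulVec W 1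
  have h3 := sum_vecMulVec 1 W
  simp only [one_mulVec, transpose_one, mul_one, one_mul] at h2 h3
  have h4 : ∀ M : Fin n, stdVec M ⬝ᵥ W *ᵥ stdVec M = W M M := fun M => by simp [stdVec]
  simp only [Finset.sum_add_distrib, ← map_sum, h2, h3, sum_mulMat_mulMat_mulVec,
    sum_mulMat_mulVec_mulMat, ← contract_apply, h4, ← Finset.sum_smul] at h1
  rw [Matrix.trace]
  simp only [diag_apply]
  linear_combination (norm := module) (1 : ℝ) • h1

theorem upsilonHat_one : upsilonHat n (1 : Matrix (Fin n) (Fin n) ℝ) =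
    (2 * (n + 2) : ℝ) • (1 : Matrix (Fin n) (Fin n) ℝ) := by
  rw [upsilonHat_eq]
  simp only [mul_one, h.sum_mulMat_sq]
  module

/-- Symmetric eigenvectors of `upsilonHat`. -/
theorem symm_upsilonHat {W : Matrix (Fin n) (Fin n) ℝ} (hW : Wᵀ = W) {r : ℝ}
    (h0 : upsilonHat n W = r • W) (hr : r / 2 + (n + 2) / 2 - 2 ≠ 0) :
    (r / 2 - n - 2) * W.trace = 0 ∧
      (r / 2 - 2) • W = W.trace • (1 : Matrix (Fin n) (Fin n) ℝ) := by
  have h1 := h.upsilonHat_add_transpose W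
  rw [hW, h0] at h1
  have h2 := congrArg Matrix.trace h1
  simp only [trace_add, trace_smul, h.trace_mulMat, trace_one, Fintype.card_fin, smul_eq_mul] at h2
  have h3 := congrArg contract h1
  simp only [map_add, map_smul, h.contract_one, h.contract_mulMat] at h3
  have h4 : (r / 2 + (n + 2) / 2 - 2) • contract W = 0 := by
    linear_combination (norm := module) (1 : ℝ) • h3
  have h5 := (smul_eq_zero.1 h4).resolve_left hr
  rw [h5, map_zero] at h1
  refine ⟨by linarith, ?_⟩
  linear_combination (norm := module) (1 : ℝ) • h1

end CartanCubic

theorem upsilonHat_parts {W : Matrix (Fin n) (Fin n) ℝ} {r : ℝ} (h0 : upsilonHat n W = r • W) :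
    upsilonHat n (W + Wᵀ) = r • (W + Wᵀ) ∧ upsilonHat n (W - Wᵀ) = r • (W - Wᵀ) := by
  have h1 := upsilonHat_transpose W
  rw [h0, transpose_smul] at h1
  constructor
  · rw [map_add, h0, ← h1, smul_add]
  · rw [map_sub, h0, ← h1, smul_sub]

/-- Here 28 = n + 2. Contraction and trace exclude this eigenvalue on symmetric matrices, and
`sum_trace_defect` identifies the skew ones. -/
theorem eigenspace_eq_stabLie (h : CartanCubic 26) :
    Module.End.eigenspace (upsilonHat 26) 28 = stabLie 26 := by
  ext W
  rw [Module.End.mem_eigenspace_iff]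
  constructor
  · intro h0
    obtain ⟨h1, h2⟩ := upsilonHat_parts h0
    have h3 := h.symm_upsilonHat (by rw [transpose_add, transpose_transpose, add_comm]) h1
      (by norm_num)
    have h4 : (W + Wᵀ).trace = 0 := by
      have := h3.1
      norm_num at this
      simpa using this
    have h5 := h3.2
    rw [h4, zero_smul] at h5
    have h6 : W + Wᵀ = 0 := (smul_eq_zero.1 h5).resolve_left (by norm_num)
    have h7 : Wᵀ = -W := (neg_eq_of_add_eq_zero_right h6).symm
    exact h.mem_stabLie_of_upsilonHat h7 (by rw [h0]; norm_num)
  · intro hW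
    rw [h.upsilonHat_of_mem hW]
    norm_num

/-- Here 20 = 2(n + 2) is the eigenvalue of the identity, the only symmetric eigenvector up to
scale; it exceeds n + 2 = 10, so no skew matrix can occur. -/
theorem eigenspace_eq_span_one (h : CartanCubic 8) :
    Module.End.eigenspace (upsilonHat 8) 20 = Submodule.span ℝ {1} := by
  ext W
  rw [Module.End.mem_eigenspace_iff, Submodule.mem_span_singleton]
  constructor
  · intro h0
    obtain ⟨h1, h2⟩ := upsilonHat_parts h0
    have h3 := (h.symm_upsilonHat (by rw [transpose_add, transpose_transpose, add_comm]) h1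
      (by norm_num)).2
    have h4 := h.eq_zero_of_upsilonHat (by rw [transpose_sub, transpose_transpose, neg_sub]) h2
      (by norm_num)
    refine ⟨(W + Wᵀ).trace / 16, ?_⟩
    rw [sub_eq_zero] at h4
    rw [← h4] at h3 ⊢
    linear_combination (norm := module) -(1 / 16 : ℝ) • h3
  · rintro ⟨t, rfl⟩
    rw [map_smul, h.upsilonHat_one]
    module
end
end

/-! ### The projection of skew matrices to `stabLie` and the dimension of `stabLie`. -/

noncomputable section

section

variable {n : ℕ}

theorem upsilonHat_vecMulVec (u v : Fin n → ℝ) :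
    upsilonHat n (vecMulVec u v) = (4 : ℝ) • (mulMat u * mulMat v) := by
  rw [upsilonHat_eq]
  congr 1
  rw [← mulMat_transpose v, ← sum_vecMulVec]
  refine Finset.sum_congr rfl fun M _ => ?_
  rw [mul_vecMulVec, vecMulVec_mul, ← mulVec_transpose, mulMat_transpose,
    mulMat_mulVec_comm u, mulMat_mulVec_comm v]

namespace CartanCubic

variable (h : CartanCubic n)
include h

/-- The analogue of the inner derivations [L_u, L_v] of a Jordan algebra; the correction of rank two
compensates the right-hand sides of `cube_polar`, of which six instances combine. -/
theorem derivation_identity (u v x y : Fin n → ℝ) :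
    let D := fun z => (4 : ℝ) • (mulMat u *ᵥ (mulMat v *ᵥ z) - mulMat v *ᵥ (mulMat u *ᵥ z))
      + (8 : ℝ) • ((v ⬝ᵥ z) • u - (u ⬝ᵥ z) • v)
    D (mulMat x *ᵥ y) = mulMat (D x) *ᵥ y + mulMat x *ᵥ D y := by
  intro D
  have t1 : v ⬝ᵥ mulMat x *ᵥ y = (mulMat v *ᵥ x) ⬝ᵥ y := by
    rw [← mulMat_dotProduct, mulMat_mulVec_comm]
  have t2 : u ⬝ᵥ mulMat x *ᵥ y = (mulMat u *ᵥ x) ⬝ᵥ y := by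
    rw [← mulMat_dotProduct, mulMat_mulVec_comm]
  have c1 := h.cube_polar (mulMat u *ᵥ x) v y
  have c2 := h.cube_polar (mulMat u *ᵥ y) v x
  have c3 := h.cube_polar (mulMat v *ᵥ x) u y
  have c4 := h.cube_polar (mulMat v *ᵥ y) u x
  have c5 := congrArg (fun z => mulMat u *ᵥ z) (h.cube_polar v x y)
  have c6 := congrArg (fun z => mulMat v *ᵥ z) (h.cube_polar u x y)
  have n1 : ∀ a b, mulMat (mulMat a *ᵥ b) *ᵥ u = mulMat u *ᵥ (mulMat a *ᵥ b) :=
    fun a b => mulMat_mulVec_comm _ _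
  have n2 : ∀ a b, mulMat (mulMat a *ᵥ b) *ᵥ v = mulMat v *ᵥ (mulMat a *ᵥ b) :=
    fun a b => mulMat_mulVec_comm _ _
  have n3 : ∀ a b, mulMat (mulMat a *ᵥ b) *ᵥ x = mulMat x *ᵥ (mulMat a *ᵥ b) :=
    fun a b => mulMat_mulVec_comm _ _
  have n4 : ∀ a b, mulMat (mulMat a *ᵥ b) *ᵥ y = mulMat y *ᵥ (mulMat a *ᵥ b) :=
    fun a b => mulMat_mulVec_comm _ _
  have n5 := mulMat_mulVec_comm (mulMat v *ᵥ y) (mulMat u *ᵥ x)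
  have n6 := mulMat_mulVec_comm (mulMat v *ᵥ x) (mulMat u *ᵥ y)
  have q1 : mulMat u *ᵥ x ⬝ᵥ v = mulMat v *ᵥ x ⬝ᵥ u := mulMat_dotProduct_swap _ _ _
  have q2 : mulMat u *ᵥ y ⬝ᵥ v = mulMat v *ᵥ y ⬝ᵥ u := mulMat_dotProduct_swap _ _ _
  have q3 : mulMat v *ᵥ y ⬝ᵥ x = mulMat v *ᵥ x ⬝ᵥ y := by
    rw [mulMat_dotProduct, dotProduct_comm]
  have q4 : mulMat u *ᵥ y ⬝ᵥ x = mulMat u *ᵥ x ⬝ᵥ y := by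
    rw [mulMat_dotProduct, dotProduct_comm]
  simp only [D, t1, t2, map_add, map_sub, map_smul, add_mulVec, sub_mulVec, smul_mulVec,
    mulVec_add, mulVec_sub, mulVec_smul, n1, n2, n3, n4, n5, n6, mulMat_mulVec_comm x u,
    mulMat_mulVec_comm x v, mulMat_mulVec_comm v u, q1, q2, q3, q4] at *
  linear_combination (norm := module) (4 : ℝ) • (c1 + c2 - c3 - c4 + c5 - c6)

theorem wedge_mem_stabLie (u v : Fin n → ℝ) :
    upsilonHat n (vecMulVec u v - vecMulVec v u) +
      (8 : ℝ) • (vecMulVec u v - vecMulVec v u) ∈ stabLie n := by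
  rw [map_sub, upsilonHat_vecMulVec, upsilonHat_vecMulVec, mem_stabLie_iff]
  constructor
  · simp only [transpose_add, transpose_sub, transpose_smul, transpose_mul, mulMat_transpose,
      transpose_vecMulVec]
    module
  · refine fun x => eq_of_mulVec fun y => ?_
    have e : ∀ z, ((4 : ℝ) • (mulMat u * mulMat v) - (4 : ℝ) • (mulMat v * mulMat u)
        + (8 : ℝ) • (vecMulVec u v - vecMulVec v u)) *ᵥ z =
        (4 : ℝ) • (mulMat u *ᵥ (mulMat v *ᵥ z) - mulMat v *ᵥ (mulMat u *ᵥ z))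
      + (8 : ℝ) • ((v ⬝ᵥ z) • u - (u ⬝ᵥ z) • v) := by
      intro z
      simp only [add_mulVec, sub_mulVec, smul_mulVec, ← mulVec_mulVec, vecMulVec_mulVec,
        op_smul_eq_smul]
      module
    rw [← mulVec_mulVec, e, e, add_mulVec _ _ y, ← mulVec_mulVec, e]
    exact h.derivation_identity u v x y

/-- Skew matrices are sums of u ∧ v, on which Υ̂ + 8 gives the derivation of `derivation_identity`.
Consequently Υ̂ has only the eigenvalues n + 2 and -8 on skew matrices. -/
theorem upsilonHat_add_mem {W : Matrix (Fin n) (Fin n) ℝ} (hW : Wᵀ = -W) :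
    upsilonHat n W + (8 : ℝ) • W ∈ stabLie n := by
  have h1 : W = (1 / 2 : ℝ) • ∑ M, (vecMulVec (W *ᵥ stdVec M) (stdVec M)
      - vecMulVec (stdVec M) (W *ᵥ stdVec M)) := by
    have h2 := sum_vecMulVec W 1
    have h3 := sum_vecMulVec 1 W
    simp only [one_mulVec, transpose_one, mul_one, one_mul] at h2 h3
    rw [Finset.sum_sub_distrib, h2, h3, hW]
    module
  have h4 : upsilonHat n W + (8 : ℝ) • W = (1 / 2 : ℝ) • ∑ M,
      (upsilonHat n (vecMulVec (W *ᵥ stdVec M) (stdVec M)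
        - vecMulVec (stdVec M) (W *ᵥ stdVec M)) + (8 : ℝ) •
      (vecMulVec (W *ᵥ stdVec M) (stdVec M) - vecMulVec (stdVec M) (W *ᵥ stdVec M))) := by
    conv_lhs => rw [h1]
    rw [map_smul, map_sum, Finset.sum_add_distrib, ← Finset.smul_sum]
    module
  rw [h4]
  exact Submodule.smul_mem _ _ (Submodule.sum_mem _ fun M _ => h.wedge_mem_stabLie _ _)

end CartanCubic

/-- The projection of matrices to their skew part. -/
def skewProj (n : ℕ) : Matrix (Fin n) (Fin n) ℝ →ₗ[ℝ] Matrix (Fin n) (Fin n) ℝ :=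
  (1 / 2 : ℝ) • (LinearMap.id - (transposeLinearEquiv (Fin n) (Fin n) ℝ ℝ).toLinearMap)

theorem skewProj_apply (W : Matrix (Fin n) (Fin n) ℝ) :
    skewProj n W = (1 / 2 : ℝ) • (W - Wᵀ) := rfl

theorem trace_endomorphism (f : Matrix (Fin n) (Fin n) ℝ →ₗ[ℝ] Matrix (Fin n) (Fin n) ℝ) :
    LinearMap.trace ℝ _ f = ∑ I, ∑ J, f (Matrix.single I J 1) I J := by
  rw [LinearMap.trace_eq_matrix_trace ℝ (Matrix.stdBasis ℝ (Fin n) (Fin n)), Matrix.trace,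
    Fintype.sum_prod_type]
  simp only [diag_apply, LinearMap.toMatrix_apply, Matrix.stdBasis_eq_single]
  rfl

/-- The dimension is the trace of the projection (Υ̂ + 8)/(n + 10) composed with the skew part,
evaluated on elementary matrices. -/
theorem CartanCubic.finrank_stabLie (h : CartanCubic n) :
    (n + 10 : ℝ) * Module.finrank ℝ (stabLie n) = 4 * (n ^ 2 - n) - n * (n + 2) := by
  have hn : (n + 10 : ℝ) ≠ 0 := by positivity
  set P : Matrix (Fin n) (Fin n) ℝ →ₗ[ℝ] Matrix (Fin n) (Fin n) ℝ :=
    (n + 10 : ℝ)⁻¹ • ((upsilonHat n + (8 : ℝ) • LinearMap.id) ∘ₗ skewProj n) with hP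
  have hproj : LinearMap.IsProj (stabLie n) P := by
    constructor
    · intro W
      refine Submodule.smul_mem _ _ (h.upsilonHat_add_mem ?_)
      rw [skewProj_apply, transpose_smul, transpose_sub, transpose_transpose]
      module
    · intro D hD
      have h1 := h.upsilonHat_of_mem hD
      have h2 : skewProj n D = D := by
        rw [skewProj_apply, (mem_stabLie_iff.1 hD).1]
        module
      rw [hP, LinearMap.smul_apply, LinearMap.comp_apply, h2, LinearMap.add_apply, h1,
        LinearMap.smul_apply, LinearMap.id_apply, ← add_smul, smul_smul]
      rw [show (n + 10 : ℝ)⁻¹ * (n + 2 + 8) = 1 by field_simp; ring, one_smul]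
  have h1 := hproj.trace
  rw [hP, map_smul, smul_eq_mul, inv_mul_eq_iff_eq_mul₀ hn, trace_endomorphism] at h1
  rw [← h1]
  have e1 : ∀ I J : Fin n, Matrix.single I J (1 : ℝ) = vecMulVec (stdVec I) (stdVec J) := by
    intro I J
    ext A B
    simp [vecMulVec_apply, stdVec, Matrix.single_apply, Pi.single_apply, eq_comm,
      ← ite_and, and_comm]
  have e2 : ∀ I J : Fin n, (((upsilonHat n + (8 : ℝ) • LinearMap.id) ∘ₗ skewProj n)
      (Matrix.single I J 1) : Matrix (Fin n) (Fin n) ℝ) I J = 2 * (mulMat (stdVec I) * mulMat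
          (stdVec J)) I J
      - 2 * (mulMat (stdVec J) * mulMat (stdVec I)) I J + 4 - 4 * (if I = J then 1 else 0) := by
    intro I J
    simp only [LinearMap.comp_apply, skewProj_apply, LinearMap.add_apply, LinearMap.smul_apply,
      LinearMap.id_apply, map_smul, e1, transpose_vecMulVec, map_sub, upsilonHat_vecMulVec,
      Matrix.add_apply, Matrix.smul_apply, Matrix.sub_apply, vecMulVec_apply, smul_eq_mul]
    by_cases hIJ : I = J
    · subst hIJ
      simp [stdVec]
    · simp only [stdVec, Pi.single_apply, hIJ, Ne.symm hIJ, if_true, if_false]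
      ring
  simp only [e2, Finset.sum_add_distrib, Finset.sum_sub_distrib, ← Finset.mul_sum]
  -- Regrouped by symmetry of Υ, this double sum is the squared norm of `∑ e∘e`, which is zero.
  have e3 : ∑ I : Fin n, ∑ J : Fin n, (mulMat (stdVec I) * mulMat (stdVec J)) I J = 0 := by
    have e : ∀ I J : Fin n, (mulMat (stdVec I) * mulMat (stdVec J)) I J =
        (mulMat (stdVec I) *ᵥ stdVec I) ⬝ᵥ (mulMat (stdVec J) *ᵥ stdVec J) := by
      intro I J
      rw [mul_apply, dotProduct]
      refine Finset.sum_congr rfl fun K _ => ?_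
      rw [mulVec_stdVec, mulVec_stdVec, mulMat_stdVec, mulMat_stdVec, mulMat_stdVec,
        upsilon_swap_left I K]
    simp only [e, ← dotProduct_sum, h.trace, dotProduct_zero, Finset.sum_const_zero]
  have e4 : ∑ I : Fin n, ∑ J : Fin n, (mulMat (stdVec J) * mulMat (stdVec I)) I J
      = (n + 2 : ℝ) / 2 * n := by
    have e : ∀ I : Fin n, ∑ J : Fin n, (mulMat (stdVec J) * mulMat (stdVec I)) I J =
        (n + 2 : ℝ) / 2 := by
      intro I
      have := h.trace_mulMat_mul (stdVec I) (stdVec I)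
      rw [show stdVec I ⬝ᵥ stdVec I = (1 : ℝ) by simp [stdVec], mul_one] at this
      rw [← this, Matrix.trace]
      refine Finset.sum_congr rfl fun J _ => ?_
      rw [diag_apply, mul_apply, mul_apply]
      refine Finset.sum_congr rfl fun K _ => ?_
      rw [mulMat_stdVec, mulMat_stdVec, mulMat_stdVec, upsilon_swap_left I K,
        upsilon_swap_right K I, upsilon_swap_left K J]
    simp only [e, Finset.sum_const, Finset.card_univ, Fintype.card_fin, nsmul_eq_mul]
    ring
  rw [e3, e4]
  simp
  ring

end
end

/-! ### Anticommutators of derivations with multiplications. -/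

noncomputable section

section

variable {n : ℕ}

/-- The tensor with slices `D U_x + U_x D`. -/
def anticomm (D : Matrix (Fin n) (Fin n) ℝ) : (Fin n → ℝ) →ₗ[ℝ] Matrix (Fin n) (Fin n) ℝ :=
  (LinearMap.mulLeft ℝ D + LinearMap.mulRight ℝ D) ∘ₗ mulMat

theorem anticomm_apply (D : Matrix (Fin n) (Fin n) ℝ) (x : Fin n → ℝ) :
    anticomm D x = D * mulMat x + mulMat x * D := rfl

theorem anticomm_transpose {D : Matrix (Fin n) (Fin n) ℝ} (hD : Dᵀ = -D) (x : Fin n → ℝ) :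
    (anticomm D x)ᵀ = - anticomm D x := by
  simp only [anticomm_apply, transpose_add, transpose_mul, mulMat_transpose, hD]
  noncomm_ring

/-- Since D(x∘x) = 2 x∘Dx, the two terms contribute 1 and 1/2. -/
theorem anticomm_mulVec_self {D : Matrix (Fin n) (Fin n) ℝ} (hD : D ∈ stabLie n)
    (x : Fin n → ℝ) : anticomm D x *ᵥ x = (3 / 2 : ℝ) • D *ᵥ (mulMat x *ᵥ x) := by
  have := stabLie_mulVec_self hD x
  rw [anticomm_apply, add_mulVec, ← mulVec_mulVec, ← mulVec_mulVec, this]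
  rw [show mulMat x *ᵥ (D *ᵥ x) = (1 / 2 : ℝ) • D *ᵥ (mulMat x *ᵥ x) by rw [this]; module]
  module

/-- The tensor `Υ̂(Γ) + 8 Γ` for `Γ = anticomm D`. -/
def anticommHat (D : Matrix (Fin n) (Fin n) ℝ) : (Fin n → ℝ) →ₗ[ℝ] Matrix (Fin n) (Fin n) ℝ :=
  (upsilonHat n + (8 : ℝ) • LinearMap.id) ∘ₗ anticomm D

theorem anticommHat_apply (D : Matrix (Fin n) (Fin n) ℝ) (x : Fin n → ℝ) :
    anticommHat D x = upsilonHat n (anticomm D x) + (8 : ℝ) • anticomm D x := rfl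

namespace CartanCubic

variable (h : CartanCubic n)
include h

theorem anticommHat_mem {D : Matrix (Fin n) (Fin n) ℝ} (hD : D ∈ stabLie n)
    (x : Fin n → ℝ) : anticommHat D x ∈ stabLie n :=
  h.upsilonHat_add_mem (anticomm_transpose (mem_stabLie_iff.1 hD).1 x)

theorem contract_mul_mulMat {D : Matrix (Fin n) (Fin n) ℝ} (hD : D ∈ stabLie n)
    (x : Fin n → ℝ) : contract (D * mulMat x) = ((n + 2 : ℝ) / 4) • D *ᵥ x := by
  rw [mem_stabLie_iff] at hD
  have h1 := contract_transpose (mulMat x * D)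
  rw [transpose_mul, mulMat_transpose, hD.1, neg_mul, map_neg] at h1
  have h2 := congrArg contract (hD.2 x)
  rw [map_add, h.contract_mulMat, ← h1] at h2
  linear_combination (norm := module) (1 / 2 : ℝ) • h2

/-- As U_M x = U_x e_M, the left side is 4 times the contraction of (D U_x + U_x D) U_x. The part
U_x D U_x is skew and contracts to zero; in D U_x² the square is replaced by means of `mulMat_mul`.
-/
theorem upsilonHat_anticomm_mulVec {D : Matrix (Fin n) (Fin n) ℝ} (hD : D ∈ stabLie n)
    (x : Fin n → ℝ) : upsilonHat n (anticomm D x) *ᵥ x =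
      (2 - (n + 2) / 2 : ℝ) • D *ᵥ (mulMat x *ᵥ x) := by
  have hDs := (mem_stabLie_iff.1 hD).1
  have h1 : upsilonHat n (anticomm D x) *ᵥ x =
      (4 : ℝ) • contract (anticomm D x * mulMat x) := by
    rw [upsilonHat_eq, smul_mulVec, sum_mulVec, contract_apply]
    congr 1
    refine Finset.sum_congr rfl fun M _ => ?_
    rw [← mulVec_mulVec, ← mulVec_mulVec, mulMat_mulVec_comm (stdVec M) x, mulVec_mulVec (stdVec M)]
  have h2 : mulMat x * mulMat x = (1 / 2 : ℝ) • ((x ⬝ᵥ x) • (1 : Matrix (Fin n) (Fin n) ℝ)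
      + (2 : ℝ) • vecMulVec x x - mulMat (mulMat x *ᵥ x)) := by
    have := h.mulMat_mul x x
    linear_combination (norm := module) (1 / 2 : ℝ) • this
  have h3 : contract (mulMat x * D * mulMat x) = 0 := by
    refine contract_skew ?_
    rw [transpose_mul, transpose_mul, mulMat_transpose, hDs]
    noncomm_ring
  have h4 := stabLie_mulVec_self hD x
  have h5 : mulMat x *ᵥ (D *ᵥ x) = (1 / 2 : ℝ) • D *ᵥ (mulMat x *ᵥ x) := by
    rw [h4, smul_smul]
    norm_num
  rw [h1, anticomm_apply, add_mul, map_add, h3, Matrix.mul_assoc, h2, Matrix.mul_smul, mul_sub,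
      mul_add,
    Matrix.mul_smul, Matrix.mul_smul, mul_one, mul_vecMulVec]
  simp only [map_smul, map_sub, map_add, contract_skew hDs, contract_vecMulVec, h5,
    h.contract_mul_mulMat hD]
  module

/-- The coefficient is 2 - (n + 2)/2 + 8 · 3/2. It vanishes exactly for n = 26, which is the source
of the additional summand. -/
theorem anticommHat_mulVec_self {D : Matrix (Fin n) (Fin n) ℝ} (hD : D ∈ stabLie n)
    (x : Fin n → ℝ) : anticommHat D x *ᵥ x =
      (14 - (n + 2) / 2 : ℝ) • D *ᵥ (mulMat x *ᵥ x) := by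
  rw [anticommHat_apply, add_mulVec, h.upsilonHat_anticomm_mulVec hD, smul_mulVec,
    anticomm_mulVec_self hD]
  module

/-- Squares span: by polarisation all products are killed, and `sum_mulMat_sq` writes every vector
as a combination of products. -/
theorem eq_zero_of_mulVec_square {D : Matrix (Fin n) (Fin n) ℝ}
    (h0 : ∀ x, D *ᵥ (mulMat x *ᵥ x) = 0) : D = 0 := by
  have h1 : ∀ x y, D *ᵥ (mulMat x *ᵥ y) = 0 := by
    intro x y
    have := h0 (x + y)
    simp only [map_add, add_mulVec, mulVec_add, h0, mulMat_mulVec_comm y x, zero_add,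
      add_zero] at this
    rw [← two_smul ℝ] at this
    exact (smul_eq_zero.1 this).resolve_left (by norm_num)
  refine eq_of_mulVec fun x => ?_
  have h2 := congrArg (fun A => D *ᵥ (A *ᵥ x)) h.sum_mulMat_sq
  simp only [sum_mulVec, smul_mulVec, one_mulVec, mulVec_sum, mulVec_smul, ← mulVec_mulVec, h1,
    Finset.sum_const_zero] at h2
  rw [zero_mulVec]
  exact (smul_eq_zero.1 h2.symm).resolve_left (by positivity)

end CartanCubic

/-! ### Tensors -/

/-- The tensor with slices `Γ_x`. -/
def toTensor (Γ : (Fin n → ℝ) →ₗ[ℝ] Matrix (Fin n) (Fin n) ℝ) : Fin n → Fin n → Fin n → ℝ :=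
  fun M J I => Γ (stdVec I) M J

/-- The slice `Γ_x` of a tensor. -/
def slice (Γ : Fin n → Fin n → Fin n → ℝ) : (Fin n → ℝ) →ₗ[ℝ] Matrix (Fin n) (Fin n) ℝ where
  toFun x := Matrix.of fun M J => ∑ I, Γ M J I * x I
  map_add' x y := by
    ext I J
    simp [mul_add, Finset.sum_add_distrib]
  map_smul' c x := by
    ext I J
    simp only [of_apply, Pi.smul_apply, smul_eq_mul, Matrix.smul_apply, RingHom.id_apply,
      Finset.mul_sum]
    exact Finset.sum_congr rfl fun K _ => by ring

theorem slice_apply (Γ : Fin n → Fin n → Fin n → ℝ) (x : Fin n → ℝ) (M J : Fin n) :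
    slice Γ x M J = ∑ I, Γ M J I * x I := rfl

theorem slice_stdVec (Γ : Fin n → Fin n → Fin n → ℝ) (I M J : Fin n) :
    slice Γ (stdVec I) M J = Γ M J I := by
  simp [slice_apply, stdVec, Pi.single_apply]

theorem linear_ext_stdVec {E : Type*} [AddCommGroup E] [Module ℝ E] {f g : (Fin n → ℝ) →ₗ[ℝ] E}
    (hfg : ∀ I, f (stdVec I) = g (stdVec I)) : f = g := by
  refine LinearMap.ext fun x => ?_
  rw [vec_eq_sum x]
  simp only [map_sum, map_smul, hfg]

theorem slice_toTensor (Γ : (Fin n → ℝ) →ₗ[ℝ] Matrix (Fin n) (Fin n) ℝ) :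
    slice (toTensor Γ) = Γ := by
  refine linear_ext_stdVec fun I => ?_
  ext M J
  rw [slice_stdVec, toTensor]

theorem toTensor_slice (Γ : Fin n → Fin n → Fin n → ℝ) : toTensor (slice Γ) = Γ := by
  funext M J I
  rw [toTensor, slice_stdVec]

theorem slice_add (Γ Δ : Fin n → Fin n → Fin n → ℝ) (x : Fin n → ℝ) :
    slice (Γ + Δ) x = slice Γ x + slice Δ x := by
  ext M J
  simp [slice_apply, add_mul, Finset.sum_add_distrib]

theorem slice_smul (c : ℝ) (Γ : Fin n → Fin n → Fin n → ℝ) (x : Fin n → ℝ) :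
    slice (c • Γ) x = c • slice Γ x := by
  ext M J
  simp [slice_apply, Finset.mul_sum, mul_assoc]

theorem mem_wedgeTwoTensor_iff {Γ : Fin n → Fin n → Fin n → ℝ} :
    Γ ∈ wedgeTwoTensor n ↔ ∀ x, (slice Γ x)ᵀ = - slice Γ x := by
  constructor
  · intro h x
    ext M J
    simp only [transpose_apply, slice_apply, Matrix.neg_apply, ← Finset.sum_neg_distrib]
    exact Finset.sum_congr rfl fun I _ => by rw [h J M I, neg_mul]
  · intro h M J I
    have := congrFun (congrFun (h (stdVec I)) J) M
    rwa [transpose_apply, Matrix.neg_apply, slice_stdVec, slice_stdVec] at this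

theorem mem_stabLieTensor_iff {Γ : wedgeTwoTensor n} :
    Γ ∈ stabLieTensor n ↔ ∀ x, slice Γ.1 x ∈ stabLie n := by
  constructor
  · intro h x
    have : slice Γ.1 x = ∑ I, x I • (Matrix.of fun M J => Γ.1 M J I) := by
      ext M J
      simp [slice_apply, Matrix.sum_apply, mul_comm]
    rw [this]
    exact Submodule.sum_mem _ fun I _ => Submodule.smul_mem _ _ (h I)
  · intro h I
    have := h (stdVec I)
    convert this using 1
    ext M J
    rw [slice_stdVec, of_apply]

theorem slice_mulVec (Γ : Fin n → Fin n → Fin n → ℝ) (x y : Fin n → ℝ) (M : Fin n) :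
    (slice Γ x *ᵥ y) M = ∑ J, ∑ I, Γ M J I * x I * y J := by
  simp only [mulVec, dotProduct, slice_apply, Finset.sum_mul]

theorem mem_wedgeThree_iff {Γ : wedgeTwoTensor n} :
    Γ ∈ wedgeThree n ↔ ∀ x, slice Γ.1 x *ᵥ x = 0 := by
  constructor
  · intro h x
    ext M
    rw [slice_mulVec, Pi.zero_apply]
    have h1 : ∑ J, ∑ I, Γ.1 M J I * x I * x J = - ∑ J, ∑ I, Γ.1 M J I * x I * x J := by
      conv_lhs => rw [Finset.sum_comm]
      rw [← Finset.sum_neg_distrib]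
      refine Finset.sum_congr rfl fun J _ => ?_
      rw [← Finset.sum_neg_distrib]
      refine Finset.sum_congr rfl fun I _ => ?_
      rw [h M I J]
      ring
    linarith
  · intro h M J I
    have h1 := congrFun (h (stdVec I + stdVec J)) M
    have h2 := congrFun (h (stdVec I)) M
    have h3 := congrFun (h (stdVec J)) M
    simp only [map_add, add_mulVec, mulVec_add, Pi.add_apply, mulVec_stdVec, slice_stdVec,
      Pi.zero_apply] at h1 h2 h3
    linarith

/-- The symmetrized slices `Γ_x y + Γ_y x`. -/
def symSlice (Γ : Fin n → Fin n → Fin n → ℝ) (x y : Fin n → ℝ) : Fin n → ℝ :=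
  slice Γ x *ᵥ y + slice Γ y *ᵥ x

/-- The polarization of `⟨Γ_x x, x ∘ x⟩`. -/
def quarticForm (Γ : Fin n → Fin n → Fin n → ℝ) (x y z w : Fin n → ℝ) : ℝ :=
  symSlice Γ x y ⬝ᵥ (mulMat z *ᵥ w) + symSlice Γ x z ⬝ᵥ (mulMat y *ᵥ w)
    + symSlice Γ x w ⬝ᵥ (mulMat y *ᵥ z) + symSlice Γ y z ⬝ᵥ (mulMat x *ᵥ w)
    + symSlice Γ y w ⬝ᵥ (mulMat x *ᵥ z) + symSlice Γ z w ⬝ᵥ (mulMat x *ᵥ y)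

theorem symSlice_comm (Γ : Fin n → Fin n → Fin n → ℝ) (x y : Fin n → ℝ) :
    symSlice Γ x y = symSlice Γ y x := add_comm _ _

theorem quarticForm_swap (Γ : Fin n → Fin n → Fin n → ℝ) (x y z w : Fin n → ℝ) :
    quarticForm Γ x y z w = quarticForm Γ y z w x := by
  simp only [quarticForm, symSlice_comm Γ y x, symSlice_comm Γ z x, symSlice_comm Γ w x,
    mulMat_mulVec_comm w x, mulMat_mulVec_comm z x, mulMat_mulVec_comm y x]
  ring

theorem quarticForm_eq_zero_of_stdVec {Γ : Fin n → Fin n → Fin n → ℝ}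
    (h : ∀ I J K L, quarticForm Γ (stdVec I) (stdVec J) (stdVec K) (stdVec L) = 0)
    (x y z w : Fin n → ℝ) : quarticForm Γ x y z w = 0 := by
  have hlin : ∀ y z w, (∀ I, quarticForm Γ (stdVec I) y z w = 0) →
      ∀ x, quarticForm Γ x y z w = 0 := by
    intro y z w h0 x
    let f : (Fin n → ℝ) →ₗ[ℝ] ℝ :=
      { toFun := fun x => quarticForm Γ x y z w
        map_add' := fun a b => by
          simp only [quarticForm, symSlice, map_add, add_mulVec, mulVec_add, add_dotProduct,
            dotProduct_add]
          ring
        map_smul' := fun c a => by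
          simp only [quarticForm, symSlice, map_smul, smul_mulVec, mulVec_smul, ← smul_add,
            smul_dotProduct, dotProduct_smul, smul_eq_mul, RingHom.id_apply]
          ring }
    have : f = 0 := linear_ext_stdVec fun I => h0 I
    exact congrArg (fun g => g x) this
  refine hlin _ _ _ (fun I => ?_) x
  rw [quarticForm_swap]
  refine hlin _ _ _ (fun J => ?_) y
  rw [quarticForm_swap]
  refine hlin _ _ _ (fun K => ?_) z
  rw [quarticForm_swap]
  refine hlin _ _ _ (fun L => ?_) w
  exact h _ _ _ _

/-- The twelve terms are the six pairs of indices, each in two orders. -/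
theorem upsilonPrimeFun_eq (Γ : Fin n → Fin n → Fin n → ℝ) (I J K L : Fin n) :
    upsilonPrimeFun n Γ I J K L = quarticForm Γ (stdVec I) (stdVec J) (stdVec K) (stdVec L) := by
  simp only [quarticForm, dotProduct, symSlice, Pi.add_apply, mulVec_stdVec, slice_stdVec,
    mulMat_stdVec, upsilonPrimeFun, ← Finset.sum_add_distrib]
  refine Finset.sum_congr rfl fun M _ => ?_
  have l1 : ∀ A B M : Fin n, upsilon n A M B = upsilon n M A B := fun A B M =>
    upsilon_swap_left A M B
  have l2 : ∀ A B M : Fin n, upsilon n A B M = upsilon n M A B := fun A B M => by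
    rw [upsilon_swap_right A B M, l1]
  rw [l1 J L M, l2 J K M, l1 I L M, l2 I K M, l2 I J M, l1 I K M, upsilon_swap_right M L K,
    upsilon_swap_right M L J, upsilon_swap_right M K J, upsilon_swap_right M L I,
    upsilon_swap_right M K I, upsilon_swap_right M J I]
  ring

theorem quarticForm_of_diag {Γ : Fin n → Fin n → Fin n → ℝ}
    (h : ∀ x, (slice Γ x *ᵥ x) ⬝ᵥ (mulMat x *ᵥ x) = 0) (x y z w : Fin n → ℝ) :
    quarticForm Γ x y z w = 0 := by
  have key : ∀ x y, symSlice Γ x y ⬝ᵥ (mulMat x *ᵥ x) +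
      symSlice Γ x x ⬝ᵥ (mulMat x *ᵥ y) = 0 := by
    intro x y
    have h1 := h (x + y)
    have h2 := h (x - y)
    have h3 := h (x + (2 : ℝ) • y)
    have h4 := h (x - (2 : ℝ) • y)
    simp only [map_add, map_sub, map_smul, add_mulVec, sub_mulVec, smul_mulVec, mulVec_add,
      mulVec_sub, mulVec_smul, mulMat_mulVec_comm y x, add_dotProduct, sub_dotProduct,
      dotProduct_add, dotProduct_sub, dotProduct_smul, smul_dotProduct, smul_eq_mul]
      at h1 h2 h3 h4
    simp only [symSlice, add_dotProduct]
    -- The same interpolation at ±y and ±2y extracts the coefficient linear in y of a quartic.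
    linear_combination (2 / 3 : ℝ) * (h1 - h2) - (1 / 12 : ℝ) * (h3 - h4)
  have h1 := key (x + y + z) w
  have h2 := key (x + y) w
  have h3 := key (x + z) w
  have h4 := key (y + z) w
  have h5 := key x w
  have h6 := key y w
  have h7 := key z w
  simp only [symSlice, map_add, add_mulVec, mulVec_add, add_dotProduct, dotProduct_add,
    mulMat_mulVec_comm y x, mulMat_mulVec_comm z x, mulMat_mulVec_comm z y] at h1 h2 h3 h4 h5 h6 h7
  simp only [quarticForm, symSlice, add_dotProduct]
  linear_combination (1 / 2 : ℝ) * (h1 - h2 - h3 - h4 + h5 + h6 + h7)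

/-- A symmetric tensor vanishes exactly when it vanishes on the diagonal, and the diagonal of Υ'(Γ)
is a multiple of this quartic. -/
theorem mem_ker_upsilonPrime_iff {Γ : wedgeTwoTensor n} :
    Γ ∈ LinearMap.ker (upsilonPrime n) ↔
      ∀ x, (slice Γ.1 x *ᵥ x) ⬝ᵥ (mulMat x *ᵥ x) = 0 := by
  have hk : Γ ∈ LinearMap.ker (upsilonPrime n) ↔ ∀ I J K L, upsilonPrimeFun n Γ I J K L = 0 := by
    rw [LinearMap.mem_ker]
    constructor
    · intro h I J K L
      exact congrArg (fun T : symFour n => T.1 I J K L) h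
    · intro h
      ext I J K L
      exact h I J K L
  rw [hk]
  constructor
  · intro h x
    have h1 := quarticForm_eq_zero_of_stdVec (Γ := Γ.1) (fun I J K L => by
      rw [← upsilonPrimeFun_eq, h]) x x x x
    simp only [quarticForm, symSlice, add_dotProduct] at h1
    linarith
  · intro h I J K L
    rw [upsilonPrimeFun_eq]
    exact quarticForm_of_diag h _ _ _ _

end
end

/-! ### Transfer between ℝⁿ and hermitian matrices. -/

noncomputable section

open Herm SymComp

variable {K : Type*} [NormedAddCommGroup K] [InnerProductSpace ℝ K] {m : SymComp K} {n k : ℕ}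

/-- An identification of `ℝⁿ` with the trace-free hermitian matrices carrying the cubic form to
the determinant. -/
structure HermModel (n : ℕ) (m : SymComp K) where
  toHerm : (Fin n → ℝ) →ₗ[ℝ] Herm K
  tr_toHerm : ∀ x, tr (toHerm x) = 0
  form_self : ∀ x, form (toHerm x) (toHerm x) = 6 * (x ⬝ᵥ x)
  det_self : ∀ x, form (m.cross (toHerm x) (toHerm x)) (toHerm x) = 6 * ((mulMat x *ᵥ x) ⬝ᵥ x)
  surj : ∀ z, tr z = 0 → ∃ x, toHerm x = z

theorem SymComp.cross_one (x : Herm K) :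
    m.cross x Herm.one = (1 / 2 : ℝ) • (tr x • Herm.one - x) := by
  refine Prod.ext (funext fun j => ?_) (funext fun j => ?_)
  · rw [cross_fst, tr_eq_cycle j]
    simp [Herm.one]
    ring
  · rw [cross_snd]
    simp [Herm.one]

theorem SymComp.tr_cross_self (x : Herm K) :
    tr (m.cross x x) = 1 / 2 * (tr x ^ 2 - form x x) := by
  simp only [tr_apply, form_apply, Fin.sum_univ_three, cross_fst]
  have f1 : (1 + 1 : Fin 3) = 2 := rfl
  have f2 : (1 + 2 : Fin 3) = 0 := rfl
  have f3 : (2 + 1 : Fin 3) = 0 := rfl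
  have f4 : (2 + 2 : Fin 3) = 1 := rfl
  simp only [zero_add, f1, f2, f3, f4]
  ring

/-- The composition law |x y| = |x| |y| is used here; on ℝⁿ this becomes the identity |x∘x|² = |x|⁴.
-/
theorem SymComp.form_cross_self {x : Herm K} (hx : tr x = 0) :
    form (m.cross x x) (m.cross x x) = 1 / 4 * form x x ^ 2 := by
  have f1 : (1 + 1 : Fin 3) = 2 := rfl
  have f2 : (1 + 2 : Fin 3) = 0 := rfl
  have f3 : (2 + 1 : Fin 3) = 0 := rfl
  have f4 : (2 + 2 : Fin 3) = 1 := rfl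
  have h1 : ∀ i : Fin 3, (m.cross x x).2 i = m.mul (x.2 (i + 1)) (x.2 (i + 2)) - x.1 i • x.2 i := by
    intro i
    rw [cross_snd]
    module
  have hc : ∀ u v w : K, inner ℝ (m.mul u v) w = inner ℝ (m.mul v w) u :=
    fun u v w => by rw [m.inner_mul, real_inner_comm]
  rw [tr_apply] at hx
  simp only [form_apply, Fin.sum_univ_three, cross_fst, h1, inner_sub_left, inner_sub_right,
    real_inner_smul_left, real_inner_smul_right, m.inner_mul_mul_left, zero_add, f1, f2, f3, f4]
  have g1 : inner ℝ (x.2 1) (m.mul (x.2 2) (x.2 0)) = inner ℝ (x.2 0) (m.mul (x.2 1) (x.2 2)) := by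
    rw [real_inner_comm, ← hc, real_inner_comm]
  have g2 : inner ℝ (x.2 2) (m.mul (x.2 0) (x.2 1)) = inner ℝ (x.2 0) (m.mul (x.2 1) (x.2 2)) := by
    rw [real_inner_comm, hc, real_inner_comm]
  have g3 : ∀ u v w : K, inner ℝ (m.mul u v) w = inner ℝ w (m.mul u v) :=
    fun u v w => real_inner_comm _ _
  simp only [g3, g1, g2]
  have : x.1 2 = - x.1 0 - x.1 1 := by linarith
  rw [this]
  ring

namespace HermModel

variable (H : HermModel n m)

theorem form_toHerm (x y : Fin n → ℝ) : form (H.toHerm x) (H.toHerm y) = 6 * (x ⬝ᵥ y) := by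
  have h := H.form_self (x + y)
  simp only [map_add, LinearMap.add_apply, H.form_self, form_comm (H.toHerm y), add_dotProduct,
    dotProduct_add, dotProduct_comm y x] at h
  linarith

/-- The left inverse of the identification. -/
def ofHerm : Herm K →ₗ[ℝ] (Fin n → ℝ) where
  toFun z := fun M => 1 / 6 * form z (H.toHerm (stdVec M))
  map_add' z w := by
    ext M
    simp [mul_add]
  map_smul' c z := by
    ext M
    simp
    ring

theorem ofHerm_dotProduct (z : Herm K) (x : Fin n → ℝ) :
    6 * (H.ofHerm z ⬝ᵥ x) = form z (H.toHerm x) := by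
  conv_rhs => rw [vec_eq_sum x]
  simp only [map_sum, map_smul, smul_eq_mul, dotProduct, Finset.mul_sum]
  refine Finset.sum_congr rfl fun M _ => ?_
  simp only [ofHerm, LinearMap.coe_mk, AddHom.coe_mk]
  ring

theorem ofHerm_toHerm (x : Fin n → ℝ) : H.ofHerm (H.toHerm x) = x := by
  refine dotProduct_eq _ _ fun y => ?_
  have := H.ofHerm_dotProduct (H.toHerm x) y
  rw [form_toHerm] at this
  linarith

theorem toHerm_ofHerm_of_tr {z : Herm K} (hz : tr z = 0) : H.toHerm (H.ofHerm z) = z := by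
  obtain ⟨x, rfl⟩ := H.surj z hz
  rw [ofHerm_toHerm]

theorem ofHerm_one : H.ofHerm Herm.one = 0 := by
  refine dotProduct_eq _ _ fun y => ?_
  have := H.ofHerm_dotProduct Herm.one y
  rw [form_comm, form_one, H.tr_toHerm] at this
  rw [zero_dotProduct]
  linarith

theorem tr_one : tr (Herm.one : Herm K) = 3 := by
  rw [tr_apply]
  norm_num [Herm.one]

theorem toHerm_ofHerm (z : Herm K) :
    H.toHerm (H.ofHerm z) = z - (tr z / 3) • Herm.one := by
  have h1 : tr (z - (tr z / 3) • Herm.one : Herm K) = 0 := by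
    rw [map_sub, map_smul, tr_one, smul_eq_mul]
    ring
  have h2 := H.toHerm_ofHerm_of_tr h1
  rwa [map_sub, map_smul, ofHerm_one, smul_zero, sub_zero] at h2

theorem eq_toHerm_add (z : Herm K) : z = H.toHerm (H.ofHerm z) + (tr z / 3) • Herm.one := by
  rw [toHerm_ofHerm, sub_add_cancel]

theorem form_cross_toHerm (x y z : Fin n → ℝ) :
    form (m.cross (H.toHerm x) (H.toHerm y)) (H.toHerm z) = 6 * ((mulMat x *ᵥ y) ⬝ᵥ z) := by
  have c : ∀ x y z, form (m.cross (H.toHerm x) (H.toHerm y)) (H.toHerm z) =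
      form (m.cross (H.toHerm x) (H.toHerm z)) (H.toHerm y) := fun x y z => by
    rw [m.cross_comm, form_cross, form_comm]
  have d : ∀ x y z : Fin n → ℝ, (mulMat x *ᵥ y) ⬝ᵥ z = (mulMat x *ᵥ z) ⬝ᵥ y := fun x y z => by
    rw [mulMat_dotProduct, dotProduct_comm]
  have h1 := H.det_self (x + y + z)
  have h2 := H.det_self (x + y)
  have h3 := H.det_self (x + z)
  have h4 := H.det_self (y + z)
  simp only [map_add, LinearMap.add_apply, H.det_self, add_mulVec, mulVec_add, add_dotProduct,
    dotProduct_add, m.cross_comm (H.toHerm y) (H.toHerm x), m.cross_comm (H.toHerm z) (H.toHerm x),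
    m.cross_comm (H.toHerm z) (H.toHerm y), mulMat_mulVec_comm y x, mulMat_mulVec_comm z x,
    mulMat_mulVec_comm z y] at h1 h2 h3 h4
  have e1 := c x y x
  have e2 := c x z x
  have e3 := c x y z
  have e4 := c y x y
  have e5 := c y z y
  have e6 := c y z x
  have e7 := c z x z
  have e8 := c z y z
  have g1 := d x y x
  have g2 := d x z x
  have g3 := d x y z
  have g4 := d y x y
  have g5 := d y z y
  have g6 := d y z x
  have g7 := d z x z
  have g8 := d z y z
  simp only [m.cross_comm (H.toHerm y) (H.toHerm x), m.cross_comm (H.toHerm z) (H.toHerm x),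
    m.cross_comm (H.toHerm z) (H.toHerm y), mulMat_mulVec_comm y x, mulMat_mulVec_comm z x,
    mulMat_mulVec_comm z y] at e1 e2 e3 e4 e5 e6 e7 e8 g1 g2 g3 g4 g5 g6 g7 g8
  linarith

/-- The adjoint of a trace-free matrix is not trace free: its trace is minus half the squared norm,
which fixes the multiple of the unit. The rest is determined by pairing with trace-free matrices. -/
theorem cross_toHerm (x y : Fin n → ℝ) : m.cross (H.toHerm x) (H.toHerm y) =
    H.toHerm (mulMat x *ᵥ y) - (x ⬝ᵥ y) • Herm.one := by
  have htr : tr (m.cross (H.toHerm x) (H.toHerm y)) = -3 * (x ⬝ᵥ y) := by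
    have h1 := SymComp.tr_cross_self (m := m) (H.toHerm (x + y))
    have h2 := SymComp.tr_cross_self (m := m) (H.toHerm x)
    have h3 := SymComp.tr_cross_self (m := m) (H.toHerm y)
    rw [H.tr_toHerm, H.form_self] at h1 h2 h3
    simp only [map_add, LinearMap.add_apply, m.cross_comm (H.toHerm y), add_dotProduct,
      dotProduct_add, dotProduct_comm y x] at h1
    linarith
  refine eq_of_form fun z => ?_
  rw [H.eq_toHerm_add z, map_add, map_smul, form_cross_toHerm, form_one, htr, map_sub,
    LinearMap.sub_apply, map_add, form_toHerm, map_smul, form_one, tr_toHerm, map_smul,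
    LinearMap.smul_apply, map_add, map_smul, form_one, tr_one, form_comm, form_one, tr_toHerm]
  simp only [smul_eq_mul]
  ring

theorem norm_square (H : HermModel n m) (x : Fin n → ℝ) :
    (mulMat x *ᵥ x) ⬝ᵥ (mulMat x *ᵥ x) = (x ⬝ᵥ x) ^ 2 := by
  have h1 := SymComp.form_cross_self (m := m) (H.tr_toHerm x)
  rw [cross_toHerm] at h1
  simp only [map_sub, LinearMap.sub_apply, map_smul, LinearMap.smul_apply, form_toHerm, form_one,
    form_comm Herm.one, tr_toHerm, tr_one, smul_eq_mul] at h1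
  linarith

theorem ofHerm_cross (z w : Herm K) : H.ofHerm (m.cross z w) = mulMat (H.ofHerm z) *ᵥ (H.ofHerm w)
    - (tr w / 6) • H.ofHerm z - (tr z / 6) • H.ofHerm w := by
  conv_lhs => rw [H.eq_toHerm_add z, H.eq_toHerm_add w]
  simp only [map_add, LinearMap.add_apply, map_smul, LinearMap.smul_apply, cross_toHerm,
    SymComp.cross_one, m.cross_comm Herm.one, map_sub, ofHerm_toHerm, ofHerm_one, tr_toHerm]
  module

theorem ofHerm_der_mem {D : Herm K →ₗ[ℝ] Herm K} (hD : D ∈ m.der) :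
    LinearMap.toMatrix' (H.ofHerm ∘ₗ D ∘ₗ H.toHerm) ∈ stabLie n := by
  set E := LinearMap.toMatrix' (H.ofHerm ∘ₗ D ∘ₗ H.toHerm) with hE
  have hEx : ∀ x, H.toHerm (E *ᵥ x) = D (H.toHerm x) := by
    intro x
    rw [hE, ← toLin'_apply, toLin'_toMatrix']
    exact H.toHerm_ofHerm_of_tr (hD.1 _)
  have hm : E ∈ stabLie n ↔ ExpMemStab n E := Iff.rfl
  rw [hm, expMemStab_iff]
  constructor
  · ext I J
    have h1 := hD.2.1 (H.toHerm (stdVec I)) (H.toHerm (stdVec J))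
    rw [← hEx, ← hEx, form_toHerm, form_toHerm] at h1
    have e : ∀ v : Fin n → ℝ, ∀ I, v ⬝ᵥ stdVec I = v I := fun v I => by simp [stdVec]
    rw [e, e, mulVec_stdVec, mulVec_stdVec] at h1
    rw [transpose_apply, Matrix.neg_apply]
    linarith
  · intro x y z
    have h1 := hD.2.2 (H.toHerm x) (H.toHerm y) (H.toHerm z)
    simp only [← hEx, cross_toHerm, map_sub, map_smul, form_toHerm, form_one, tr_toHerm,
      smul_zero, sub_zero] at h1
    have a1 := mulMat_dotProduct_swap (E *ᵥ x) y z
    have a2 := mulMat_dotProduct x (E *ᵥ y) z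
    rw [upsilonForm_eq, upsilonForm_eq, upsilonForm_eq, a1, a2, mulMat_mulVec_comm z y,
      dotProduct_comm (mulMat y *ᵥ z), mulMat_mulVec_comm x z,
      dotProduct_comm (mulMat x *ᵥ y) (E *ᵥ z)]
    linarith

theorem toMatrix_ofHerm_mulVec {D : Herm K →ₗ[ℝ] Herm K} (x : Fin n → ℝ) :
    LinearMap.toMatrix' (H.ofHerm ∘ₗ D ∘ₗ H.toHerm) *ᵥ x = H.ofHerm (D (H.toHerm x)) := by
  rw [← toLin'_apply, toLin'_toMatrix']
  rfl

/-- The endomorphism of hermitian matrices defined by an endomorphism of `ℝⁿ`. -/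
def lift (A : Matrix (Fin n) (Fin n) ℝ) : Herm K →ₗ[ℝ] Herm K :=
  H.toHerm ∘ₗ A.toLin' ∘ₗ H.ofHerm

theorem lift_apply (A : Matrix (Fin n) (Fin n) ℝ) (z : Herm K) :
    H.lift A z = H.toHerm (A *ᵥ H.ofHerm z) := rfl

theorem skew_dotProduct {D : Matrix (Fin n) (Fin n) ℝ} (hD : Dᵀ = -D) (x y : Fin n → ℝ) :
    (D *ᵥ x) ⬝ᵥ y = - (x ⬝ᵥ (D *ᵥ y)) := by
  rw [dotProduct_mulVec, ← mulVec_transpose, hD, neg_mulVec, neg_dotProduct, neg_neg]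

theorem skew_dotProduct_self {D : Matrix (Fin n) (Fin n) ℝ} (hD : Dᵀ = -D) (x : Fin n → ℝ) :
    (D *ᵥ x) ⬝ᵥ x = 0 := by
  have := skew_dotProduct hD x x
  rw [dotProduct_comm x] at this
  linarith

theorem stabLie_dotProduct_square {D : Matrix (Fin n) (Fin n) ℝ} (hD : D ∈ stabLie n)
    (x : Fin n → ℝ) : (D *ᵥ x) ⬝ᵥ (mulMat x *ᵥ x) = 0 := by
  have h1 := skew_dotProduct (mem_stabLie_iff.1 hD).1 x (mulMat x *ᵥ x)
  rw [stabLie_mulVec_self hD, dotProduct_smul, ← mulMat_dotProduct, smul_eq_mul,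
    dotProduct_comm x, mulMat_dotProduct] at h1
  linarith

theorem lift_mem_der {D : Matrix (Fin n) (Fin n) ℝ} (hD : D ∈ stabLie n) : H.lift D ∈ m.der := by
  have hs := (mem_stabLie_iff.1 hD).1
  refine m.mem_der_of (fun z => H.tr_toHerm _) (fun z => ?_) fun z => ?_
  · rw [lift_apply, form_comm, ← ofHerm_dotProduct, dotProduct_comm, skew_dotProduct_self hs,
      mul_zero]
  · rw [lift_apply, form_comm, ← ofHerm_dotProduct, dotProduct_comm, ofHerm_cross, dotProduct_sub,
      dotProduct_sub, dotProduct_smul, skew_dotProduct_self hs, stabLie_dotProduct_square hD]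
    simp

/-- A tensor in `𝔥 ⊗ ℝⁿ` with `Γ_x x = 0` defines a linear family of derivations. -/
def liftFamily (Γ : (Fin n → ℝ) →ₗ[ℝ] Matrix (Fin n) (Fin n) ℝ) :
    Herm K →ₗ[ℝ] Herm K →ₗ[ℝ] Herm K where
  toFun z := H.lift (Γ (H.ofHerm z))
  map_add' z w := by
    refine LinearMap.ext fun v => ?_
    simp [lift_apply, add_mulVec]
  map_smul' c z := by
    refine LinearMap.ext fun v => ?_
    simp [lift_apply, smul_mulVec]

theorem liftFamily_apply (Γ : (Fin n → ℝ) →ₗ[ℝ] Matrix (Fin n) (Fin n) ℝ) (z w : Herm K) :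
    H.liftFamily Γ z w = H.toHerm (Γ (H.ofHerm z) *ᵥ H.ofHerm w) := rfl

theorem eq_zero_of_liftFamily {Γ : (Fin n → ℝ) →ₗ[ℝ] Matrix (Fin n) (Fin n) ℝ}
    (h : H.liftFamily Γ = 0) : Γ = 0 := by
  refine LinearMap.ext fun x => eq_of_mulVec fun y => ?_
  have h1 := H.liftFamily_apply Γ (H.toHerm x) (H.toHerm y)
  rw [h, ofHerm_toHerm, ofHerm_toHerm] at h1
  have h2 := congrArg H.ofHerm h1
  rw [ofHerm_toHerm] at h2
  rw [← h2]
  simp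

theorem eq_zero_of_mulVec_self (H : HermModel n m) (e : OrthonormalBasis (Fin k) ℝ K) (hk : k ≠ 2)
    {Γ : (Fin n → ℝ) →ₗ[ℝ] Matrix (Fin n) (Fin n) ℝ} (hΓ : ∀ x, Γ x ∈ stabLie n)
    (h0 : ∀ x, Γ x *ᵥ x = 0) : Γ = 0 :=
  H.eq_zero_of_liftFamily (family_eq_zero_of_ne_two e hk (fun z => H.lift_mem_der (hΓ _))
    fun z => by rw [liftFamily_apply, h0, map_zero])

/-- The vector `∑ e∘e` is annihilated by 𝔥, as a skew matrix contracts to zero with Υ. Invariance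
under all rotations makes its matrix diagonal with equal entries, and trace zero makes it vanish. A
nonzero `d` is needed to compare the diagonal entries. -/
theorem cartanCubic (H : HermModel n m) [Nontrivial K] : CartanCubic n := by
  refine ⟨?_, H.norm_square⟩
  set t := ∑ M : Fin n, mulMat (stdVec M) *ᵥ stdVec M with ht
  have h1 : ∀ E ∈ stabLie n, E *ᵥ t = 0 := by
    intro E hE
    have h2 := contract_skew (mem_stabLie_iff.1 hE).1
    rw [ht, mulVec_sum]
    simp only [stabLie_mulVec_self hE]
    rw [← Finset.smul_sum, ← contract_apply, h2, smul_zero]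
  have h2 : ∀ D ∈ m.der, D (H.toHerm t) = 0 := by
    intro D hD
    have h3 := h1 _ (H.ofHerm_der_mem hD)
    rw [toMatrix_ofHerm_mulVec] at h3
    rw [← H.toHerm_ofHerm_of_tr (hD.1 _), h3, map_zero]
  obtain ⟨d, hd⟩ := exists_ne (0 : K)
  have h3 : ∀ i, (H.toHerm t).1 (i + 1) = (H.toHerm t).1 (i + 2) := by
    intro i
    have := congrArg (fun z : Herm K => z.2 i) (h2 _ (m.rot_mem_der i d))
    simp only [rot_snd, if_true, Prod.snd_zero, Pi.zero_apply] at this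
    exact sub_eq_zero.1 ((smul_eq_zero.1 this).resolve_right hd)
  have h4 : ∀ i, (H.toHerm t).2 i = 0 := by
    intro i
    have := congrArg (fun z : Herm K => z.1 (i + 2)) (h2 _ (m.rot_mem_der i ((H.toHerm t).2 i)))
    obtain ⟨c1, c2, c3, c4, c5, c6, c7⟩ := cycle_simps i
    simp only [rot_fst, c6, c7, if_false, Prod.fst_zero, Pi.zero_apply] at this
    exact inner_self_eq_zero.1 ((mul_eq_zero.1 this).resolve_left (by norm_num))
  have h5 := H.tr_toHerm t
  rw [tr_apply] at h5
  have a0 := h3 0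
  have a1 := h3 1
  simp only [zero_add, show (1 + 1 : Fin 3) = 2 from rfl, show (1 + 2 : Fin 3) = 0 from rfl]
    at a0 a1
  have h6 : H.toHerm t = 0 := by
    refine Prod.ext (funext fun j => ?_) (funext h4)
    rw [Prod.fst_zero, Pi.zero_apply]
    fin_cases j <;> simp <;> linarith
  rw [← H.ofHerm_toHerm t, h6, map_zero]

/-- The normal form of `Γ_x x` for `Γ` in the kernel of `Υ'`. -/
theorem exists_of_mem_ker (H : HermModel n m) (e : OrthonormalBasis (Fin k) ℝ K)
    {Γ : (Fin n → ℝ) →ₗ[ℝ] Matrix (Fin n) (Fin n) ℝ} (hs : ∀ x, (Γ x)ᵀ = - Γ x)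
    (hq : ∀ x y z w, quarticForm (toTensor Γ) x y z w = 0) :
    ∃ D : (Fin n → ℝ) →ₗ[ℝ] Matrix (Fin n) (Fin n) ℝ, (∀ x, D x ∈ stabLie n) ∧
      ∃ S ∈ stabLie n, ∀ x, Γ x *ᵥ x = D x *ᵥ x + S *ᵥ (mulMat x *ᵥ x) := by
  set b := symm (H.liftFamily Γ) with hb
  have hbx : ∀ x y, b x y = H.toHerm ((1 / 2 : ℝ) •
      symSlice (toTensor Γ) (H.ofHerm x) (H.ofHerm y)) := by
    intro x y
    rw [hb, symm_apply, liftFamily_apply, liftFamily_apply, symSlice, slice_toTensor, map_smul,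
      map_add]
  have hcub : ∀ x y z, symSlice (toTensor Γ) x y ⬝ᵥ z + symSlice (toTensor Γ) y z ⬝ᵥ x
      + symSlice (toTensor Γ) z x ⬝ᵥ y = 0 := by
    intro x y z
    simp only [symSlice, slice_toTensor, add_dotProduct]
    have h1 := skew_dotProduct (hs x) y z
    have h2 := skew_dotProduct (hs y) z x
    have h3 := skew_dotProduct (hs z) x y
    rw [dotProduct_comm y] at h1
    rw [dotProduct_comm z] at h2
    rw [dotProduct_comm x] at h3
    linarith
  have hform : ∀ x z, form (H.toHerm x) z = 6 * (x ⬝ᵥ H.ofHerm z) := fun x z => by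
    rw [form_comm, ← ofHerm_dotProduct, dotProduct_comm]
  have hbn : b ∈ m.normalFields := by
    refine ⟨fun x y => ?_, fun x y => ?_, fun x y z => ?_, fun x y z w => ?_⟩
    · rw [hbx, hbx, symSlice_comm]
    · rw [hbx, tr_toHerm]
    · have := hcub (H.ofHerm x) (H.ofHerm y) (H.ofHerm z)
      simp only [hbx, hform, smul_dotProduct, smul_eq_mul]
      linarith
    · have h0 := hq (H.ofHerm x) (H.ofHerm y) (H.ofHerm z) (H.ofHerm w)
      have h1 := hcub (H.ofHerm x) (H.ofHerm y) (H.ofHerm z)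
      have h2 := hcub (H.ofHerm x) (H.ofHerm y) (H.ofHerm w)
      have h3 := hcub (H.ofHerm x) (H.ofHerm z) (H.ofHerm w)
      have h4 := hcub (H.ofHerm y) (H.ofHerm z) (H.ofHerm w)
      simp only [hbx, hform, smul_dotProduct, smul_eq_mul, ofHerm_cross, dotProduct_sub,
        dotProduct_smul]
      rw [symSlice_comm _ (H.ofHerm z) (H.ofHerm x)] at h1
      rw [symSlice_comm _ (H.ofHerm w) (H.ofHerm x)] at h2 h3
      rw [symSlice_comm _ (H.ofHerm w) (H.ofHerm y)] at h4
      simp only [quarticForm] at h0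
      -- Each trace correction in `ofHerm_cross` multiplies the cubic identity `hcub`, which holds
      -- by skewness of the slices; so passing from trace-free to all hermitian matrices imposes no
      -- further condition.
      linear_combination 3 * h0 - (1 / 2 * tr w) * h1 - (1 / 2 * tr z) * h2 - (1 / 2 * tr y) * h3
        - (1 / 2 * tr x) * h4
  obtain ⟨D, hD, S, hS, hbD⟩ := normalFields_le_derFields e hbn
  refine ⟨LinearMap.toMatrix'.toLinearMap ∘ₗ (LinearMap.llcomp ℝ (Fin n → ℝ) (Herm K)
    (Fin n → ℝ) H.ofHerm) ∘ₗ (LinearMap.lcomp ℝ (Herm K) H.toHerm) ∘ₗ D ∘ₗ H.toHerm,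
    fun x => H.ofHerm_der_mem (hD _), _, H.ofHerm_der_mem hS, fun x => ?_⟩
  have h1 : b (H.toHerm x) (H.toHerm x) = H.toHerm (Γ x *ᵥ x) := by
    rw [hb, symm_apply, liftFamily_apply, ofHerm_toHerm, ← two_smul ℝ, smul_smul]
    norm_num
  have h2 := congrArg H.ofHerm h1
  -- The multiple of the unit in `cross_toHerm` is lost because derivations kill the unit.
  rw [ofHerm_toHerm, hbD, LinearMap.add_apply, LinearMap.add_apply, LinearMap.compr₂_apply,
    cross_toHerm, map_sub, map_smul, der_one hS, smul_zero, sub_zero, symm_apply,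
    ← two_smul ℝ, smul_smul] at h2
  rw [← h2, toMatrix_ofHerm_mulVec, map_add]
  congr 1
  norm_num

end HermModel
end

/-! ### The kernel of `upsilonPrime` and the intersection of its obvious parts. -/

noncomputable section

open Herm SymComp

section

variable {n k : ℕ}

/-- The tensor in `Λ² ⊗ ℝⁿ` with given skew slices. -/
def mkTensor (Γ : (Fin n → ℝ) →ₗ[ℝ] Matrix (Fin n) (Fin n) ℝ) (h : ∀ x, (Γ x)ᵀ = - Γ x) :
    wedgeTwoTensor n :=
  ⟨toTensor Γ, mem_wedgeTwoTensor_iff.2 fun x => by rw [slice_toTensor, h]⟩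

theorem slice_mkTensor (Γ : (Fin n → ℝ) →ₗ[ℝ] Matrix (Fin n) (Fin n) ℝ)
    (h : ∀ x, (Γ x)ᵀ = - Γ x) : slice (mkTensor Γ h).1 = Γ :=
  slice_toTensor Γ

theorem wedgeTwoTensor_ext {Γ Δ : wedgeTwoTensor n} (h : ∀ x, slice Γ.1 x = slice Δ.1 x) :
    Γ = Δ := by
  refine Subtype.ext ?_
  rw [← toTensor_slice Γ.1, ← toTensor_slice Δ.1, LinearMap.ext h]

theorem slice_transpose (Γ : wedgeTwoTensor n) (x : Fin n → ℝ) :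
    (slice Γ.1 x)ᵀ = - slice Γ.1 x :=
  mem_wedgeTwoTensor_iff.1 Γ.2 x

theorem stabLie_transpose {D : Matrix (Fin n) (Fin n) ℝ} (hD : D ∈ stabLie n) : Dᵀ = -D :=
  (mem_stabLie_iff.1 hD).1

theorem stabLieTensor_le_ker : stabLieTensor n ≤ LinearMap.ker (upsilonPrime n) := by
  intro Γ hΓ
  rw [mem_ker_upsilonPrime_iff]
  exact fun x => HermModel.stabLie_dotProduct_square (mem_stabLieTensor_iff.1 hΓ x) x

theorem wedgeThree_le_ker : wedgeThree n ≤ LinearMap.ker (upsilonPrime n) := by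
  intro Γ hΓ
  rw [mem_ker_upsilonPrime_iff]
  intro x
  rw [mem_wedgeThree_iff.1 hΓ, zero_dotProduct]

/-- The tensor `D U + U D`. -/
def anticommTensor (D : stabLie n) : wedgeTwoTensor n :=
  mkTensor (anticomm D.1) (anticomm_transpose (stabLie_transpose D.2))

theorem slice_anticommTensor (D : stabLie n) : slice (anticommTensor D).1 = anticomm D.1 :=
  slice_mkTensor _ _

/-- The linear map `D ↦ D U + U D`. -/
def anticommMap (n : ℕ) : stabLie n →ₗ[ℝ] wedgeTwoTensor n where
  toFun := anticommTensor
  map_add' C D := wedgeTwoTensor_ext fun x => by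
    rw [Submodule.coe_add, slice_add, slice_anticommTensor, slice_anticommTensor,
      slice_anticommTensor]
    simp only [anticomm_apply, Submodule.coe_add, add_mul, mul_add]
    abel
  map_smul' c D := wedgeTwoTensor_ext fun x => by
    rw [RingHom.id_apply, Submodule.coe_smul, slice_smul, slice_anticommTensor,
      slice_anticommTensor]
    simp only [anticomm_apply, Submodule.coe_smul, Matrix.smul_mul, Matrix.mul_smul, smul_add]

theorem slice_anticommMap (D : stabLie n) : slice (anticommMap n D).1 = anticomm D.1 :=
  slice_anticommTensor D

theorem anticommMap_mem_ker (D : stabLie n) :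
    anticommMap n D ∈ LinearMap.ker (upsilonPrime n) := by
  rw [mem_ker_upsilonPrime_iff]
  intro x
  rw [slice_anticommMap, anticomm_mulVec_self D.2, smul_dotProduct,
    HermModel.skew_dotProduct_self (stabLie_transpose D.2), smul_zero]

variable {K : Type*} [NormedAddCommGroup K] [InnerProductSpace ℝ K] {m : SymComp K}

namespace HermModel

theorem ker_le (H : HermModel n m) (e : OrthonormalBasis (Fin k) ℝ K) :
    LinearMap.ker (upsilonPrime n) ≤
      stabLieTensor n ⊔ wedgeThree n ⊔ LinearMap.range (anticommMap n) := by
  intro Γ hΓ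
  obtain ⟨D, hD, S, hS, h⟩ := H.exists_of_mem_ker e (Γ := slice Γ.1) (slice_transpose Γ) (by
    rw [toTensor_slice]
    exact quarticForm_of_diag (mem_ker_upsilonPrime_iff.1 hΓ))
  set A := mkTensor D (fun x => stabLie_transpose (hD x)) with hA
  set B := anticommMap n ⟨S, hS⟩ with hB
  have hA' : A ∈ stabLieTensor n := by
    rw [mem_stabLieTensor_iff, hA, slice_mkTensor]
    exact hD
  -- The factor 2/3 inverts the 3/2 of `anticomm_mulVec_self`, so both sides of the normal form
  -- cancel on the diagonal.
  have hC : Γ - A - (2 / 3 : ℝ) • B ∈ wedgeThree n := by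
    rw [mem_wedgeThree_iff]
    intro x
    have e1 : slice (Γ - A - (2 / 3 : ℝ) • B).1 x = slice Γ.1 x - D x
        - (2 / 3 : ℝ) • anticomm S x := by
      have : (Γ - A - (2 / 3 : ℝ) • B).1 = Γ.1 + ((-1 : ℝ) • A.1 + (-(2 / 3) : ℝ) • B.1) := by
        have : Γ - A - (2 / 3 : ℝ) • B = Γ + ((-1 : ℝ) • A + (-(2 / 3) : ℝ) • B) := by module
        rw [this]
        rfl
      rw [this, slice_add, slice_add, slice_smul, slice_smul, hA, slice_mkTensor, hB,
        slice_anticommMap]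
      module
    rw [e1, sub_mulVec, sub_mulVec, smul_mulVec, anticomm_mulVec_self hS, h]
    module
  have : Γ = A + (Γ - A - (2 / 3 : ℝ) • B) + (2 / 3 : ℝ) • B := by module
  rw [this]
  exact Submodule.add_mem_sup (Submodule.add_mem_sup hA' hC)
    (Submodule.smul_mem _ _ (LinearMap.mem_range_self _ _))

theorem ker_eq (H : HermModel n m) (e : OrthonormalBasis (Fin k) ℝ K) :
    LinearMap.ker (upsilonPrime n) =
      stabLieTensor n ⊔ wedgeThree n ⊔ LinearMap.range (anticommMap n) := by
  refine le_antisymm (H.ker_le e) (sup_le (sup_le stabLieTensor_le_ker wedgeThree_le_ker) ?_)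
  rintro _ ⟨D, rfl⟩
  exact anticommMap_mem_ker D

/-- The tensors `anticomm D` and `anticommHat D` both send x to a multiple of D(x∘x), and the second
lies in 𝔥 ⊗ ℝⁿ. For n ≠ 26 its coefficient is nonzero, so a suitable difference is totally skew. -/
theorem ker_eq_of_ne [Nontrivial K] (H : HermModel n m) (e : OrthonormalBasis (Fin k) ℝ K) (hn : n
    ≠ 26) :
    LinearMap.ker (upsilonPrime n) = stabLieTensor n ⊔ wedgeThree n := by
  rw [H.ker_eq e, sup_eq_left]
  rintro _ ⟨D, rfl⟩
  have hc := H.cartanCubic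
  have hn' : (14 - (n + 2) / 2 : ℝ) ≠ 0 := by
    intro h
    have : (n : ℝ) = 26 := by linarith
    exact hn (by exact_mod_cast this)
  set A := mkTensor (anticommHat D.1)
    (fun x => stabLie_transpose (hc.anticommHat_mem D.2 x)) with hA
  have hA' : A ∈ stabLieTensor n := by
    rw [mem_stabLieTensor_iff, hA, slice_mkTensor]
    exact hc.anticommHat_mem D.2
  set r : ℝ := 3 / 2 / (14 - (n + 2) / 2) with hr
  have hC : anticommMap n D - r • A ∈ wedgeThree n := by
    rw [mem_wedgeThree_iff]
    intro x
    have e1 : slice (anticommMap n D - r • A).1 x = anticomm D.1 x - r • anticommHat D.1 x := by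
      have : (anticommMap n D - r • A).1 = (anticommMap n D).1 + (-r) • A.1 := by
        have : anticommMap n D - r • A = anticommMap n D + (-r) • A := by module
        rw [this]
        rfl
      rw [this, slice_add, slice_smul, hA, slice_mkTensor, slice_anticommMap]
      module
    rw [e1, sub_mulVec, smul_mulVec, anticomm_mulVec_self D.2, hc.anticommHat_mulVec_self D.2,
      smul_smul, hr, div_mul_cancel₀ _ hn', sub_self]
  have : anticommMap n D = r • A + (anticommMap n D - r • A) := by module
  rw [this]
  exact Submodule.add_mem_sup (Submodule.smul_mem _ _ hA') hC

theorem inf_eq_bot (H : HermModel n m) (e : OrthonormalBasis (Fin k) ℝ K) (hk : k ≠ 2) :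
    stabLieTensor n ⊓ wedgeThree n = ⊥ := by
  rw [eq_bot_iff]
  rintro Γ ⟨h1, h2⟩
  have := H.eq_zero_of_mulVec_self e hk (mem_stabLieTensor_iff.1 h1) (mem_wedgeThree_iff.1 h2)
  rw [Submodule.mem_bot]
  refine wedgeTwoTensor_ext fun x => ?_
  rw [this]
  ext M J
  simp [slice_apply]

end HermModel

/-! ### The additional summand for `n = 26` -/

theorem CartanCubic.anticommMap_injective (h : CartanCubic n) :
    Function.Injective (anticommMap n) := by
  rw [injective_iff_map_eq_zero]
  intro D hD
  refine Subtype.ext (h.eq_zero_of_mulVec_square fun x => ?_)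
  have h1 := anticomm_mulVec_self D.2 x
  rw [← slice_anticommMap, hD] at h1
  have h2 : slice (0 : wedgeTwoTensor n).1 x = 0 := by
    ext M J
    simp [slice_apply]
  rw [h2, zero_mulVec] at h1
  exact (smul_eq_zero.1 h1.symm).resolve_left (by norm_num)

/-- The inner product of tensors. -/
def tensorInner (Γ Δ : wedgeTwoTensor n) : ℝ :=
  ∑ I, (slice Γ.1 (stdVec I) * slice Δ.1 (stdVec I)).trace

theorem tensorInner_add_left (Γ Δ E : wedgeTwoTensor n) :
    tensorInner (Γ + Δ) E = tensorInner Γ E + tensorInner Δ E := by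
  simp only [tensorInner, Submodule.coe_add, slice_add, add_mul, trace_add,
    Finset.sum_add_distrib]

/-- The slices are skew, so `tensorInner Γ Γ` is minus a sum of squares. -/
theorem eq_zero_of_tensorInner_self {Γ : wedgeTwoTensor n} (h : tensorInner Γ Γ = 0) : Γ = 0 := by
  have h1 : ∑ I, ((slice Γ.1 (stdVec I))ᵀ * slice Γ.1 (stdVec I)).trace = 0 := by
    simp only [slice_transpose, neg_mul, trace_neg, Finset.sum_neg_distrib]
    rw [← tensorInner, h, neg_zero]
  rw [Finset.sum_eq_zero_iff_of_nonneg fun M _ => trace_transpose_mul_nonneg _] at h1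
  refine Subtype.ext ?_
  funext M J I
  rw [← slice_stdVec Γ.1, eq_zero_of_trace_transpose_mul (h1 I (Finset.mem_univ _))]
  rfl

/-- A symmetric pair of indices of Υ is contracted with a skew pair of Γ. -/
theorem sum_mulMat_mul_slice {Γ : wedgeTwoTensor n} (hΓ : Γ ∈ wedgeThree n) :
    ∑ I, mulMat (stdVec I) * slice Γ.1 (stdVec I) = 0 := by
  ext A J
  have hsk : ∀ I M, Γ.1 M J I = -Γ.1 I J M := fun I M => by
    rw [Γ.2 M J I, hΓ J M I, Γ.2 J I M, neg_neg]
  simp only [Matrix.sum_apply, mul_apply, mulMat_stdVec, slice_stdVec, Matrix.zero_apply]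
  have h1 : ∑ I, ∑ M, upsilon n A M I * Γ.1 M J I = - ∑ I, ∑ M, upsilon n A M I * Γ.1 M J I := by
    conv_lhs => rw [Finset.sum_comm]
    rw [← Finset.sum_neg_distrib]
    refine Finset.sum_congr rfl fun I _ => ?_
    rw [← Finset.sum_neg_distrib]
    refine Finset.sum_congr rfl fun M _ => ?_
    rw [upsilon_swap_right, hsk]
    ring
  linarith

theorem tensorInner_wedgeThree {Γ : wedgeTwoTensor n} (hΓ : Γ ∈ wedgeThree n) (D : stabLie n) :
    tensorInner Γ (anticommMap n D) = 0 := by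
  have h1 := sum_mulMat_mul_slice hΓ
  have h2 : ∑ I, slice Γ.1 (stdVec I) * mulMat (stdVec I) = 0 := by
    have := congrArg transpose h1
    simp only [transpose_sum, transpose_mul, mulMat_transpose, slice_transpose, neg_mul,
      Finset.sum_neg_distrib, transpose_zero] at this
    exact neg_eq_zero.1 this
  have h3 : ∀ I, (slice Γ.1 (stdVec I) * anticomm D.1 (stdVec I)).trace =
      (mulMat (stdVec I) * slice Γ.1 (stdVec I) * D.1).trace
      + (slice Γ.1 (stdVec I) * mulMat (stdVec I) * D.1).trace := by
    intro I
    rw [anticomm_apply, mul_add, trace_add, ← Matrix.mul_assoc, ← Matrix.mul_assoc,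
      Matrix.mul_assoc (mulMat (stdVec I)), trace_mul_comm (mulMat (stdVec I))]
  simp only [tensorInner, slice_anticommMap, h3, Finset.sum_add_distrib, ← trace_sum,
    ← Finset.sum_mul, h1, h2, zero_mul, trace_zero, add_zero]

/-- For n = 26 the tensor `anticommHat D` lies in both 𝔥 ⊗ ℝ²⁶ and Λ³, hence is zero. So the slices
of `anticomm D` are eigenvectors of Υ̂ for -8 and orthogonal to 𝔥, where the eigenvalue is 28. With
orthogonality to Λ³, an element of the intersection is orthogonal to itself. -/
theorem inf_range_anticommMap (h : CartanCubic 26) (hb : stabLieTensor 26 ⊓ wedgeThree 26 = ⊥) :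
    (stabLieTensor 26 ⊔ wedgeThree 26) ⊓ LinearMap.range (anticommMap 26) = ⊥ := by
  rw [eq_bot_iff]
  rintro _ ⟨hΓ, D, rfl⟩
  have hh : ∀ x, anticommHat D.1 x = 0 := by
    set A := mkTensor (anticommHat D.1)
      (fun x => stabLie_transpose (h.anticommHat_mem D.2 x)) with hA
    have hA' : A ∈ stabLieTensor 26 := by
      rw [mem_stabLieTensor_iff, hA, slice_mkTensor]
      exact h.anticommHat_mem D.2
    have hA3 : A ∈ wedgeThree 26 := by
      rw [mem_wedgeThree_iff, hA, slice_mkTensor]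
      intro x
      rw [h.anticommHat_mulVec_self D.2]
      norm_num
    have hA0 : A = 0 := by
      rw [← Submodule.mem_bot ℝ, ← hb]
      exact ⟨hA', hA3⟩
    intro x
    rw [← slice_mkTensor (anticommHat D.1)
      (fun x => stabLie_transpose (h.anticommHat_mem D.2 x)), ← hA, hA0]
    ext M J
    simp [slice_apply]
  have horth : ∀ Γ ∈ stabLieTensor 26, tensorInner Γ (anticommMap 26 D) = 0 := by
    intro Γ hΓ
    refine Finset.sum_eq_zero fun I _ => ?_
    rw [slice_anticommMap]
    have h1 := h.upsilonHat_of_mem (mem_stabLieTensor_iff.1 hΓ (stdVec I))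
    have h2 := hh (stdVec I)
    rw [anticommHat_apply] at h2
    have h3 := trace_upsilonHat_mul (slice Γ.1 (stdVec I)) (anticomm D.1 (stdVec I))
    rw [h1, eq_neg_of_add_eq_zero_left h2, Matrix.smul_mul, mul_neg, Matrix.mul_smul, trace_smul,
      trace_neg, trace_smul, smul_eq_mul, smul_eq_mul] at h3
    norm_num at h3
    linarith
  obtain ⟨A, hA, B, hB, hAB⟩ := Submodule.mem_sup.1 hΓ
  rw [Submodule.mem_bot]
  refine eq_zero_of_tensorInner_self ?_
  conv_lhs => rw [← hAB, tensorInner_add_left, hAB]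
  rw [horth A hA, tensorInner_wedgeThree hB, add_zero]

/-! ### The action of the stabilizer -/

theorem specialOrthogonal_mul_transpose (h : specialOrthogonalGroup (Fin n) ℝ) :
    h.1 * h.1ᵀ = 1 :=
  (mem_orthogonalGroup_iff _ _).1 (mem_specialOrthogonalGroup_iff.1 h.2).1

theorem specialOrthogonal_transpose_mul (h : specialOrthogonalGroup (Fin n) ℝ) :
    h.1ᵀ * h.1 = 1 :=
  (mem_orthogonalGroup_iff' _ _).1 (mem_specialOrthogonalGroup_iff.1 h.2).1

/-- Orthogonal matrices preserving the cubic form are automorphisms of the product. -/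
theorem mulMat_orthogonal {g : Matrix (Fin n) (Fin n) ℝ} (hg : gᵀ * g = 1)
    (h : ∀ x y z, upsilonForm n (g *ᵥ x) (g *ᵥ y) (g *ᵥ z) = upsilonForm n x y z)
    (x : Fin n → ℝ) : mulMat (g *ᵥ x) = g * mulMat x * gᵀ := by
  have hg' : g * gᵀ = 1 := mul_eq_one_comm.1 hg
  have h1 : gᵀ * mulMat (g *ᵥ x) * g = mulMat x := by
    refine eq_of_mulVec fun y => dotProduct_eq _ _ fun z => ?_
    have := h x y z
    rw [upsilonForm_eq, upsilonForm_eq] at this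
    rw [← this, ← mulVec_mulVec, ← mulVec_mulVec, mulVec_transpose, ← dotProduct_mulVec]
  rw [← h1]
  calc mulMat (g *ᵥ x) = (g * gᵀ) * mulMat (g *ᵥ x) * (g * gᵀ) := by rw [hg', one_mul, mul_one]
    _ = _ := by noncomm_ring

theorem slice_tensorAct (g : Matrix (Fin n) (Fin n) ℝ) (Γ : Fin n → Fin n → Fin n → ℝ)
    (x : Fin n → ℝ) : slice (tensorAct g Γ) x = g * slice Γ (gᵀ *ᵥ x) * gᵀ := by
  ext M J
  simp only [slice_apply, tensorAct, mul_apply, transpose_apply, mulVec, dotProduct,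
    Finset.sum_mul, Finset.mul_sum]
  rw [Finset.sum_comm]
  conv_rhs => rw [Finset.sum_comm]
  refine Finset.sum_congr rfl fun A _ => ?_
  rw [Finset.sum_comm]
  refine Finset.sum_congr rfl fun B _ => ?_
  rw [Finset.sum_comm]
  refine Finset.sum_congr rfl fun C _ => Finset.sum_congr rfl fun I _ => ?_
  ring

theorem conj_mem_stabLie {h : specialOrthogonalGroup (Fin n) ℝ} (hh : h ∈ stabGroup n)
    {D : Matrix (Fin n) (Fin n) ℝ} (hD : D ∈ stabLie n) : h.1 * D * h.1ᵀ ∈ stabLie n := by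
  have h1 := specialOrthogonal_transpose_mul h
  have h2 := specialOrthogonal_mul_transpose h
  rw [mem_stabLie_iff] at hD ⊢
  refine ⟨?_, fun x => ?_⟩
  · rw [transpose_mul, transpose_mul, transpose_transpose, hD.1]
    noncomm_ring
  · have h3 : ∀ y, mulMat (h.1 *ᵥ y) = h.1 * mulMat y * h.1ᵀ := mulMat_orthogonal h1 hh
    have hx : x = h.1 *ᵥ (h.1ᵀ *ᵥ x) := by rw [mulVec_mulVec, h2, one_mulVec]
    set y := h.1ᵀ *ᵥ x
    have h4 : (h.1 * D * h.1ᵀ) *ᵥ x = h.1 *ᵥ (D *ᵥ y) := by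
      rw [← mulVec_mulVec, ← mulVec_mulVec]
    have e : ∀ A B : Matrix (Fin n) (Fin n) ℝ, h.1 * A * h.1ᵀ * (h.1 * B * h.1ᵀ) =
        h.1 * (A * B) * h.1ᵀ := by
      intro A B
      calc h.1 * A * h.1ᵀ * (h.1 * B * h.1ᵀ) = h.1 * A * (h.1ᵀ * h.1) * B * h.1ᵀ := by
            noncomm_ring
        _ = _ := by rw [h1, mul_one]; noncomm_ring
    rw [h4, h3, hx, h3, e, e, hD.2, mul_add, add_mul]

theorem anticommMap_equivariant {h : specialOrthogonalGroup (Fin n) ℝ} (hh : h ∈ stabGroup n)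
    (D : stabLie n) : (anticommMap n ⟨_, conj_mem_stabLie hh D.2⟩).1 =
      tensorAct h.1 (anticommMap n D).1 := by
  rw [← toTensor_slice (tensorAct _ _), ← toTensor_slice (anticommMap n _).1]
  congr 1
  refine LinearMap.ext fun x => ?_
  have h1 := specialOrthogonal_transpose_mul h
  have h2 := specialOrthogonal_mul_transpose h
  have hx : x = h.1 *ᵥ (h.1ᵀ *ᵥ x) := by rw [mulVec_mulVec, h2, one_mulVec]
  rw [slice_tensorAct, slice_anticommMap, slice_anticommMap, anticomm_apply, anticomm_apply]
  set y := h.1ᵀ *ᵥ x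
  rw [hx, mulMat_orthogonal h1 hh]
  have e : ∀ A B : Matrix (Fin n) (Fin n) ℝ, h.1 * A * h.1ᵀ * (h.1 * B * h.1ᵀ) =
      h.1 * (A * B) * h.1ᵀ := by
    intro A B
    calc h.1 * A * h.1ᵀ * (h.1 * B * h.1ᵀ) = h.1 * A * (h.1ᵀ * h.1) * B * h.1ᵀ := by
          noncomm_ring
      _ = _ := by rw [h1, mul_one]; noncomm_ring
  rw [e, e, mul_add, add_mul]

/-- The eigenspace is 𝔥 with the action by conjugation, and D ↦ D U + U D is equivariant because the
group acts by automorphisms of ∘. -/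
theorem CartanCubic.isoAsRep (h : CartanCubic 26) :
    IsoAsRep 26 (Module.End.eigenspace (upsilonHat 26) 28) (LinearMap.range (anticommMap 26)) := by
  rw [eigenspace_eq_stabLie h]
  refine ⟨LinearEquiv.ofInjective (anticommMap 26) h.anticommMap_injective, fun g hg F => ?_⟩
  exact ⟨conj_mem_stabLie hg F.2, anticommMap_equivariant hg F⟩

theorem CartanCubic.finrank_range (h : CartanCubic 26) :
    Module.finrank ℝ (LinearMap.range (anticommMap 26)) = 52 := by
  rw [LinearMap.finrank_range_of_inj h.anticommMap_injective]
  have := h.finrank_stabLie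
  norm_num at this
  have h2 : (Module.finrank ℝ (stabLie 26) : ℝ) = 52 := by linarith
  exact_mod_cast h2

end
end

noncomputable section

/-! ### The cubic form in coordinates -/

namespace Octonion

variable {R : Type*} [CommRing R]

@[simp] theorem re_add (a b : Octonion R) : (a + b).re = a.re + b.re := rfl

@[simp] theorem re_sub (a b : Octonion R) : (a - b).re = a.re - b.re := rfl

theorem re_mul (a b : Octonion R) : (a * b).re = a.re * b.re - ∑ m, a.im m * b.im m := rfl

theorem im_mul (a b : Octonion R) (l : ZMod 7) : (a * b).im l =
    a.re * b.im l + a.im l * b.re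
      + (a.im (l - 3) * b.im (l - 2) - a.im (l - 2) * b.im (l - 3))
      + (a.im (l + 1) * b.im (l + 3) - a.im (l + 3) * b.im (l + 1))
      + (a.im (l + 2) * b.im (l - 1) - a.im (l - 1) * b.im (l + 2)) := rfl

/-- The octonion with components listed in the order `e₀, e₁, e₂, e₄, e₃, e₅, e₆, e₇`. -/
def ofVec (v : Fin 8 → R) : Octonion R :=
  mk8 (v 0) (v 1) (v 2) (v 4) (v 3) (v 5) (v 6) (v 7)

/-- The octonionic product in the basis `e₀, e₁, e₂, e₄, e₃, e₅, e₆, e₇`. -/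
def vecMul (x y : Fin 8 → R) : Fin 8 → R :=
  ![x 0 * y 0 - x 1 * y 1 - x 2 * y 2 - x 3 * y 3 - x 4 * y 4 - x 5 * y 5 - x 6 * y 6 - x 7 * y 7,
    x 0 * y 1 + x 1 * y 0 + x 2 * y 3 + x 4 * y 7 + x 5 * y 6 - x 3 * y 2 - x 6 * y 5 - x 7 * y 4,
    x 0 * y 2 + x 2 * y 0 + x 3 * y 1 + x 4 * y 5 + x 6 * y 7 - x 1 * y 3 - x 5 * y 4 - x 7 * y 6,
    x 0 * y 3 + x 1 * y 2 + x 3 * y 0 + x 5 * y 7 + x 6 * y 4 - x 2 * y 1 - x 4 * y 6 - x 7 * y 5,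
    x 0 * y 4 + x 3 * y 6 + x 4 * y 0 + x 5 * y 2 + x 7 * y 1 - x 1 * y 7 - x 2 * y 5 - x 6 * y 3,
    x 0 * y 5 + x 2 * y 4 + x 5 * y 0 + x 6 * y 1 + x 7 * y 3 - x 1 * y 6 - x 3 * y 7 - x 4 * y 2,
    x 0 * y 6 + x 1 * y 5 + x 4 * y 3 + x 6 * y 0 + x 7 * y 2 - x 2 * y 7 - x 3 * y 4 - x 5 * y 1,
    x 0 * y 7 + x 1 * y 4 + x 2 * y 6 + x 3 * y 5 + x 7 * y 0 - x 4 * y 1 - x 5 * y 3 - x 6 * y 2]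

theorem ofVec_mul (x y : Fin 8 → R) : ofVec x * ofVec y = ofVec (vecMul x y) := by
  ext l
  · rw [re_mul]
    change _ - ∑ i : Fin 7, _ = _
    rw [Fin.sum_univ_seven]
    change x 0 * y 0 - (x 7 * y 7 + x 1 * y 1 + x 2 * y 2 + x 4 * y 4 + x 3 * y 3 + x 5 * y 5 +
      x 6 * y 6) = x 0 * y 0 - x 1 * y 1 - x 2 * y 2 - x 3 * y 3 - x 4 * y 4 - x 5 * y 5 -
      x 6 * y 6 - x 7 * y 7
    ring
  · rw [im_mul]
    -- The index 0 stands for e₇, and the indices 3 and 4 sit in positions 4 and 3 of the list,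
    -- where e₁, e₂ and e₄ = e₁ e₂ are adjacent.
    change Fin 7 at l
    match l with
    | 0 =>
      change x 0 * y 7 + x 7 * y 0 + (x 3 * y 5 - x 5 * y 3) + (x 1 * y 4 - x 4 * y 1)
        + (x 2 * y 6 - x 6 * y 2) = vecMul x y 7
      simp [vecMul]; ring
    | 1 =>
      change x 0 * y 1 + x 1 * y 0 + (x 5 * y 6 - x 6 * y 5) + (x 2 * y 3 - x 3 * y 2)
        + (x 4 * y 7 - x 7 * y 4) = vecMul x y 1
      simp [vecMul]; ring
    | 2 =>
      change x 0 * y 2 + x 2 * y 0 + (x 6 * y 7 - x 7 * y 6) + (x 4 * y 5 - x 5 * y 4)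
        + (x 3 * y 1 - x 1 * y 3) = vecMul x y 2
      simp [vecMul]; ring
    | 3 =>
      change x 0 * y 4 + x 4 * y 0 + (x 7 * y 1 - x 1 * y 7) + (x 3 * y 6 - x 6 * y 3)
        + (x 5 * y 2 - x 2 * y 5) = vecMul x y 4
      simp [vecMul]; ring
    | 4 =>
      change x 0 * y 3 + x 3 * y 0 + (x 1 * y 2 - x 2 * y 1) + (x 5 * y 7 - x 7 * y 5)
        + (x 6 * y 4 - x 4 * y 6) = vecMul x y 3
      simp [vecMul]; ring
    | 5 =>
      change x 0 * y 5 + x 5 * y 0 + (x 2 * y 4 - x 4 * y 2) + (x 6 * y 1 - x 1 * y 6)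
        + (x 7 * y 3 - x 3 * y 7) = vecMul x y 5
      simp [vecMul]; ring
    | 6 =>
      change x 0 * y 6 + x 6 * y 0 + (x 4 * y 3 - x 3 * y 4) + (x 7 * y 2 - x 2 * y 7)
        + (x 1 * y 5 - x 5 * y 1) = vecMul x y 6
      simp [vecMul]; ring

/-- Conjugation in coordinates. -/
def vecConj (x : Fin 8 → R) : Fin 8 → R :=
  ![x 0, -x 1, -x 2, -x 3, -x 4, -x 5, -x 6, -x 7]

theorem ofVec_conj (x : Fin 8 → R) : (ofVec x).conj = ofVec (vecConj x) := by
  ext l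
  · rfl
  · change Fin 7 at l
    match l with
    | 0 | 1 | 2 | 3 | 4 | 5 | 6 => rfl

theorem ofScalar_eq (r : R) : ofScalar r = ofVec (Pi.single 0 r) := by
  ext l
  · rfl
  · change Fin 7 at l
    match l with
    | 0 | 1 | 2 | 3 | 4 | 5 | 6 => rfl

theorem vecMul_single_left (r : R) (x : Fin 8 → R) : vecMul (Pi.single 0 r) x = r • x := by
  ext i
  fin_cases i <;> simp [vecMul]

theorem vecMul_single_right (r : R) (x : Fin 8 → R) : vecMul x (Pi.single 0 r) = r • x := by
  ext i
  fin_cases i <;> simp [vecMul, mul_comm]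

theorem re_ofVec (x : Fin 8 → R) : (ofVec x).re = x 0 := rfl

/-- The determinant of a hermitian matrix in coordinates. -/
theorem detOne_hermitian (a b c s : R) (x y z : Fin 8 → R) :
    detOne ![![ofScalar a, ofScalar s * ofVec z, ofScalar s * ofVec y],
      ![ofScalar s * (ofVec z).conj, ofScalar b, ofScalar s * ofVec x],
      ![ofScalar s * (ofVec y).conj, ofScalar s * (ofVec x).conj, ofScalar c]] =
    a * b * c - s ^ 2 * (a * ∑ i, x i ^ 2 + b * ∑ i, y i ^ 2 + c * ∑ i, z i ^ 2)
      + 2 * s ^ 3 * vecMul (vecMul z x) (vecConj y) 0 := by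
  simp only [detOne, Matrix.cons_val_zero, Matrix.cons_val_one, Matrix.cons_val, ofVec_conj,
    ofScalar_eq, ofVec_mul, re_add, re_sub, re_ofVec, vecMul_single_left, vecMul_single_right]
  simp [vecMul, vecConj, Fin.sum_univ_eight]
  ring

/-- All components are homogeneous of degree `d`. -/
def IsHomogeneous {σ : Type*} (a : Octonion (MvPolynomial σ R)) (d : ℕ) : Prop :=
  a.re.IsHomogeneous d ∧ ∀ l, (a.im l).IsHomogeneous d

namespace IsHomogeneous

variable {σ : Type*} {a b : Octonion (MvPolynomial σ R)} {d e : ℕ}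

theorem mul (ha : a.IsHomogeneous d) (hb : b.IsHomogeneous e) : (a * b).IsHomogeneous (d + e) := by
  have h : ∀ l l', (a.im l * b.im l').IsHomogeneous (d + e) := fun l l' => (ha.2 l).mul (hb.2 l')
  refine ⟨?_, fun l => ?_⟩
  · rw [re_mul]
    exact (ha.1.mul hb.1).sub (MvPolynomial.IsHomogeneous.sum _ _ _ fun m _ => h m m)
  · rw [im_mul]
    exact (((((ha.1.mul (hb.2 l)).add ((ha.2 l).mul hb.1)).add ((h _ _).sub (h _ _))).add
      ((h _ _).sub (h _ _)))).add ((h _ _).sub (h _ _))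

theorem conj (ha : a.IsHomogeneous d) : a.conj.IsHomogeneous d :=
  ⟨ha.1, fun l => (ha.2 l).neg⟩

theorem add (ha : a.IsHomogeneous d) (hb : b.IsHomogeneous d) : (a + b).IsHomogeneous d :=
  ⟨ha.1.add hb.1, fun l => (ha.2 l).add (hb.2 l)⟩

theorem sub (ha : a.IsHomogeneous d) (hb : b.IsHomogeneous d) : (a - b).IsHomogeneous d :=
  ⟨ha.1.sub hb.1, fun l => (ha.2 l).sub (hb.2 l)⟩

theorem ofScalar {r : MvPolynomial σ R} (hr : r.IsHomogeneous d) :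
    (Octonion.ofScalar r).IsHomogeneous d :=
  ⟨hr, fun _ => isHomogeneous_zero _ _ _⟩

theorem ofVec {v : Fin 8 → MvPolynomial σ R} (hv : ∀ i, (v i).IsHomogeneous d) :
    (Octonion.ofVec v).IsHomogeneous d := by
  refine ⟨hv 0, fun l => ?_⟩
  change Fin 7 at l
  match l with
  | 0 => exact hv 7
  | 1 => exact hv 1
  | 2 => exact hv 2
  | 3 => exact hv 4
  | 4 => exact hv 3
  | 5 => exact hv 5
  | 6 => exact hv 6

end IsHomogeneous

end Octonion

theorem isHomogeneous_detOne {σ : Type*} {A : Fin 3 → Fin 3 → Octonion (MvPolynomial σ ℝ)}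
    (hA : ∀ i j, (A i j).IsHomogeneous 1) : (detOne A).IsHomogeneous 3 := by
  have h : ∀ i j k l p q, ((A i j * A k l) * A p q).IsHomogeneous 3 := fun i j k l p q =>
    ((hA i j).mul (hA k l)).mul (hA p q)
  exact (((((h _ _ _ _ _ _).sub (h _ _ _ _ _ _)).sub (h _ _ _ _ _ _)).sub (h _ _ _ _ _ _)).add
    ((hA _ _).mul ((hA _ _).mul (hA _ _)))).add (h _ _ _ _ _ _) |>.1

theorem isHomogeneous_coordX (n I : ℕ) : (coordX n I).IsHomogeneous 1 := by
  unfold coordX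
  split
  · exact isHomogeneous_X _ _
  · exact isHomogeneous_zero _ _ _

/-- The components of `X¹`, `X²` and `X³`. -/
def genericVec (n : ℕ) : Fin 3 → Fin 8 → MvPolynomial (Fin n) ℝ :=
  let x := coordX n
  ![![x 1, x 6, x 9, x 10, x 15, x 16, x 17, x 18],
    ![x 2, x 7, x 11, x 12, x 19, x 20, x 21, x 22],
    ![x 3, x 8, x 13, x 14, x 23, x 24, x 25, x 26]]

theorem genericOne_eq (n : ℕ) : genericOne n = .ofVec (genericVec n 0) := rfl

theorem genericTwo_eq (n : ℕ) : genericTwo n = .ofVec (genericVec n 1) := rfl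

theorem genericThree_eq (n : ℕ) : genericThree n = .ofVec (genericVec n 2) := rfl

theorem isHomogeneous_genericVec (n : ℕ) (i : Fin 3) (j : Fin 8) :
    (genericVec n i j).IsHomogeneous 1 := by
  fin_cases i <;> fin_cases j <;> exact isHomogeneous_coordX n _

theorem isHomogeneous_upsilonPoly (n : ℕ) : (upsilonPoly n).IsHomogeneous 3 := by
  have hs : (Octonion.ofScalar (C (√3) : MvPolynomial (Fin n) ℝ)).IsHomogeneous 0 :=
    .ofScalar (isHomogeneous_C _ _)
  have hx := isHomogeneous_coordX n
  have hC : ∀ (r : ℝ) I, (C r * coordX n I).IsHomogeneous 1 := fun r I => by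
    have := (isHomogeneous_C (Fin n) r).mul (hx I)
    rwa [zero_add] at this
  have hv : ∀ i, (Octonion.ofScalar (C (√3) : MvPolynomial (Fin n) ℝ) *
      .ofVec (genericVec n i)).IsHomogeneous 1 := fun i =>
    hs.mul (.ofVec (isHomogeneous_genericVec n i))
  have hv' : ∀ i, (Octonion.ofScalar (C (√3) : MvPolynomial (Fin n) ℝ) *
      (Octonion.ofVec (genericVec n i)).conj).IsHomogeneous 1 := fun i =>
    hs.mul (Octonion.IsHomogeneous.conj (.ofVec (isHomogeneous_genericVec n i)))
  have h3 : (detOne (genericHermitian n)).IsHomogeneous 3 := by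
    refine isHomogeneous_detOne fun i j => ?_
    fin_cases i <;> fin_cases j
    · exact .ofScalar ((hx 5).sub (hC _ 4))
    · exact hv 2
    · exact hv 1
    · exact hv' 2
    · exact .ofScalar ((hx 5).add (hC _ 4))
    · exact hv 0
    · exact hv' 1
    · exact hv' 0
    · have := hC (-2) 5
      rw [map_neg] at this
      exact .ofScalar this
  have := (isHomogeneous_C (Fin n) (1 / 2 : ℝ)).mul h3
  rwa [zero_add] at this

/-- Homogeneity of degree 3 makes the third derivatives constant, and Euler's identity applied three
times gives the factor 3 · 2 · 1 that cancels the 1/6. -/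
theorem upsilonForm_self (n : ℕ) (x : Fin n → ℝ) :
    upsilonForm n x x x = eval x (upsilonPoly n) := by
  have euler : ∀ {p : MvPolynomial (Fin n) ℝ} {d : ℕ}, p.IsHomogeneous d →
      ∑ i, x i * eval x (pderiv i p) = d * eval x p := by
    intro p d hp
    have := congrArg (eval x) hp.sum_X_mul_pderiv
    simpa using this
  have h3 := isHomogeneous_upsilonPoly n
  have h2 : ∀ K, (pderiv K (upsilonPoly n)).IsHomogeneous 2 := fun K => h3.pderiv
  have h1 : ∀ J K, (pderiv J (pderiv K (upsilonPoly n))).IsHomogeneous 1 := fun J K => (h2 K).pderiv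
  have h0 : ∀ I J K, eval 0 (pderiv I (pderiv J (pderiv K (upsilonPoly n)))) =
      eval x (pderiv I (pderiv J (pderiv K (upsilonPoly n)))) := fun I J K => by
    have h : (pderiv I (pderiv J (pderiv K (upsilonPoly n)))).totalDegree = 0 :=
      Nat.le_zero.1 ((h1 J K).pderiv (i := I)).totalDegree_le
    rw [totalDegree_eq_zero_iff_eq_C] at h
    rw [h, eval_C, eval_C]
  have e1 : ∀ J K, ∑ I, upsilon n I J K * x I =
      1 / 6 * eval x (pderiv J (pderiv K (upsilonPoly n))) := fun J K => by
    have := euler (h1 J K)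
    simp only [upsilon, h0, mul_assoc, ← Finset.mul_sum]
    rw [← one_mul (eval x (pderiv J (pderiv K (upsilonPoly n)))), ← Nat.cast_one, ← this]
    simp only [mul_comm]
  have e2 : upsilonForm n x x x =
      ∑ K, x K * ∑ J, x J * ∑ I, upsilon n I J K * x I := by
    simp only [upsilonForm, Finset.mul_sum]
    rw [Finset.sum_comm' (t' := Finset.univ) (s' := fun _ => Finset.univ) (by simp),
      Finset.sum_comm]
    rw [Finset.sum_congr rfl fun J _ => Finset.sum_comm, Finset.sum_comm]
    exact Finset.sum_congr rfl fun K _ => Finset.sum_congr rfl fun J _ =>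
      Finset.sum_congr rfl fun I _ => by
        rw [upsilon_swap_left J I K]; ring
  have e3 : ∀ K, ∑ J, x J * (1 / 6 * eval x (pderiv J (pderiv K (upsilonPoly n)))) =
      1 / 3 * eval x (pderiv K (upsilonPoly n)) := fun K => by
    have := euler (h2 K)
    rw [show (1 / 3 : ℝ) = 1 / 6 * (2 : ℕ) by norm_num, mul_assoc, ← this, Finset.mul_sum]
    exact Finset.sum_congr rfl fun J _ => by ring
  rw [e2]
  simp only [e1, e3]
  have := euler h3
  have h6 : eval x (upsilonPoly n) = 1 / 3 * ((3 : ℕ) * eval x (upsilonPoly n)) := by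
    push_cast; ring
  rw [h6, ← this, Finset.mul_sum]
  exact Finset.sum_congr rfl fun J _ => by ring

theorem upsilonForm_self_eq (n : ℕ) (x : Fin n → ℝ) :
    let y := fun I => eval x (coordX n I)
    let v := fun i j => eval x (genericVec n i j)
    upsilonForm n x x x = 1 / 2 * ((y 5 - √3 * y 4) * (y 5 + √3 * y 4) * (-2 * y 5)
      - 3 * ((y 5 - √3 * y 4) * ∑ i, v 0 i ^ 2 + (y 5 + √3 * y 4) * ∑ i, v 1 i ^ 2
        + (-2 * y 5) * ∑ i, v 2 i ^ 2)
      + 6 * √3 * Octonion.vecMul (Octonion.vecMul (v 2) (v 0)) (Octonion.vecConj (v 1)) 0) := by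
  intro y v
  have hs : √3 ^ 2 = (3 : ℝ) := Real.sq_sqrt (by norm_num)
  rw [upsilonForm_self, upsilonPoly, genericHermitian]
  simp only [genericOne_eq, genericTwo_eq, genericThree_eq, Octonion.detOne_hermitian]
  simp only [map_add, map_sub, map_mul, map_pow, map_sum, eval_C, map_neg, map_ofNat, hs,
    Octonion.vecMul, Octonion.vecConj, Matrix.cons_val, Matrix.cons_val_zero, Matrix.cons_val_one]
  simp only [pow_succ _ 2, hs]
  ring

end

noncomputable section

open Herm SymComp Octonion

/-! ### The four composition algebras and their models -/

namespace Octonion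

/-- The product `conj (x y)`. -/
def symMul (x y : Fin 8 → ℝ) : Fin 8 → ℝ := vecConj (vecMul x y)

theorem symMul_add_left (x x' y : Fin 8 → ℝ) :
    symMul (x + x') y = symMul x y + symMul x' y := by
  ext i
  fin_cases i <;> simp [symMul, vecConj, vecMul] <;> ring

theorem symMul_add_right (x y y' : Fin 8 → ℝ) :
    symMul x (y + y') = symMul x y + symMul x y' := by
  ext i
  fin_cases i <;> simp [symMul, vecConj, vecMul] <;> ring

theorem symMul_smul_left (c : ℝ) (x y : Fin 8 → ℝ) : symMul (c • x) y = c • symMul x y := by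
  ext i
  fin_cases i <;> simp [symMul, vecConj, vecMul] <;> ring

theorem symMul_smul_right (c : ℝ) (x y : Fin 8 → ℝ) : symMul x (c • y) = c • symMul x y := by
  ext i
  fin_cases i <;> simp [symMul, vecConj, vecMul] <;> ring

theorem symMul_dotProduct (x y z : Fin 8 → ℝ) : symMul x y ⬝ᵥ z = x ⬝ᵥ symMul y z := by
  simp [symMul, vecConj, vecMul, dotProduct, Fin.sum_univ_eight]
  ring

theorem symMul_symMul_self (x y : Fin 8 → ℝ) : symMul (symMul x y) x = (x ⬝ᵥ x) • y := by
  ext i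
  fin_cases i <;> simp [symMul, vecConj, vecMul, dotProduct, Fin.sum_univ_eight] <;> ring

/-- Extension by zero. -/
def pad {k : ℕ} (x : Fin k → ℝ) : Fin 8 → ℝ := fun i => if h : (i : ℕ) < k then x ⟨i, h⟩ else 0

theorem pad_add {k : ℕ} (x y : Fin k → ℝ) : pad (x + y) = pad x + pad y := by
  ext i
  simp only [pad, Pi.add_apply]
  split <;> simp

theorem pad_smul {k : ℕ} (c : ℝ) (x : Fin k → ℝ) : pad (c • x) = c • pad x := by
  ext i
  simp only [pad, Pi.smul_apply]
  split <;> simp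

/-- The first `k` components. -/
def trunc {k : ℕ} (hk : k ≤ 8) (v : Fin 8 → ℝ) : Fin k → ℝ := fun i => v (Fin.castLE hk i)

theorem trunc_pad {k : ℕ} (hk : k ≤ 8) (x : Fin k → ℝ) : trunc hk (pad x) = x := by
  ext i
  simp [trunc, pad]

theorem trunc_add {k : ℕ} (hk : k ≤ 8) (v w : Fin 8 → ℝ) :
    trunc hk (v + w) = trunc hk v + trunc hk w := rfl

theorem trunc_smul {k : ℕ} (hk : k ≤ 8) (c : ℝ) (v : Fin 8 → ℝ) :
    trunc hk (c • v) = c • trunc hk v := rfl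

theorem pad_dotProduct {k : ℕ} (hk : k ≤ 8) (x : Fin k → ℝ) (v : Fin 8 → ℝ) :
    pad x ⬝ᵥ v = x ⬝ᵥ trunc hk v := by
  have h := Finset.sum_map Finset.univ (Fin.castLEEmb hk) fun i => pad x i * v i
  simp only [dotProduct]
  rw [← Finset.sum_subset (Finset.subset_univ (Finset.univ.map (Fin.castLEEmb hk))), h]
  · refine Finset.sum_congr rfl fun i _ => ?_
    simp [trunc, pad]
  · intro i _ hi
    have : ¬ (i : ℕ) < k := fun hik => hi (by
      simp only [Finset.mem_map, Finset.mem_univ, true_and]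
      exact ⟨⟨i, hik⟩, rfl⟩)
    simp [pad, this]

/-- The vectors supported in the first `k` components. -/
def Supported (k : ℕ) (v : Fin 8 → ℝ) : Prop := ∀ i : Fin 8, k ≤ i → v i = 0

theorem Supported.pad_trunc {k : ℕ} (hk : k ≤ 8) {v : Fin 8 → ℝ} (hv : Supported k v) :
    pad (trunc hk v) = v := by
  ext i
  by_cases h : (i : ℕ) < k
  · simp [pad, trunc, h]
  · simp [pad, h, hv i (not_lt.1 h)]

theorem supported_pad {k : ℕ} (x : Fin k → ℝ) : Supported k (pad x) := fun i hi => by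
  simp [pad, not_lt.2 hi]

theorem Supported.vecConj {k : ℕ} {v : Fin 8 → ℝ} (hv : Supported k v) :
    Supported k (vecConj v) := by
  intro i hi
  have := hv i hi
  fin_cases i <;> simp_all [Octonion.vecConj]

/-- The first `k` components form a subalgebra. -/
def IsClosed (k : ℕ) : Prop :=
  ∀ x y : Fin 8 → ℝ, Supported k x → Supported k y → Supported k (symMul x y)

theorem isClosed_one : IsClosed 1 := by
  intro x y hx hy i hi
  have h : ∀ v : Fin 8 → ℝ, Supported 1 v → v 1 = 0 ∧ v 2 = 0 ∧ v 3 = 0 ∧ v 4 = 0 ∧ v 5 = 0 ∧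
      v 6 = 0 ∧ v 7 = 0 := fun v hv => ⟨hv 1 (by decide), hv 2 (by decide), hv 3 (by decide),
    hv 4 (by decide), hv 5 (by decide), hv 6 (by decide), hv 7 (by decide)⟩
  obtain ⟨a1, a2, a3, a4, a5, a6, a7⟩ := h x hx
  obtain ⟨b1, b2, b3, b4, b5, b6, b7⟩ := h y hy
  fin_cases i <;> simp_all [symMul, vecMul, Octonion.vecConj]

theorem isClosed_four : IsClosed 4 := by
  intro x y hx hy i hi
  have h : ∀ v : Fin 8 → ℝ, Supported 4 v → v 4 = 0 ∧ v 5 = 0 ∧ v 6 = 0 ∧ v 7 = 0 :=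
    fun v hv => ⟨hv 4 (by decide), hv 5 (by decide), hv 6 (by decide), hv 7 (by decide)⟩
  obtain ⟨a4, a5, a6, a7⟩ := h x hx
  obtain ⟨b4, b5, b6, b7⟩ := h y hy
  fin_cases i <;> simp_all [symMul, vecMul, Octonion.vecConj]

theorem isClosed_eight : IsClosed 8 := fun _ _ _ _ i hi => absurd i.2 (not_lt.2 hi)

end Octonion

/-- The symmetric composition algebra of dimension `k`. -/
def truncComp {k : ℕ} (hk : k ≤ 8) (hc : IsClosed k) : SymComp (EuclideanSpace ℝ (Fin k)) where
  mul := LinearMap.mk₂ ℝ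
    (fun x y => WithLp.toLp 2 (trunc hk (symMul (pad x.ofLp) (pad y.ofLp))))
    (fun x x' y => by
      rw [WithLp.ofLp_add, pad_add, symMul_add_left, trunc_add, WithLp.toLp_add])
    (fun c x y => by
      rw [WithLp.ofLp_smul, pad_smul, symMul_smul_left, trunc_smul, WithLp.toLp_smul])
    (fun x y y' => by
      rw [WithLp.ofLp_add, pad_add, symMul_add_right, trunc_add, WithLp.toLp_add])
    (fun c x y => by
      rw [WithLp.ofLp_smul, pad_smul, symMul_smul_right, trunc_smul, WithLp.toLp_smul])
  inner_mul x y z := by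
    simp only [LinearMap.mk₂_apply, EuclideanSpace.inner_eq_star_dotProduct, star_trivial]
    rw [dotProduct_comm _ x.ofLp, ← pad_dotProduct, ← pad_dotProduct,
      ← symMul_dotProduct (pad x.ofLp), dotProduct_comm]
  mul_mul_self x y := by
    simp only [LinearMap.mk₂_apply, EuclideanSpace.inner_eq_star_dotProduct, star_trivial]
    rw [(hc _ _ (supported_pad _) (supported_pad _)).pad_trunc, symMul_symMul_self,
      trunc_smul, trunc_pad, pad_dotProduct hk, trunc_pad, WithLp.toLp_smul]

theorem truncComp_mul {k : ℕ} (hk : k ≤ 8) (hc : IsClosed k) (x y : EuclideanSpace ℝ (Fin k)) :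
    (truncComp hk hc).mul x y = WithLp.toLp 2 (trunc hk (symMul (pad x.ofLp) (pad y.ofLp))) := rfl

namespace SymComp

variable {K : Type*} [NormedAddCommGroup K] [InnerProductSpace ℝ K] (m : SymComp K)

/-- This is three times the determinant, in a shape that can be compared with `upsilonForm_self_eq`.
-/
theorem form_cross_self_self (z : Herm K) : form (m.cross z z) z =
    3 * (z.1 0 * z.1 1 * z.1 2 - ∑ i, z.1 i * inner ℝ (z.2 i) (z.2 i)
      + 2 * inner ℝ (m.mul (z.2 2) (z.2 0)) (z.2 1)) := by
  have f1 : (1 + 1 : Fin 3) = 2 := rfl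
  have f2 : (1 + 2 : Fin 3) = 0 := rfl
  have f3 : (2 + 1 : Fin 3) = 0 := rfl
  have f4 : (2 + 2 : Fin 3) = 1 := rfl
  have h1 : ∀ i : Fin 3, (m.cross z z).2 i = m.mul (z.2 (i + 1)) (z.2 (i + 2)) - z.1 i • z.2 i := by
    intro i
    rw [cross_snd]
    module
  have h2 := m.inner_mul_cycle (z.2 2) (z.2 0) (z.2 1)
  have h3 := m.inner_mul_cycle (z.2 1) (z.2 2) (z.2 0)
  simp only [form_apply, Fin.sum_univ_three, cross_fst, h1, inner_sub_left,
    real_inner_smul_left, zero_add, f1, f2, f3, f4]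
  rw [h2, h3]
  ring

end SymComp

theorem eval_coordX {n : ℕ} (x : Fin n → ℝ) (I : ℕ) :
    eval x (coordX n I) = if h : 1 ≤ I ∧ I ≤ n then x ⟨I - 1, by omega⟩ else 0 := by
  unfold coordX
  split <;> simp

section Model

variable {n k : ℕ} (hk : k ≤ 8) (hc : IsClosed k)

/-- The components of `X¹`, `X²` and `X³` at a point. -/
def partVec (x : Fin n → ℝ) (i : Fin 3) : Fin 8 → ℝ := fun j => eval x (genericVec n i j)

/-- The diagonal entries at a point. -/
def partDiag (x : Fin n → ℝ) : Fin 3 → ℝ :=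
  ![eval x (coordX n 5) - √3 * eval x (coordX n 4), eval x (coordX n 5) + √3 * eval x (coordX n 4),
    -2 * eval x (coordX n 5)]

theorem eval_add_coordX (x y : Fin n → ℝ) (I : ℕ) :
    eval (x + y) (coordX n I) = eval x (coordX n I) + eval y (coordX n I) := by
  simp only [eval_coordX]
  split <;> simp

theorem eval_smul_coordX (c : ℝ) (x : Fin n → ℝ) (I : ℕ) :
    eval (c • x) (coordX n I) = c * eval x (coordX n I) := by
  simp only [eval_coordX]
  split <;> simp

theorem partVec_add (x y : Fin n → ℝ) : partVec (x + y) = partVec x + partVec y := by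
  ext i j
  fin_cases i <;> fin_cases j <;> exact eval_add_coordX x y _

theorem partVec_smul (c : ℝ) (x : Fin n → ℝ) : partVec (c • x) = c • partVec x := by
  ext i j
  fin_cases i <;> fin_cases j <;> exact eval_smul_coordX c x _

theorem partDiag_add (x y : Fin n → ℝ) : partDiag (x + y) = partDiag x + partDiag y := by
  ext i
  fin_cases i <;> simp [partDiag, eval_add_coordX] <;> ring

theorem partDiag_smul (c : ℝ) (x : Fin n → ℝ) : partDiag (c • x) = c • partDiag x := by
  ext i
  fin_cases i <;> simp [partDiag, eval_smul_coordX] <;> ring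

theorem vecConj_add (v w : Fin 8 → ℝ) : vecConj (v + w) = vecConj v + vecConj w := by
  ext i
  fin_cases i <;> simp [vecConj] <;> ring

theorem vecConj_smul (c : ℝ) (v : Fin 8 → ℝ) : vecConj (c • v) = c • vecConj v := by
  ext i
  fin_cases i <;> simp [vecConj]

/-- The trace-free hermitian matrix of a point. -/
def toHermMap (n : ℕ) : (Fin n → ℝ) →ₗ[ℝ] Herm (EuclideanSpace ℝ (Fin k)) where
  -- The middle entry is conjugated: the determinant contains Re((X³ X¹) conj X²), while the product
  -- of slots 2 and 0 is conj(X³ X¹), to be paired with slot 1.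
  toFun x := (partDiag x, ![√3 • WithLp.toLp 2 (trunc hk (partVec x 0)),
    √3 • WithLp.toLp 2 (trunc hk (vecConj (partVec x 1))),
    √3 • WithLp.toLp 2 (trunc hk (partVec x 2))])
  map_add' x y := by
    simp only [partDiag_add, partVec_add, Pi.add_apply, trunc_add, vecConj_add, WithLp.toLp_add,
      smul_add]
    refine Prod.ext rfl (funext fun i => ?_)
    fin_cases i <;> rfl
  map_smul' c x := by
    simp only [partDiag_smul, partVec_smul, Pi.smul_apply, trunc_smul, vecConj_smul,
      WithLp.toLp_smul, smul_comm (√3) c, RingHom.id_apply]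
    refine Prod.ext rfl (funext fun i => ?_)
    fin_cases i <;> rfl

theorem tr_toHermMap (x : Fin n → ℝ) : tr (toHermMap hk n x) = 0 := by
  rw [tr_apply]
  simp [toHermMap, partDiag]
  ring

theorem vecConj_dotProduct_self (v : Fin 8 → ℝ) : vecConj v ⬝ᵥ vecConj v = v ⬝ᵥ v := by
  simp [vecConj, dotProduct, Fin.sum_univ_eight]

theorem inner_toLp_trunc {v : Fin 8 → ℝ} (hv : Supported k v) (w : Fin 8 → ℝ) :
    inner ℝ (WithLp.toLp 2 (trunc hk w)) (WithLp.toLp 2 (trunc hk v)) = w ⬝ᵥ v := by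
  rw [EuclideanSpace.inner_eq_star_dotProduct, star_trivial, ← pad_dotProduct, hv.pad_trunc,
    dotProduct_comm]

theorem form_toHermMap {x : Fin n → ℝ} (hs : ∀ i, Supported k (partVec x i)) :
    form (toHermMap hk n x) (toHermMap hk n x) =
      6 * (eval x (coordX n 4) ^ 2 + eval x (coordX n 5) ^ 2 +
        ∑ i, partVec x i ⬝ᵥ partVec x i) := by
  have h3 : √3 * √3 = (3 : ℝ) := Real.mul_self_sqrt (by norm_num)
  rw [form_apply]
  simp only [toHermMap, LinearMap.coe_mk, AddHom.coe_mk, Fin.sum_univ_three, Matrix.cons_val_zero,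
    Matrix.cons_val_one, Matrix.cons_val, real_inner_smul_left, real_inner_smul_right,
    inner_toLp_trunc hk (hs _), inner_toLp_trunc hk (hs _).vecConj, vecConj_dotProduct_self]
  simp only [partDiag, Matrix.cons_val_zero, Matrix.cons_val_one, Matrix.cons_val]
  linear_combination (2 * eval x (coordX n 4) ^ 2 + 2 * ∑ i, partVec x i ⬝ᵥ partVec x i) * h3 +
    (-2 * (∑ i, partVec x i ⬝ᵥ partVec x i) + 2 * (partVec x 0 ⬝ᵥ partVec x 0 +
      partVec x 1 ⬝ᵥ partVec x 1 + partVec x 2 ⬝ᵥ partVec x 2)) * h3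

theorem det_toHermMap {x : Fin n → ℝ} (hs : ∀ i, Supported k (partVec x i)) :
    form ((truncComp hk hc).cross (toHermMap hk n x) (toHermMap hk n x)) (toHermMap hk n x) =
      6 * ((mulMat x *ᵥ x) ⬝ᵥ x) := by
  have h3 : √3 * √3 = (3 : ℝ) := Real.mul_self_sqrt (by norm_num)
  have hv : ∀ i, (fun j => eval x (genericVec n i j)) = partVec x i := fun _ => rfl
  rw [form_cross_self_self, ← upsilonForm_eq, upsilonForm_self_eq]
  simp only [toHermMap, LinearMap.coe_mk, AddHom.coe_mk, Fin.sum_univ_three, Matrix.cons_val_zero,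
    Matrix.cons_val_one, Matrix.cons_val, real_inner_smul_left, real_inner_smul_right, map_smul,
    LinearMap.smul_apply, truncComp_mul, (hs _).pad_trunc,
    inner_toLp_trunc hk (hs _), inner_toLp_trunc hk (hs _).vecConj, vecConj_dotProduct_self]
  simp only [partDiag, Matrix.cons_val_zero, Matrix.cons_val_one, Matrix.cons_val, hv]
  have hq : ∀ i, ∑ j, partVec x i j ^ 2 = partVec x i ⬝ᵥ partVec x i := fun i => by
    simp only [dotProduct, sq]
  have hd : ∀ v w : Fin 8 → ℝ, vecConj v ⬝ᵥ vecConj w = Octonion.vecMul v (vecConj w) 0 := by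
    intro v w
    simp [vecConj, Octonion.vecMul, dotProduct, Fin.sum_univ_eight]
  have hq' : ∀ i, ∑ j, eval x (genericVec n i j) ^ 2 = partVec x i ⬝ᵥ partVec x i := hq
  simp only [hq', symMul, hd]
  generalize Octonion.vecMul (Octonion.vecMul (partVec x 2) (partVec x 0)) (vecConj (partVec x 1))
      0 = t
  generalize partVec x 0 ⬝ᵥ partVec x 0 = a
  generalize partVec x 1 ⬝ᵥ partVec x 1 = b
  generalize partVec x 2 ⬝ᵥ partVec x 2 = c
  generalize eval x (coordX n 4) = p
  generalize eval x (coordX n 5) = q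
  generalize √3 = s at *
  linear_combination (-3 * (q - s * p) * a - 3 * (q + s * p) * b + 6 * q * c + 6 * s * t) * h3

/-- The model of the cubic form on `ℝⁿ`. -/
def hermModel (hn : n = 3 * k + 2) (hs : ∀ (x : Fin n → ℝ) i, Supported k (partVec x i))
    (hx : ∀ x : Fin n → ℝ, eval x (coordX n 4) ^ 2 + eval x (coordX n 5) ^ 2 +
      ∑ i, partVec x i ⬝ᵥ partVec x i = x ⬝ᵥ x) : HermModel n (truncComp hk hc) where
  toHerm := toHermMap hk n
  tr_toHerm := tr_toHermMap hk
  form_self x := by rw [form_toHermMap hk (hs x), hx]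
  det_self x := det_toHermMap hk hc (hs x)
  -- The norm identity gives injectivity; the range is then everything because n = 3k + 2 is the
  -- dimension of the trace-free matrices.
  surj z hz := by
    have hinj : Function.Injective (toHermMap (k := k) hk n) := by
      rw [injective_iff_map_eq_zero]
      intro x h0
      have := form_toHermMap hk (hs x)
      rw [hx, h0, map_zero] at this
      exact dotProduct_self_eq_zero.1 (by linarith)
    have hle : LinearMap.range (toHermMap (k := k) hk n) ≤
        LinearMap.ker (tr (K := EuclideanSpace ℝ (Fin k))) := by
      rintro _ ⟨x, rfl⟩
      exact tr_toHermMap hk x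
    have h1 : Module.finrank ℝ (LinearMap.range (toHermMap (k := k) hk n)) = n := by
      rw [LinearMap.finrank_range_of_inj hinj, Module.finrank_fin_fun]
    have h2 := (tr (K := EuclideanSpace ℝ (Fin k))).finrank_range_add_finrank_ker
    have h3 : LinearMap.range (tr (K := EuclideanSpace ℝ (Fin k))) = ⊤ := by
      rw [LinearMap.range_eq_top]
      intro r
      refine ⟨r • idem 0, ?_⟩
      simp [tr_apply, idem]
    rw [h3, finrank_top, Module.finrank_self] at h2
    have h4 : Module.finrank ℝ (Herm (EuclideanSpace ℝ (Fin k))) = 3 + 3 * k := by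
      simp [Module.finrank_pi_fintype]
    have : z ∈ LinearMap.range (toHermMap (k := k) hk n) := by
      rw [Submodule.eq_of_le_of_finrank_le hle (by omega)]
      exact hz
    exact this

end Model

/-- The model with real entries. -/
def hermModelFive : HermModel 5 (truncComp (by norm_num) isClosed_one) :=
  hermModel _ _ rfl
    (fun x i j hj => by
      fin_cases i <;> fin_cases j <;> first | (exact absurd hj (by decide)) | exact map_zero _)
    fun x => by
      simp [partVec, genericVec, eval_coordX, dotProduct, Fin.sum_univ_succ]
      ring

/-- The model with quaternionic entries. -/
def hermModelFourteen : HermModel 14 (truncComp (by norm_num) isClosed_four) :=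
  hermModel _ _ rfl
    (fun x i j hj => by
      fin_cases i <;> fin_cases j <;> first | (exact absurd hj (by decide)) | exact map_zero _)
    fun x => by
      simp [partVec, genericVec, eval_coordX, dotProduct, Fin.sum_univ_succ]
      ring

/-- The model with octonionic entries. -/
def hermModelTwentySix : HermModel 26 (truncComp le_rfl isClosed_eight) :=
  hermModel _ _ rfl (fun x i j hj => absurd j.2 (not_lt.2 hj))
    fun x => by
      simp [partVec, genericVec, eval_coordX, dotProduct, Fin.sum_univ_succ]
      ring

end

noncomputable section

open Herm SymComp

/-! ### The complex model -/

theorem complex_inner (z w : ℂ) : inner ℝ z w = z.re * w.re + z.im * w.im := by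
  rw [Complex.inner, Complex.mul_re, Complex.conj_re, Complex.conj_im]
  ring

/-- The symmetric composition algebra of the complex numbers. -/
def complexComp : SymComp ℂ where
  mul := LinearMap.mk₂ ℝ (fun x y => star (x * y))
    (fun x x' y => by rw [add_mul, star_add]) (fun c x y => by rw [smul_mul_assoc, star_smul]; simp)
    (fun x y y' => by rw [mul_add, star_add]) (fun c x y => by rw [mul_smul_comm, star_smul]; simp)
  inner_mul x y z := by
    simp
    ring
  mul_mul_self x y := by
    rw [complex_inner]
    apply Complex.ext <;> simp <;> ring

theorem complexComp_mul (x y : ℂ) : complexComp.mul x y = star (x * y) := rfl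

/-- The trace-free hermitian complex matrix of a point of `ℝ⁸`. -/
def complexHerm : (Fin 8 → ℝ) →ₗ[ℝ] Herm ℂ where
  toFun x := (![x 4 - √3 * x 3, x 4 + √3 * x 3, -2 * x 4],
    ![⟨√3 * x 0, √3 * x 5⟩, ⟨√3 * x 1, -(√3 * x 6)⟩, ⟨√3 * x 2, √3 * x 7⟩])
  map_add' x y := by
    refine Prod.ext (funext fun i => ?_) (funext fun i => ?_)
    · fin_cases i <;> simp <;> ring
    · fin_cases i <;> apply Complex.ext <;> simp <;> ring
  map_smul' c x := by
    refine Prod.ext (funext fun i => ?_) (funext fun i => ?_)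
    · fin_cases i <;> simp <;> ring
    · fin_cases i <;> apply Complex.ext <;> simp <;> ring

/-- The model with complex entries. -/
def hermModelEight : HermModel 8 complexComp where
  toHerm := complexHerm
  tr_toHerm x := by
    rw [tr_apply]
    simp [complexHerm]
    ring
  form_self x := by
    have h3 : √3 * √3 = (3 : ℝ) := Real.mul_self_sqrt (by norm_num)
    simp only [form_apply, complexHerm, Fin.sum_univ_three, complex_inner, LinearMap.coe_mk,
      AddHom.coe_mk, Matrix.cons_val_zero, Matrix.cons_val_one, Matrix.cons_val, dotProduct,
      Fin.sum_univ_eight]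
    linear_combination (2 * (x 0 ^ 2 + x 1 ^ 2 + x 2 ^ 2 + x 3 ^ 2 + x 5 ^ 2 + x 6 ^ 2 +
      x 7 ^ 2)) * h3
  det_self x := by
    have h3 : √3 * √3 = (3 : ℝ) := Real.mul_self_sqrt (by norm_num)
    rw [form_cross_self_self, ← upsilonForm_eq, upsilonForm_self_eq]
    simp only [complexHerm, Fin.sum_univ_three, complex_inner, LinearMap.coe_mk,
      AddHom.coe_mk, Matrix.cons_val_zero, Matrix.cons_val_one, Matrix.cons_val, complexComp_mul,
      Complex.star_def, Complex.conj_re, Complex.conj_im, Complex.mul_re, Complex.mul_im]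
    simp [genericVec, eval_coordX, Fin.sum_univ_eight, Octonion.vecMul, Octonion.vecConj]
    generalize √3 = s at *
    linear_combination (-3 * (x 4 - s * x 3) * (x 0 ^ 2 + x 5 ^ 2)
      - 3 * (x 4 + s * x 3) * (x 1 ^ 2 + x 6 ^ 2) + 6 * x 4 * (x 2 ^ 2 + x 7 ^ 2)
      + 6 * s * ((x 2 * x 0 - x 7 * x 5) * x 1 + (x 2 * x 5 + x 7 * x 0) * x 6)) * h3
  surj z hz := by
    have h0 : √3 ≠ (0 : ℝ) := by positivity
    refine ⟨![(z.2 0).re / √3, (z.2 1).re / √3, (z.2 2).re / √3, (z.1 1 - z.1 0) / (2 * √3),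
      -(z.1 2) / 2, (z.2 0).im / √3, -(z.2 1).im / √3, (z.2 2).im / √3], ?_⟩
    rw [tr_apply] at hz
    refine Prod.ext (funext fun i => ?_) (funext fun i => ?_)
    · fin_cases i <;> simp [complexHerm] <;> field_simp <;> linarith
    · fin_cases i <;> apply Complex.ext <;> simp [complexHerm] <;> field_simp

/-- Multiplication by the imaginary unit. -/
def mulI : ℂ →ₗ[ℝ] ℂ := LinearMap.mulLeft ℝ Complex.I

theorem mulI_apply (z : ℂ) : mulI z = Complex.I * z := rfl

/-- The diagonal part of the derivations `w ↦ i [z, w]` for diagonal `z`. -/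
def hermBracketDiag : Herm ℂ →ₗ[ℝ] (Fin 3 → ℂ →ₗ[ℝ] ℂ) where
  toFun z i := (z.1 (i + 2) - z.1 (i + 1)) • mulI
  map_add' z w := by
    ext1 i
    simp only [Prod.fst_add, Pi.add_apply]
    module
  map_smul' c z := by
    ext1 i
    simp only [Prod.smul_fst, Pi.smul_apply, smul_eq_mul, RingHom.id_apply]
    module

/-- The derivations `w ↦ i [z, w]` in the complex model. -/
def hermBracket : Herm ℂ →ₗ[ℝ] Herm ℂ →ₗ[ℝ] Herm ℂ :=
  (∑ i, complexComp.rot i ∘ₗ mulI ∘ₗ (LinearMap.proj i : (Fin 3 → ℂ) →ₗ[ℝ] ℂ) ∘ₗ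
    LinearMap.snd ℝ (Fin 3 → ℝ) (Fin 3 → ℂ)) +
    diagDer ∘ₗ hermBracketDiag

theorem hermBracket_apply (z : Herm ℂ) : hermBracket z =
    ∑ i, complexComp.rot i (mulI (z.2 i)) +
      diagDer fun i => (z.1 (i + 2) - z.1 (i + 1)) • mulI := by
  rw [hermBracket, LinearMap.add_apply, LinearMap.sum_apply]
  rfl

theorem hermBracket_mem_der (z : Herm ℂ) : hermBracket z ∈ complexComp.der := by
  rw [hermBracket_apply]
  refine Submodule.add_mem _ (Submodule.sum_mem _ fun i _ => complexComp.rot_mem_der _ _)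
    (complexComp.diagDer_mem_der ⟨fun i x => ?_, fun i x y w => ?_⟩)
  · simp [mulI_apply]
    ring
  · obtain ⟨c1, c2, c3, c4, -⟩ := cycle_simps i
    simp only [c1, c2, c3, c4]
    simp [mulI_apply, complexComp_mul]
    ring

theorem hermBracket_fst (z w : Herm ℂ) (j : Fin 3) : (hermBracket z w).1 j =
    2 * inner ℝ (w.2 (j + 1)) (mulI (z.2 (j + 1))) -
      2 * inner ℝ (w.2 (j + 2)) (mulI (z.2 (j + 2))) := by
  obtain ⟨c1, c2, c3, c4, c5, c6, c7⟩ := cycle_simps j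
  rw [hermBracket_apply, LinearMap.add_apply, LinearMap.sum_apply, Prod.fst_add, Prod.fst_sum,
    Pi.add_apply, Finset.sum_apply, sum_eq_cycle _ j, diagDer_fst]
  simp only [rot_fst, c1, c3, c5.symm, c6.symm, if_true, if_false]
  ring

theorem hermBracket_snd (z w : Herm ℂ) (j : Fin 3) : (hermBracket z w).2 j =
    (w.1 (j + 1) - w.1 (j + 2)) • mulI (z.2 j) - complexComp.mul (mulI (z.2 (j + 1))) (w.2 (j + 2))
      + complexComp.mul (w.2 (j + 1)) (mulI (z.2 (j + 2)))
      + (z.1 (j + 2) - z.1 (j + 1)) • mulI (w.2 j) := by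
  obtain ⟨c1, c2, c3, c4, c5, c6, c7⟩ := cycle_simps j
  rw [hermBracket_apply, LinearMap.add_apply, LinearMap.sum_apply, Prod.snd_add, Prod.snd_sum,
    Pi.add_apply, Finset.sum_apply, sum_eq_cycle _ j, diagDer_snd]
  simp only [rot_snd, c1, c2, c3, c4, c5.symm, c6.symm, if_true, if_false, LinearMap.smul_apply]
  abel

theorem hermBracket_self (z : Herm ℂ) : hermBracket z z = 0 := by
  refine Prod.ext (funext fun j => ?_) (funext fun j => ?_)
  · rw [hermBracket_fst]
    simp [mulI_apply]
    ring
  · rw [hermBracket_snd]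
    simp [mulI_apply, complexComp_mul]
    ring

/-- Multiplication by i is the solution of the relations in `eq_zero_of_central` that exists only in
dimension two. -/
theorem rotCoeff_hermBracket (i : Fin 3) : rotCoeff hermBracket i = mulI := by
  refine LinearMap.ext fun X => ?_
  obtain ⟨c1, c2, c3, c4, c5, c6, c7⟩ := cycle_simps i
  rw [rotCoeff_apply, hermBracket_snd]
  simp [off_snd, idem_fst, idem_snd, off_fst, c7]

/-- Families of derivations with `D_z z = 0` are multiples of the hermBracket. -/
theorem exists_smul_hermBracket {D : Herm ℂ →ₗ[ℝ] Herm ℂ →ₗ[ℝ] Herm ℂ}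
    (hD : ∀ z, D z ∈ complexComp.der) (hD0 : ∀ z, D z z = 0) : ∃ c : ℝ, D = c • hermBracket := by
  have hs := rotCoeff_skew hD hD0 0
  -- A skew endomorphism of ℂ is multiplication by an imaginary number, read off at 1, and the
  -- coefficient on slot 0 determines the family.
  refine ⟨(rotCoeff D 0 1).im, sub_eq_zero.1 (family_eq_zero_of_rotCoeff (m := complexComp)
    (fun z => ?_) (fun z => ?_) (LinearMap.ext fun X => ?_))⟩
  · exact Submodule.sub_mem _ (hD z) (Submodule.smul_mem _ _ (hermBracket_mem_der z))
  · simp [hD0, hermBracket_self]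
  · have h1 : rotCoeff (D - (rotCoeff D 0 1).im • hermBracket) 0 X =
        rotCoeff D 0 X - (rotCoeff D 0 1).im • rotCoeff hermBracket 0 X := rfl
    have hX : X = X.re • 1 + X.im • Complex.I := by
      apply Complex.ext <;> simp
    have e1 := hs 1
    have e2 := hs Complex.I
    have e3 := hs (1 + Complex.I)
    simp only [map_add, complex_inner, Complex.one_re, Complex.one_im, Complex.I_re, Complex.I_im,
      Complex.add_re, Complex.add_im] at e1 e2 e3
    rw [h1, rotCoeff_hermBracket, mulI_apply, LinearMap.zero_apply]
    have h2 : rotCoeff D 0 X = X.re • rotCoeff D 0 1 + X.im • rotCoeff D 0 Complex.I := by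
      conv_lhs => rw [hX, map_add, map_smul, map_smul]
    rw [h2]
    apply Complex.ext
    · simp
      linear_combination X.re * e1 + X.im * (e3 - e1 - e2)
    · simp
      linear_combination X.im * e2

end

noncomputable section

open Herm SymComp

/-! ### The invariant three-form on `ℝ⁸` -/

/-- The family of endomorphisms of `ℝⁿ` induced by a family of endomorphisms. -/
def HermModel.ofHermFamily {K : Type*} [NormedAddCommGroup K] [InnerProductSpace ℝ K]
    {m : SymComp K} {n : ℕ} (H : HermModel n m) (D : Herm K →ₗ[ℝ] Herm K →ₗ[ℝ] Herm K) :
    (Fin n → ℝ) →ₗ[ℝ] Matrix (Fin n) (Fin n) ℝ :=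
  LinearMap.toMatrix'.toLinearMap ∘ₗ (LinearMap.llcomp ℝ (Fin n → ℝ) (Herm K)
    (Fin n → ℝ) H.ofHerm) ∘ₗ (LinearMap.lcomp ℝ (Herm K) H.toHerm) ∘ₗ D ∘ₗ H.toHerm

theorem HermModel.ofHermFamily_apply {K : Type*} [NormedAddCommGroup K] [InnerProductSpace ℝ K]
    {m : SymComp K} {n : ℕ} (H : HermModel n m) (D : Herm K →ₗ[ℝ] Herm K →ₗ[ℝ] Herm K)
    (x : Fin n → ℝ) : H.ofHermFamily D x =
      LinearMap.toMatrix' (H.ofHerm ∘ₗ D (H.toHerm x) ∘ₗ H.toHerm) := rfl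

/-- The family of derivations of `ℝ⁸` induced by the commutator. -/
def bracketMap : (Fin 8 → ℝ) →ₗ[ℝ] Matrix (Fin 8) (Fin 8) ℝ :=
  hermModelEight.ofHermFamily hermBracket

theorem bracketMap_mem (x : Fin 8 → ℝ) : bracketMap x ∈ stabLie 8 := by
  rw [bracketMap, HermModel.ofHermFamily_apply]
  exact hermModelEight.ofHerm_der_mem (hermBracket_mem_der _)

theorem bracketMap_mulVec (x y : Fin 8 → ℝ) : bracketMap x *ᵥ y =
    hermModelEight.ofHerm (hermBracket (hermModelEight.toHerm x) (hermModelEight.toHerm y)) := by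
  rw [bracketMap, HermModel.ofHermFamily_apply, HermModel.toMatrix_ofHerm_mulVec]

theorem toHerm_bracketMap_mulVec (x y : Fin 8 → ℝ) : hermModelEight.toHerm (bracketMap x *ᵥ y) =
    hermBracket (hermModelEight.toHerm x) (hermModelEight.toHerm y) := by
  rw [bracketMap_mulVec, hermModelEight.toHerm_ofHerm_of_tr ((hermBracket_mem_der _).1 _)]

theorem bracketMap_self (x : Fin 8 → ℝ) : bracketMap x *ᵥ x = 0 := by
  rw [bracketMap_mulVec, hermBracket_self, map_zero]

/-- The invariant three-form on `ℝ⁸`. -/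
def bracketTensor : wedgeTwoTensor 8 :=
  mkTensor bracketMap fun x => stabLie_transpose (bracketMap_mem x)

theorem slice_bracketTensor : slice bracketTensor.1 = bracketMap := slice_mkTensor _ _

theorem bracketTensor_ne_zero : bracketTensor ≠ 0 := by
  intro h
  have h1 : bracketMap = 0 := by
    rw [← slice_bracketTensor, h]
    ext
    simp [slice]
  obtain ⟨x, hx⟩ := hermModelEight.surj (off 0 1) (by simp [tr_apply, off_fst])
  obtain ⟨y, hy⟩ := hermModelEight.surj (idem 1 - idem 0) (by simp [tr_apply, idem_fst])
  have h2 := toHerm_bracketMap_mulVec x y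
  rw [h1, LinearMap.zero_apply, zero_mulVec, map_zero, hx, hy] at h2
  have h3 := congrArg (fun z : Herm ℂ => (z.2 0).im) h2
  simp [hermBracket_snd, mulI_apply, off_snd, off_fst, idem_fst, idem_snd] at h3

theorem inf_eq_span_bracketTensor :
    stabLieTensor 8 ⊓ wedgeThree 8 = Submodule.span ℝ {bracketTensor} := by
  refine le_antisymm ?_ ?_
  · rintro Γ ⟨h1, h2⟩
    obtain ⟨c, hc⟩ := exists_smul_hermBracket (D := hermModelEight.liftFamily (slice Γ.1))
      (fun z => hermModelEight.lift_mem_der (mem_stabLieTensor_iff.1 h1 _))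
      fun z => by rw [HermModel.liftFamily_apply, mem_wedgeThree_iff.1 h2, map_zero]
    refine Submodule.mem_span_singleton.2 ⟨c, wedgeTwoTensor_ext fun x => eq_of_mulVec fun y => ?_⟩
    have h3 := hermModelEight.liftFamily_apply (slice Γ.1) (hermModelEight.toHerm x)
      (hermModelEight.toHerm y)
    rw [hc, HermModel.ofHerm_toHerm, HermModel.ofHerm_toHerm] at h3
    have h4 := congrArg hermModelEight.ofHerm h3
    rw [HermModel.ofHerm_toHerm] at h4
    rw [← h4, Submodule.coe_smul, slice_smul, slice_bracketTensor,
      smul_mulVec, bracketMap_mulVec, LinearMap.smul_apply, LinearMap.smul_apply, map_smul]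
  · rw [Submodule.span_singleton_le_iff_mem]
    refine ⟨mem_stabLieTensor_iff.2 fun x => ?_, mem_wedgeThree_iff.2 fun x => ?_⟩
    · rw [slice_bracketTensor]
      exact bracketMap_mem x
    · rw [slice_bracketTensor]
      exact bracketMap_self x

theorem finrank_inf_eight : Module.finrank ℝ ↥(stabLieTensor 8 ⊓ wedgeThree 8) = 1 := by
  rw [inf_eq_span_bracketTensor]
  exact finrank_span_singleton bracketTensor_ne_zero

/-! ### Invariance up to sign -/

theorem sum_sq_mulVec {n : ℕ} {h : Matrix (Fin n) (Fin n) ℝ} (hh : hᵀ * h = 1) (v : Fin n → ℝ) :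
    ∑ I, (h *ᵥ v) I ^ 2 = ∑ I, v I ^ 2 := by
  have : (h *ᵥ v) ⬝ᵥ (h *ᵥ v) = v ⬝ᵥ v := by
    rw [dotProduct_mulVec, ← mulVec_transpose, mulVec_mulVec, hh, one_mulVec]
  simpa only [dotProduct, sq] using this

theorem tensorAct_apply {n : ℕ} (h : Matrix (Fin n) (Fin n) ℝ) (Γ : Fin n → Fin n → Fin n → ℝ)
    (M J I : Fin n) : tensorAct h Γ M J I =
      (h *ᵥ fun A => (h *ᵥ fun B => (h *ᵥ fun C => Γ A B C) I) J) M := by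
  simp only [tensorAct, mulVec, dotProduct, Finset.mul_sum, mul_assoc]

theorem sum_sq_tensorAct {n : ℕ} {h : Matrix (Fin n) (Fin n) ℝ} (hh : hᵀ * h = 1)
    (Γ : Fin n → Fin n → Fin n → ℝ) :
    ∑ I, ∑ J, ∑ M, tensorAct h Γ M J I ^ 2 = ∑ I, ∑ J, ∑ M, Γ M J I ^ 2 := by
  simp only [tensorAct_apply, sum_sq_mulVec hh]
  rw [Finset.sum_congr rfl fun I _ => Finset.sum_comm]
  simp only [sum_sq_mulVec hh]
  rw [Finset.sum_comm, Finset.sum_congr rfl fun I _ => Finset.sum_comm]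
  simp only [sum_sq_mulVec hh]
  rw [Finset.sum_congr rfl fun J _ => Finset.sum_comm, Finset.sum_comm]
  exact Finset.sum_congr rfl fun I _ => Finset.sum_comm

theorem tensorAct_mem {n : ℕ} {h : specialOrthogonalGroup (Fin n) ℝ} (hh : h ∈ stabGroup n)
    {Γ : wedgeTwoTensor n} (hΓ : Γ ∈ stabLieTensor n ⊓ wedgeThree n) :
    ∃ Δ ∈ stabLieTensor n ⊓ wedgeThree n, Δ.1 = tensorAct h.1 Γ.1 := by
  have h0 : tensorAct h.1 Γ.1 ∈ wedgeTwoTensor n := mem_wedgeTwoTensor_iff.2 fun x => by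
    rw [slice_tensorAct, transpose_mul, transpose_mul, transpose_transpose, slice_transpose,
      Matrix.neg_mul, Matrix.mul_neg, Matrix.mul_assoc]
  refine ⟨⟨_, h0⟩, ⟨mem_stabLieTensor_iff.2 fun x => ?_, mem_wedgeThree_iff.2 fun x => ?_⟩, rfl⟩
  · rw [slice_tensorAct]
    exact conj_mem_stabLie hh (mem_stabLieTensor_iff.1 hΓ.1 _)
  · rw [slice_tensorAct, ← mulVec_mulVec, ← mulVec_mulVec, mem_wedgeThree_iff.1 hΓ.2, mulVec_zero]

/-- The group preserves the line spanned by the three-form and acts orthogonally on tensors, so the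
factor has square 1. -/
theorem exists_tensorAct_bracketTensor {h : specialOrthogonalGroup (Fin 8) ℝ}
    (hh : h ∈ stabGroup 8) :
    tensorAct h.1 bracketTensor.1 = bracketTensor.1 ∨
      tensorAct h.1 bracketTensor.1 = -bracketTensor.1 := by
  have hmem : bracketTensor ∈ stabLieTensor 8 ⊓ wedgeThree 8 := by
    rw [inf_eq_span_bracketTensor]
    exact Submodule.mem_span_singleton_self _
  obtain ⟨Δ, hΔ, hΔ'⟩ := tensorAct_mem hh hmem
  rw [inf_eq_span_bracketTensor] at hΔ
  obtain ⟨c, rfl⟩ := Submodule.mem_span_singleton.1 hΔ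
  have h1 := sum_sq_tensorAct (specialOrthogonal_transpose_mul h) bracketTensor.1
  rw [← hΔ'] at h1 ⊢
  simp only [Submodule.coe_smul, Pi.smul_apply, smul_eq_mul, mul_pow, ← Finset.mul_sum] at h1
  have h2 : ∑ I, ∑ J, ∑ M, bracketTensor.1 M J I ^ 2 ≠ 0 := by
    intro h0
    refine bracketTensor_ne_zero (Subtype.ext (funext fun M => funext fun J => funext fun I => ?_))
    rw [Finset.sum_eq_zero_iff_of_nonneg fun _ _ => by positivity] at h0
    have h3 := h0 I (Finset.mem_univ _)
    rw [Finset.sum_eq_zero_iff_of_nonneg fun _ _ => by positivity] at h3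
    have h4 := h3 J (Finset.mem_univ _)
    rw [Finset.sum_eq_zero_iff_of_nonneg fun _ _ => by positivity] at h4
    exact pow_eq_zero_iff two_ne_zero |>.1 (h4 M (Finset.mem_univ _))
  have h3 : (c - 1) * (c + 1) = 0 := by
    have := mul_right_cancel₀ h2 (h1.trans (one_mul _).symm)
    linear_combination this
  rcases mul_eq_zero.1 h3 with h4 | h4
  · left
    rw [sub_eq_zero.1 h4, Submodule.coe_smul, one_smul]
  · right
    rw [eq_neg_of_add_eq_zero_left h4, Submodule.coe_smul, neg_one_smul]

/-- The sign by which an automorphism acts on the invariant three-form. -/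
def HasSign (h : Matrix (Fin 8) (Fin 8) ℝ) (c : ℝ) : Prop :=
  ∀ x, h * bracketMap x = c • (bracketMap (h *ᵥ x) * h)

theorem HasSign.mul {h k : Matrix (Fin 8) (Fin 8) ℝ} {c d : ℝ} (hh : HasSign h c)
    (hk : HasSign k d) : HasSign (h * k) (c * d) := by
  intro x
  rw [Matrix.mul_assoc, hk, Matrix.mul_smul, ← Matrix.mul_assoc, hh, Matrix.smul_mul, smul_smul,
    mulVec_mulVec, Matrix.mul_assoc, mul_comm d]

theorem hasSign_iff {h : specialOrthogonalGroup (Fin 8) ℝ} {c : ℝ} : HasSign h.1 c ↔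
    tensorAct h.1 bracketTensor.1 = c • bracketTensor.1 := by
  have e1 := specialOrthogonal_transpose_mul h
  have e2 := specialOrthogonal_mul_transpose h
  constructor
  · intro hh
    rw [← toTensor_slice (tensorAct _ _), ← toTensor_slice (c • bracketTensor.1)]
    congr 1
    refine LinearMap.ext fun x => ?_
    rw [slice_tensorAct, slice_smul, slice_bracketTensor, hh,
      mulVec_mulVec, e2, one_mulVec, Matrix.smul_mul, Matrix.mul_assoc, e2, Matrix.mul_one]
  · intro hh x
    have := slice_tensorAct h.1 bracketTensor.1 (h.1 *ᵥ x)
    rw [hh, slice_smul, slice_bracketTensor, mulVec_mulVec, e1,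
      one_mulVec] at this
    rw [← Matrix.smul_mul, this, Matrix.mul_assoc, e1, Matrix.mul_one]

theorem hasSign_or {h : specialOrthogonalGroup (Fin 8) ℝ} (hh : h ∈ stabGroup 8) :
    HasSign h.1 1 ∨ HasSign h.1 (-1) := by
  rw [hasSign_iff, hasSign_iff, one_smul, neg_one_smul]
  exact exists_tensorAct_bracketTensor hh

/-- Signs multiply, and `exp (t D)` is the square of `exp ((t / 2) D)` in the group. -/
theorem hasSign_exp {D : Matrix (Fin 8) (Fin 8) ℝ} (hD : D ∈ stabLie 8) (t : ℝ) :
    HasSign (NormedSpace.exp (t • D)) 1 := by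
  obtain ⟨h, hh, he⟩ := hD (t / 2)
  have h1 : NormedSpace.exp (t • D) = h.1 * h.1 := by
    rw [he, ← Matrix.exp_add_of_commute _ _ (Commute.refl _), ← add_smul, add_halves]
  rw [h1]
  rcases hasSign_or hh with h2 | h2
  · simpa using h2.mul h2
  · simpa using h2.mul h2

end

noncomputable section

open Herm SymComp

/-! ### Moving an element into a fixed position -/

/-- First and second order conditions at a maximum. -/
theorem deriv_conditions_of_max {f f' : ℝ → ℝ} {c : ℝ} (hf : ∀ t, HasDerivAt f (f' t) t)
    (hf' : HasDerivAt f' c 0) (hmax : ∀ t, f t ≤ f 0) : f' 0 = 0 ∧ c ≤ 0 := by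
  have hloc : IsLocalMax f 0 := Filter.Eventually.of_forall hmax
  have h0 : f' 0 = 0 := hloc.hasDerivAt_eq_zero (hf 0)
  refine ⟨h0, le_of_not_gt fun hc => ?_⟩
  have hd : deriv f = f' := funext fun t => (hf t).deriv
  -- A positive second derivative would make the maximum a local minimum too; then f is locally
  -- constant and its second derivative is zero.
  have hmin : IsLocalMin f 0 := isLocalMin_of_deriv_deriv_pos (by rwa [hd, hf'.deriv])
    (by rw [hd, h0]) (hf 0).continuousAt
  have hc' : f =ᶠ[nhds 0] fun _ => f 0 := by
    filter_upwards [hmin] with t ht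
    exact le_antisymm (hmax t) ht
  have h1 : deriv (deriv f) 0 = 0 := by
    rw [hc'.deriv.deriv_eq]
    simp
  rw [hd, hf'.deriv] at h1
  exact hc.ne' h1

theorem hasDerivAt_exp_dotProduct {n : ℕ} (D : Matrix (Fin n) (Fin n) ℝ) (y x : Fin n → ℝ)
    (t : ℝ) : HasDerivAt (fun u : ℝ => (NormedSpace.exp (u • D) *ᵥ y) ⬝ᵥ x)
      ((D *ᵥ (NormedSpace.exp (t • D) *ᵥ y)) ⬝ᵥ x) t := by
  simp only [dotProduct]
  exact HasDerivAt.fun_sum fun i _ => (hasDerivAt_exp_mulVec D y t i).mul_const (x i)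

theorem exp_conditions_of_max {n : ℕ} {D : Matrix (Fin n) (Fin n) ℝ} {x y : Fin n → ℝ}
    (hmax : ∀ t : ℝ, (NormedSpace.exp (t • D) *ᵥ y) ⬝ᵥ x ≤ y ⬝ᵥ x) :
    (D *ᵥ y) ⬝ᵥ x = 0 ∧ (D *ᵥ (D *ᵥ y)) ⬝ᵥ x ≤ 0 := by
  have h0 : NormedSpace.exp ((0 : ℝ) • D) *ᵥ y = y := by
    rw [zero_smul, NormedSpace.exp_zero, one_mulVec]
  have hs : ∀ v : Fin n → ℝ, (D *ᵥ v) ⬝ᵥ x = v ⬝ᵥ (Dᵀ *ᵥ x) := fun v => by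
    rw [mulVec_transpose, dotProduct_comm, dotProduct_mulVec, dotProduct_comm]
  have h2 := hasDerivAt_exp_dotProduct D y (Dᵀ *ᵥ x) 0
  simp only [← hs, h0] at h2
  have := deriv_conditions_of_max (hasDerivAt_exp_dotProduct D y x) h2 (by simpa [h0] using hmax)
  rwa [h0] at this

/-- The automorphisms of positive sign. -/
def signKer : Set (Matrix (Fin 8) (Fin 8) ℝ) :=
  {k | (∃ h ∈ stabGroup 8, h.1 = k) ∧ HasSign k 1}

theorem one_mem_signKer : (1 : Matrix (Fin 8) (Fin 8) ℝ) ∈ signKer :=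
  ⟨⟨1, one_mem _, rfl⟩, fun x => by rw [one_mulVec, one_smul, Matrix.one_mul, Matrix.mul_one]⟩

theorem exp_mul_mem_signKer {D k : Matrix (Fin 8) (Fin 8) ℝ} (hD : D ∈ stabLie 8)
    (hk : k ∈ signKer) (t : ℝ) : NormedSpace.exp (t • D) * k ∈ signKer := by
  obtain ⟨⟨h, hh, rfl⟩, hk'⟩ := hk
  obtain ⟨g, hg, hge⟩ := hD t
  refine ⟨⟨g * h, mul_mem hg hh, by rw [← hge]; rfl⟩, ?_⟩
  have := (hasSign_exp hD t).mul hk'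
  rwa [one_mul] at this

/-- Entries of orthogonal matrices are bounded by 1, and all defining conditions are closed. -/
theorem isCompact_signKer : IsCompact signKer := by
  have hsub : signKer ⊆ Set.univ.pi fun _ : Fin 8 => Set.univ.pi fun _ : Fin 8 =>
      Set.Icc (-1 : ℝ) 1 := by
    rintro k ⟨⟨h, hh, rfl⟩, -⟩ i _ j _
    have := entry_norm_bound_of_unitary (mem_specialOrthogonalGroup_iff.1 h.2).1 i j
    rwa [Real.norm_eq_abs, abs_le] at this
  refine IsCompact.of_isClosed_subset (isCompact_univ_pi fun _ => isCompact_univ_pi fun _ =>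
    isCompact_Icc) ?_ hsub
  have heq : signKer = {k | k * kᵀ = 1} ∩ {k | k.det = 1} ∩
      (⋂ x, ⋂ y, ⋂ z, {k | upsilonForm 8 (k *ᵥ x) (k *ᵥ y) (k *ᵥ z) = upsilonForm 8 x y z}) ∩
      ⋂ x, {k | k * bracketMap x = bracketMap (k *ᵥ x) * k} := by
    ext k
    simp only [signKer, HasSign, one_smul, Set.mem_inter_iff, Set.mem_iInter, Set.mem_ofPred_eq]
    refine and_congr_left fun _ => ⟨?_, ?_⟩
    · rintro ⟨h, hh, rfl⟩
      exact ⟨⟨specialOrthogonal_mul_transpose h, (mem_specialOrthogonalGroup_iff.1 h.2).2⟩, hh⟩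
    · rintro ⟨⟨h1, h2⟩, h3⟩
      exact ⟨⟨k, mem_specialOrthogonalGroup_iff.2 ⟨(mem_orthogonalGroup_iff _ _).2 h1, h2⟩⟩, h3,
          rfl⟩
  have hv : ∀ x : Fin 8 → ℝ, Continuous fun k : Matrix (Fin 8) (Fin 8) ℝ => k *ᵥ x := fun x =>
    continuous_id.matrix_mulVec continuous_const
  have hvi : ∀ (x : Fin 8 → ℝ) i, Continuous fun k : Matrix (Fin 8) (Fin 8) ℝ => (k *ᵥ x) i :=
    fun x i => (continuous_apply i).comp (hv x)
  rw [heq]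
  refine (((isClosed_eq (continuous_id.matrix_mul continuous_id.matrix_transpose)
    continuous_const).inter (isClosed_eq continuous_id.matrix_det continuous_const)).inter
    (isClosed_iInter fun x => isClosed_iInter fun y => isClosed_iInter fun z => isClosed_eq ?_
      continuous_const)).inter
    (isClosed_iInter fun x => isClosed_eq (continuous_id.matrix_mul continuous_const)
      (Continuous.matrix_mul ?_ continuous_id))
  · simp only [upsilonForm]
    exact continuous_finsetSum _ fun I _ => continuous_finsetSum _ fun J _ =>
      continuous_finsetSum _ fun K _ => ((continuous_const.mul (hvi x I)).mul (hvi y J)).mul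
        (hvi z K)
  · exact bracketMap.continuous_of_finiteDimensional.comp (hv x)

/-- The diagonal matrix `diag(1, 0, -1)`. -/
def regularDiag : Herm ℂ := (![1, 0, -1], 0)

theorem form_rot_regularDiag (i : Fin 3) (d : ℂ) (z : Herm ℂ) :
    form (complexComp.rot i d z) regularDiag =
      -2 * inner ℝ (z.2 i) d * (regularDiag.1 (i + 1) - regularDiag.1 (i + 2)) := by
  obtain ⟨c1, c2, c3, c4, c5, c6, c7⟩ := cycle_simps i
  have h : ∀ j, regularDiag.2 j = 0 := fun j => rfl
  rw [form_apply, sum_eq_cycle _ i]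
  simp only [rot_fst, h, inner_zero_right, c5, c6, c7, if_true, if_false]
  ring

/-- An element with the invariants of `diag(1, 0, -1)` that is aligned with it to second order. -/
theorem eq_regularDiag {z : Herm ℂ} (htr : tr z = 0) (hn : form z z = 2)
    (hc : form (complexComp.cross z z) z = 0)
    (h1 : ∀ i d, form (complexComp.rot i d z) regularDiag = 0)
    (h2 : ∀ i d, form (complexComp.rot i d (complexComp.rot i d z)) regularDiag ≤ 0) :
    z = regularDiag := by
  have hr : ∀ i : Fin 3, regularDiag.1 (i + 1) - regularDiag.1 (i + 2) ≠ 0 := by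
    intro i
    match i with
    | 0 => exact show (0 : ℝ) - -1 ≠ 0 by norm_num
    | 1 => exact show (-1 : ℝ) - 1 ≠ 0 by norm_num
    | 2 => exact show (1 : ℝ) - 0 ≠ 0 by norm_num
  -- The entries 1, 0, -1 are distinct, so the first-order conditions kill every off-diagonal entry.
  have hz : ∀ i, z.2 i = 0 := fun i => by
    have := h1 i (z.2 i)
    rw [form_rot_regularDiag] at this
    exact inner_self_eq_zero.1 ((mul_eq_zero.1 ((mul_eq_zero.1 this).resolve_right
      (hr i))).resolve_left (by norm_num))
  -- The second-order conditions say that the diagonal of z is ordered like 1, 0, -1; otherwise a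
  -- permutation of it would still be possible.
  have ho : ∀ i, 0 ≤ (z.1 (i + 1) - z.1 (i + 2)) *
      (regularDiag.1 (i + 1) - regularDiag.1 (i + 2)) := fun i => by
    have := h2 i 1
    rw [form_rot_regularDiag, rot_snd, if_pos rfl, real_inner_smul_left, real_inner_self_eq_norm_sq,
      norm_one] at this
    linarith
  rw [form_cross_self_self] at hc
  simp only [form_apply, hz, inner_zero_left, Fin.sum_univ_three] at hn hc
  rw [tr_apply] at htr
  have o0 := ho 0
  have o1 := ho 1
  have o2 := ho 2
  simp [regularDiag] at o0 o1 o2 hc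
  refine Prod.ext (funext fun j => ?_) (funext hz)
  have e1 : z.1 1 = 0 := by
    rcases hc with (h | h) | h
    · nlinarith
    · exact h
    · nlinarith
  have e2 : z.1 2 = -z.1 0 := by linarith
  have e0 : z.1 0 = 1 := by
    rw [e1, e2] at hn
    nlinarith
  fin_cases j <;> simp [regularDiag, e0, e1, e2]

/-- The preimage of `diag(1, 0, -1)`. -/
def regularVec : Fin 8 → ℝ := hermModelEight.ofHerm regularDiag

theorem toHerm_regularVec : hermModelEight.toHerm regularVec = regularDiag :=
  hermModelEight.toHerm_ofHerm_of_tr (by simp [tr_apply, regularDiag])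

/-- Maximise the pairing of k h v with v, the vector of diag(1, 0, -1), over the compact set of k of
sign +1. At a maximum the conditions along every one-parameter subgroup are those of
`eq_regularDiag`; the norm and the cubic form are preserved by the group. -/
theorem exists_signKer_mulVec {h : specialOrthogonalGroup (Fin 8) ℝ} (hh : h ∈ stabGroup 8) :
    ∃ k ∈ stabGroup 8, HasSign k.1 1 ∧ (k * h).1 *ᵥ regularVec = regularVec := by
  obtain ⟨k, hk, hmax⟩ := isCompact_signKer.exists_isMaxOn ⟨1, one_mem_signKer⟩
    (f := fun k => (k *ᵥ (h.1 *ᵥ regularVec)) ⬝ᵥ regularVec)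
    (Continuous.continuousOn (Continuous.dotProduct
      (continuous_id.matrix_mulVec continuous_const) continuous_const))
  obtain ⟨⟨k, hks, rfl⟩, hk'⟩ := id hk
  refine ⟨k, hks, hk', ?_⟩
  set y := (k * h).1 *ᵥ regularVec with hy
  have hy' : k.1 *ᵥ (h.1 *ᵥ regularVec) = y := mulVec_mulVec _ _ _
  have hcond : ∀ D ∈ complexComp.der,
      form (D (hermModelEight.toHerm y)) regularDiag = 0 ∧
        form (D (D (hermModelEight.toHerm y))) regularDiag ≤ 0 := by
    intro D hD
    have hE := hermModelEight.ofHerm_der_mem hD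
    set E := LinearMap.toMatrix' (hermModelEight.ofHerm ∘ₗ D ∘ₗ hermModelEight.toHerm) with hEdef
    have hEx : ∀ x, hermModelEight.toHerm (E *ᵥ x) = D (hermModelEight.toHerm x) := fun x => by
      rw [hEdef, HermModel.toMatrix_ofHerm_mulVec, HermModel.toHerm_ofHerm_of_tr _ (hD.1 _)]
    have := exp_conditions_of_max (D := E) (x := regularVec) (y := y) fun t => by
      have := hmax (exp_mul_mem_signKer hE hk t)
      simp only [Set.mem_ofPred_eq, ← mulVec_mulVec, hy'] at this
      exact this
    rw [← toHerm_regularVec, ← hEx, ← hEx, HermModel.form_toHerm, HermModel.form_toHerm]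
    exact ⟨by rw [this.1, mul_zero], by linarith [this.2]⟩
  have hg := mul_mem hks hh
  have hnorm : y ⬝ᵥ y = regularVec ⬝ᵥ regularVec := by
    rw [hy, dotProduct_mulVec, ← mulVec_transpose, mulVec_mulVec,
      specialOrthogonal_transpose_mul, one_mulVec]
  have hcub := hg regularVec regularVec regularVec
  rw [upsilonForm_eq, upsilonForm_eq] at hcub
  have h1 := hermModelEight.form_toHerm regularVec regularVec
  have h2 := hermModelEight.det_self regularVec
  rw [toHerm_regularVec] at h1 h2
  have h3 : hermModelEight.toHerm y = regularDiag := by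
    refine eq_regularDiag (hermModelEight.tr_toHerm _) ?_ ?_
      (fun i d => (hcond _ (complexComp.rot_mem_der i d)).1)
      fun i d => (hcond _ (complexComp.rot_mem_der i d)).2
    · rw [HermModel.form_toHerm, hnorm, ← h1]
      simp [form_apply, regularDiag, Fin.sum_univ_three]
      norm_num
    · rw [HermModel.det_self, hcub, ← h2, form_cross_self_self]
      simp [regularDiag]
  rw [← hermModelEight.ofHerm_toHerm y, h3]
  rfl

end

noncomputable section

open Herm SymComp

/-! ### Orientation -/

/-- Entrywise multiplication of the off-diagonal entries. -/
def slotMul (w : Fin 3 → ℂ) : Herm ℂ →ₗ[ℝ] Herm ℂ where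
  toFun z := (z.1, fun i => w i * z.2 i)
  map_add' _ _ := Prod.ext rfl (funext fun _ => mul_add _ _ _)
  map_smul' c z := Prod.ext rfl (funext fun i => mul_smul_comm c (w i) (z.2 i))

/-- Entrywise conjugation. -/
def slotConj : Herm ℂ →ₗ[ℝ] Herm ℂ where
  toFun z := (z.1, fun i => star (z.2 i))
  map_add' z z' := Prod.ext rfl (funext fun i => star_add _ _)
  map_smul' c z := Prod.ext rfl (funext fun i => by simp)

theorem HermModel.toMatrix_comp {K : Type*} [NormedAddCommGroup K] [InnerProductSpace ℝ K]
    {m : SymComp K} {n : ℕ} (H : HermModel n m) (A : Herm K →ₗ[ℝ] Herm K)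
    {B : Herm K →ₗ[ℝ] Herm K} (hB : ∀ z, tr (B z) = tr z) :
    LinearMap.toMatrix' (H.ofHerm ∘ₗ (A ∘ₗ B) ∘ₗ H.toHerm) =
      LinearMap.toMatrix' (H.ofHerm ∘ₗ A ∘ₗ H.toHerm) *
        LinearMap.toMatrix' (H.ofHerm ∘ₗ B ∘ₗ H.toHerm) := by
  rw [← LinearMap.toMatrix'_comp]
  congr 1
  refine LinearMap.ext fun x => ?_
  simp only [LinearMap.comp_apply]
  rw [H.toHerm_ofHerm_of_tr (by rw [hB, H.tr_toHerm])]

theorem toMatrix_slotConj :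
    LinearMap.toMatrix' (hermModelEight.ofHerm ∘ₗ slotConj ∘ₗ hermModelEight.toHerm) =
      diagonal ![1, 1, 1, 1, 1, -1, -1, -1] := by
  refine eq_of_mulVec fun x => ?_
  rw [HermModel.toMatrix_ofHerm_mulVec]
  have : slotConj (hermModelEight.toHerm x) =
      hermModelEight.toHerm (diagonal ![1, 1, 1, 1, 1, -1, -1, -1] *ᵥ x) := by
    refine Prod.ext (funext fun i => ?_) (funext fun i => ?_)
    · fin_cases i <;> simp [slotConj, hermModelEight, complexHerm, mulVec_diagonal]
    · fin_cases i <;> apply Complex.ext <;>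
        simp [slotConj, hermModelEight, complexHerm, mulVec_diagonal]
  rw [this, HermModel.ofHerm_toHerm]

/-- Complex numbers have square roots, so the entrywise multiplication is a square and has
nonnegative determinant, while conjugation reverses three coordinates of ℝ⁸. -/
theorem det_slotConj_neg (r : Fin 3 → ℂ) :
    (LinearMap.toMatrix' (hermModelEight.ofHerm ∘ₗ (slotMul r ∘ₗ slotConj) ∘ₗ
      hermModelEight.toHerm)).det ≤ 0 := by
  have hw : ∀ i, ∃ w : ℂ, r i = w * w := fun i =>
    IsAlgClosed.exists_eq_mul_self (r i)
  choose w hw using hw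
  have hr : slotMul r = slotMul w ∘ₗ slotMul w := by
    refine LinearMap.ext fun z => Prod.ext rfl (funext fun i => ?_)
    simp only [slotMul, LinearMap.coe_mk, AddHom.coe_mk, LinearMap.comp_apply]
    rw [hw, mul_assoc]
  rw [hermModelEight.toMatrix_comp _ fun z => rfl, toMatrix_slotConj, hr,
    hermModelEight.toMatrix_comp _ fun z => rfl, det_mul, det_mul, det_diagonal]
  simp [Fin.prod_univ_eight]
  exact mul_self_nonneg _

theorem hermBracket_regularDiag (z : Herm ℂ) : hermBracket regularDiag z =
    (0, fun j => (regularDiag.1 (j + 2) - regularDiag.1 (j + 1)) • (Complex.I * z.2 j)) := by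
  have h : ∀ j, regularDiag.2 j = 0 := fun j => rfl
  refine Prod.ext (funext fun j => ?_) (funext fun j => ?_)
  · rw [hermBracket_fst]
    simp [h]
  · rw [hermBracket_snd]
    simp [h, mulI_apply]

/-- Let v = diag(1, 0, -1). Fixing v, the element commutes with multiplication by v, so it preserves
the three complex lines and fixes the diagonal matrices. Sign -1 makes it anticommute with w ↦ i[v,
w], hence conjugate-linear on the lines, and its determinant cannot be 1. -/
theorem not_hasSign_neg_one {g : specialOrthogonalGroup (Fin 8) ℝ} (hg : g ∈ stabGroup 8)
    (hfix : g.1 *ᵥ regularVec = regularVec) : ¬ HasSign g.1 (-1) := by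
  intro hs
  set H := hermModelEight with hH
  have hgg := specialOrthogonal_transpose_mul g
  set G := H.lift g.1 with hG
  have hι : H.toHerm regularVec = regularDiag := toHerm_regularVec
  have hGι : ∀ x, G (H.toHerm x) = H.toHerm (g.1 *ᵥ x) := fun x => by
    rw [hG, HermModel.lift_apply, HermModel.ofHerm_toHerm]
  have hdot : ∀ x y, (g.1 *ᵥ x) ⬝ᵥ (g.1 *ᵥ y) = x ⬝ᵥ y := fun x y => by
    rw [dotProduct_mulVec, ← mulVec_transpose, mulVec_mulVec, hgg, one_mulVec]
  have hmul : ∀ x, g.1 *ᵥ (mulMat regularVec *ᵥ x) = mulMat regularVec *ᵥ (g.1 *ᵥ x) := fun x => by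
    have := mulMat_orthogonal hgg hg regularVec
    rw [hfix] at this
    conv_rhs => rw [this]
    rw [mulVec_mulVec, mulVec_mulVec, Matrix.mul_assoc, hgg, Matrix.mul_one]
  -- Adding this multiple of the unit turns the cross product into the trace-free product by v, with
  -- which the element commutes.
  have hcross : ∀ z, tr z = 0 → G (complexComp.cross regularDiag z + (form regularDiag z / 6) •
      Herm.one) = complexComp.cross regularDiag (G z) + (form regularDiag z / 6) • Herm.one := by
    intro z hz
    obtain ⟨x, rfl⟩ := H.surj z hz
    rw [hGι, ← hι, H.cross_toHerm, H.cross_toHerm, H.form_toHerm, mul_div_cancel_left₀ _ (by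
        norm_num),
      sub_add_cancel, hGι, hmul, ← hfix, hdot, hfix, sub_add_cancel]
  have hbr : ∀ z, tr z = 0 → G (hermBracket regularDiag z) = -hermBracket regularDiag (G z) := by
    intro z hz
    obtain ⟨x, rfl⟩ := H.surj z hz
    rw [hGι, ← hι, ← toHerm_bracketMap_mulVec, ← toHerm_bracketMap_mulVec, hGι, mulVec_mulVec, hs,
      hfix, neg_one_smul, neg_mulVec, map_neg, mulVec_mulVec]
  have hoff : ∀ (i : Fin 3) (X : ℂ), tr (off i X) = 0 := fun i X => by simp [tr_apply, off_fst]
  have hs0 : ∀ i : Fin 3, regularDiag.1 (i + 2) - regularDiag.1 (i + 1) ≠ 0 := by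
    intro i
    match i with
    | 0 => exact show (-1 : ℝ) - 0 ≠ 0 by norm_num
    | 1 => exact show (1 : ℝ) - -1 ≠ 0 by norm_num
    | 2 => exact show (0 : ℝ) - 1 ≠ 0 by norm_num
  have hI : ∀ (i : Fin 3) (X : ℂ), hermBracket regularDiag (off i X) =
      (regularDiag.1 (i + 2) - regularDiag.1 (i + 1)) • off i (Complex.I * X) := by
    intro i X
    rw [hermBracket_regularDiag]
    refine Prod.ext (funext fun j => ?_) (funext fun j => ?_)
    · simp [off_fst]
    · simp only [off_snd, Prod.smul_snd, Pi.smul_apply]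
      split_ifs with h
      · rw [h]
      · simp
  have hGI : ∀ (i : Fin 3) (X : ℂ),
      (regularDiag.1 (i + 2) - regularDiag.1 (i + 1)) • G (off i (Complex.I * X)) =
        -hermBracket regularDiag (G (off i X)) := fun i X => by
    rw [← map_smul, ← hI, hbr _ (hoff i X)]
  have hfst : ∀ (i : Fin 3) (X : ℂ) j, (G (off i X)).1 j = 0 := by
    intro i X j
    -- Up to a nonzero scalar the element of slot i is itself a bracket with diag(1, 0, -1), and
    -- such brackets have zero diagonal.
    have := congrArg (fun z : Herm ℂ => z.1 j) (hGI i (-Complex.I * X))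
    rw [hermBracket_regularDiag, neg_mul, mul_neg, ← mul_assoc, Complex.I_mul_I] at this
    simp only [neg_mul, one_mul, neg_neg, Prod.smul_fst, Pi.smul_apply, Prod.fst_neg, Pi.neg_apply,
      Pi.zero_apply, neg_zero] at this
    exact (smul_eq_zero.1 this).resolve_left (hs0 i)
  -- On slot i the cross product with diag(1, 0, -1) is multiplication by minus half its i-th entry;
  -- the three values are distinct, so the slots cannot mix.
  have hsnd : ∀ (i : Fin 3) (X : ℂ) j, j ≠ i → (G (off i X)).2 j = 0 := by
    intro i X j hj
    have h5 : ∀ j, regularDiag.2 j = 0 := fun j => rfl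
    have h1 := hcross _ (hoff i X)
    have h2 : form regularDiag (off i X) = 0 := by
      rw [form_off]
      simp [regularDiag]
    have h3 : complexComp.cross regularDiag (off i X) =
        (-(1 / 2) * regularDiag.1 i) • off i X := by
      refine Prod.ext (funext fun j => ?_) (funext fun j => ?_)
      · rw [cross_fst]
        simp [off_fst, regularDiag]
      · rw [cross_snd]
        simp only [h5, map_zero, LinearMap.zero_apply, add_zero, zero_sub, smul_zero, sub_zero,
          off_snd, off_fst, Prod.smul_snd, Pi.smul_apply]
        split_ifs with h
        · rw [h]
          module
        · simp
    rw [h2, zero_div, zero_smul, add_zero, add_zero, h3, map_smul] at h1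
    have h4 := congrArg (fun z : Herm ℂ => z.2 j) h1
    simp only [cross_snd, hfst, Prod.smul_snd, Pi.smul_apply] at h4
    simp only [h5, map_zero, LinearMap.zero_apply, add_zero, zero_sub, smul_zero, sub_zero,
      smul_neg] at h4
    have h6 : (regularDiag.1 j - regularDiag.1 i) • (G (off i X)).2 j = 0 := by
      linear_combination (norm := module) (2 : ℝ) • h4
    refine (smul_eq_zero.1 h6).resolve_left ?_
    revert hj
    match i, j with
    | 0, 0 | 1, 1 | 2, 2 => exact fun h => absurd rfl h
    | 0, 1 => exact fun _ => show (0 : ℝ) - 1 ≠ 0 by norm_num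
    | 0, 2 => exact fun _ => show (-1 : ℝ) - 1 ≠ 0 by norm_num
    | 1, 0 => exact fun _ => show (1 : ℝ) - 0 ≠ 0 by norm_num
    | 1, 2 => exact fun _ => show (-1 : ℝ) - 0 ≠ 0 by norm_num
    | 2, 0 => exact fun _ => show (1 : ℝ) - -1 ≠ 0 by norm_num
    | 2, 1 => exact fun _ => show (0 : ℝ) - -1 ≠ 0 by norm_num
  have hoffI : ∀ (i : Fin 3) (X : ℂ), (G (off i (Complex.I * X))).2 i =
      -(Complex.I * (G (off i X)).2 i) := by
    intro i X
    have := congrArg (fun z : Herm ℂ => z.2 i) (hGI i X)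
    simp only [hermBracket_regularDiag, Prod.smul_snd, Pi.smul_apply, Prod.snd_neg,
      Pi.neg_apply, ← smul_neg] at this
    exact smul_right_injective ℂ (hs0 i) this
  have hGoff : ∀ (i : Fin 3) (X : ℂ), G (off i X) = off i ((G (off i 1)).2 i * star X) := by
    intro i X
    refine Prod.ext (funext fun j => ?_) (funext fun j => ?_)
    · rw [hfst, off_fst]
    · rw [off_snd]
      split_ifs with h
      · subst h
        have hX : off j X = X.re • off j (1 : ℂ) + X.im • off j (Complex.I * 1) := by
          rw [← map_smul, ← map_smul, ← map_add]
          congr 1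
          apply Complex.ext <;> simp
        rw [hX, map_add, map_smul, map_smul, Prod.snd_add, Pi.add_apply, Prod.smul_snd,
          Prod.smul_snd, Pi.smul_apply, Pi.smul_apply, hoffI]
        apply Complex.ext <;> simp <;> ring
      · exact hsnd i X j h
  have hGdiag : ∀ a : Fin 3 → ℝ, a 0 + a 1 + a 2 = 0 → G (a, 0) = (a, 0) := by
    have h0 : G regularDiag = regularDiag := by rw [← hι, hGι, hfix]
    have htr0 : tr regularDiag = 0 := by rw [← hι, H.tr_toHerm]
    have h1 := hcross _ htr0
    rw [h0] at h1
    intro a ha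
    -- The trace-free part of v × v is diag(1/3, -2/3, 1/3), which together with v = diag(1, 0, -1)
    -- spans the trace-free diagonal matrices.
    have h2 : ((a, 0) : Herm ℂ) = (a 0 + a 1 / 2) • regularDiag + (-(3 / 2) * a 1) •
        (complexComp.cross regularDiag regularDiag + (form regularDiag regularDiag / 6) •
      Herm.one) := by
      have e : form regularDiag regularDiag = 2 := by
        simp [form_apply, regularDiag, Fin.sum_univ_three]
        norm_num
      rw [e]
      refine Prod.ext (funext fun j => ?_) (funext fun j => ?_)
      · simp only [Prod.fst_add, Prod.smul_fst, Pi.add_apply, Pi.smul_apply, cross_fst]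
        fin_cases j <;> simp [regularDiag, Herm.one] <;> linarith
      · simp only [Prod.snd_add, Prod.smul_snd, Pi.add_apply, Pi.smul_apply, cross_snd]
        simp [regularDiag, Herm.one]
    rw [h2, map_add, map_smul, map_smul, h0, h1]
  have hfinal : g.1 = LinearMap.toMatrix' (H.ofHerm ∘ₗ
      (slotMul (fun i => (G (off i 1)).2 i) ∘ₗ slotConj) ∘ₗ H.toHerm) := by
    refine eq_of_mulVec fun x => ?_
    rw [HermModel.toMatrix_ofHerm_mulVec, ← H.ofHerm_toHerm (g.1 *ᵥ x), ← hGι]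
    congr 1
    have htr := H.tr_toHerm x
    set z := H.toHerm x with hz
    have h1 : z = (z.1, 0) + ∑ i, off i (z.2 i) := by
      refine Prod.ext (funext fun j => ?_) (funext fun j => ?_)
      · simp [Prod.fst_sum, off_fst]
      · simp [Prod.snd_sum, off_snd]
    conv_lhs => rw [h1]
    rw [map_add, hGdiag _ (by rwa [tr_apply] at htr), map_sum]
    simp only [fun i => hGoff i (z.2 i)]
    refine Prod.ext (funext fun j => ?_) (funext fun j => ?_)
    · simp [Prod.fst_sum, off_fst, slotMul, slotConj]
    · simp [Prod.snd_sum, off_snd, slotMul, slotConj]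
  have hdet := (mem_specialOrthogonalGroup_iff.1 g.2).2
  have hle := det_slotConj_neg fun i => (G (off i 1)).2 i
  rw [← hH, ← hfinal, hdet] at hle
  linarith

theorem hasSign_one {h : specialOrthogonalGroup (Fin 8) ℝ} (hh : h ∈ stabGroup 8) :
    HasSign h.1 1 := by
  refine (hasSign_or hh).resolve_right fun hs => ?_
  obtain ⟨k, hk, hk', hfix⟩ := exists_signKer_mulVec hh
  refine not_hasSign_neg_one (mul_mem hk hh) hfix ?_
  have := hk'.mul hs
  rwa [one_mul] at this

/-- Both lines carry the trivial representation: one is spanned by the identity matrix, the other by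
a three-form of sign +1. -/
theorem isoAsRep_eight : IsoAsRep 8 (Module.End.eigenspace (upsilonHat 8) 20)
    (stabLieTensor 8 ⊓ wedgeThree 8) := by
  rw [eigenspace_eq_span_one hermModelEight.cartanCubic, inf_eq_span_bracketTensor]
  have h1 : (1 : Matrix (Fin 8) (Fin 8) ℝ) ≠ 0 := one_ne_zero
  refine ⟨(LinearEquiv.toSpanNonzeroSingleton ℝ _ _ h1).symm ≪≫ₗ
    LinearEquiv.toSpanNonzeroSingleton ℝ _ _ bracketTensor_ne_zero, fun h hh F => ?_⟩
  have hF : h.1 * F.1 * h.1ᵀ = F.1 := by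
    obtain ⟨c, hc⟩ := Submodule.mem_span_singleton.1 F.2
    rw [← hc, Matrix.mul_smul, Matrix.smul_mul, Matrix.mul_one, specialOrthogonal_mul_transpose]
  have hFmem : h.1 * F.1 * h.1ᵀ ∈ Submodule.span ℝ {(1 : Matrix (Fin 8) (Fin 8) ℝ)} := by
    rw [hF]
    exact F.2
  refine ⟨hFmem, ?_⟩
  have hF' : (⟨_, hFmem⟩ : Submodule.span ℝ {(1 : Matrix (Fin 8) (Fin 8) ℝ)}) = F :=
    Subtype.ext hF
  rw [hF']
  set Γ := ((LinearEquiv.toSpanNonzeroSingleton ℝ _ _ h1).symm ≪≫ₗ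
    LinearEquiv.toSpanNonzeroSingleton ℝ _ _ bracketTensor_ne_zero) F
  obtain ⟨c, hc⟩ := Submodule.mem_span_singleton.1 Γ.2
  have h2 := hasSign_iff.1 (hasSign_one hh)
  rw [one_smul] at h2
  have h3 : (c • bracketTensor).1 = tensorAct h.1 (c • bracketTensor).1 := by
    refine (toTensor_slice _).symm.trans ((congrArg toTensor (LinearMap.ext fun x => ?_)).trans
      (toTensor_slice _))
    have h4 := slice_tensorAct h.1 bracketTensor.1 x
    rw [h2] at h4
    rw [slice_tensorAct, Submodule.coe_smul, slice_smul, slice_smul, h4, Matrix.mul_smul,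
      Matrix.smul_mul]
  rwa [hc] at h3

end

/-! ### The proposition, assembled from the four models. -/

theorem mainTheorem2 :
    (∀ n : ℕ, n = 5 ∨ n = 14 →
      LinearMap.ker (upsilonPrime n) = stabLieTensor n ⊔ wedgeThree n ∧
      stabLieTensor n ⊓ wedgeThree n = ⊥) ∧
    (LinearMap.ker (upsilonPrime 8) = stabLieTensor 8 ⊔ wedgeThree 8 ∧
      Module.finrank ℝ ↥(stabLieTensor 8 ⊓ wedgeThree 8) = 1 ∧
      IsoAsRep 8 (Module.End.eigenspace (upsilonHat 8) 20) (stabLieTensor 8 ⊓ wedgeThree 8)) ∧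
    (stabLieTensor 26 ⊓ wedgeThree 26 = ⊥ ∧
      ∃ W : Submodule ℝ (wedgeTwoTensor 26),
        IsoAsRep 26 (Module.End.eigenspace (upsilonHat 26) 28) W ∧
        Module.finrank ℝ W = 52 ∧
        (stabLieTensor 26 ⊔ wedgeThree 26) ⊓ W = ⊥ ∧
        LinearMap.ker (upsilonPrime 26) = stabLieTensor 26 ⊔ wedgeThree 26 ⊔ W) := by
  refine ⟨?_, ⟨hermModelEight.ker_eq_of_ne Complex.orthonormalBasisOneI (by norm_num),
    finrank_inf_eight, isoAsRep_eight⟩, ?_⟩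
  · rintro n (rfl | rfl)
    · have e := EuclideanSpace.basisFun (Fin 1) ℝ
      exact ⟨hermModelFive.ker_eq_of_ne e (by norm_num), hermModelFive.inf_eq_bot e (by norm_num)⟩
    · have e := EuclideanSpace.basisFun (Fin 4) ℝ
      exact ⟨hermModelFourteen.ker_eq_of_ne e (by norm_num),
        hermModelFourteen.inf_eq_bot e (by norm_num)⟩
  · have e := EuclideanSpace.basisFun (Fin 8) ℝ
    have hb := hermModelTwentySix.inf_eq_bot e (by norm_num)
    have hc := hermModelTwentySix.cartanCubic
    exact ⟨hb, LinearMap.range (anticommMap 26), hc.isoAsRep, hc.finrank_range,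
      inf_range_anticommMap hc hb, hermModelTwentySix.ker_eq e⟩
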